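/- **Setting.** Let $M,\bar M$ be smooth $n$-dimensional manifolds without boundary, topologically embedded as dense subsets of compact metrizable spaces $\mathrm{cl}\,M$, $\mathrm{cl}\,\bar M$. Let $c:\mathrm{cl}\,M\times\mathrm{cl}\,\bar M\to\mathbf R\cup\{+\infty\}$ be continuous, let $N\subset M\times\bar M$ be open, and write $\bar N(x)=\{\bar x\in\bar M:(x,\bar x)\in N\}$, $N(\bar x)=\{x\in M:(x,\bar x)\in N\}$. *Cost.* Assume: (A0) $c$ is finite and $C^4$ on $N$; (A1) for every $x\in M$ the map $\bar x\mapsto -Dc(x,\bar x)\in T_x^*M$ is injective on $\bar N(x)$, where $D$ is the derivative in the first variable; (A2) the matrix $(c_{i\bar\jmath})$ of mixed second derivatives is invertible on $N$; (A3w) for the pseudo-metric $h=\frac12\begin{pmatrix}0&-\bar DDc\\-D\bar Dc&0\end{pmatrix}$ on $N$, with Riemann tensor $R$ (sign convention: round spheres are positively curved), $\sec\,(p\oplus0)\wedge(0\oplus\bar p):=R(P,Q,P,Q)\ge0$, where $P=p\oplus0$ and $Q=0\oplus\bar p$, whenever $h(p\oplus\bar p,p\oplus\bar p)=0$. *Convexity.*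 Two points of $W\subset\mathrm{cl}\,N$ are linked in $W$ if there is a geodesic of $(N,h)$, defined on a (possibly unbounded) open interval and lying in $W$, whose limits at the two ends of the interval are these points; $W$ is geodesically convex if any two distinct points of $W$ are linked in $W$. A set $\bar\Omega\subset\mathrm{cl}\,\bar M$ appears convex from $x\in M$ if $\bar\Omega\subset\mathrm{cl}\,\bar N(x)$ and $\{x\}\times\bar\Omega$ is geodesically convex; symmetrically for $\Omega\subset\mathrm{cl}\,M$ and $\bar x\in\bar M$. $N$ is horizontally convex if $N(\bar x)$ appears convex from $\bar x$ for every $\bar x\in\bar M$. *Mountains.* A mountain focused at $\bar x\in\mathrm{cl}\,\bar M$ is a function $f=-c(\cdot,\bar x)+\lambda$ on $\mathrm{cl}\,M$ with $\lambda\in\mathbf R$ (it is $-\infty$ where $c=+\infty$). For $u:\mathrm{cl}\,M\to\mathbf R\cup\{+\infty\}$, $f$ supports $u$ to first order at $x\in M$ if $u(x)=f(x)<\infty$ and $u(y)\ge f(y)+o(|y-x|)$ as $y\to x$. The subdifferential $\partial f(x)\subset T_x^*M$ consists of the $q^*$ with $f(y)\ge f(x)+q^*(y-x)+o(|y-x|)$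 in local coordinates. $u\in\mathcal S^{-c}_{\mathrm{cl}\,\bar M}$ means that $u$ is finite somewhere on $M$ and $u=\sup_{\bar x\in\mathrm{cl}\,\bar M}\,(-c(\cdot,\bar x)-v(\bar x))$ for some $v:\mathrm{cl}\,\bar M\to\mathbf R\cup\{+\infty\}$. $\partial^cu(a)$ is the set of $\bar x\in\mathrm{cl}\,\bar M$ with $c(a,\bar x)<\infty$ and $u(b)+c(b,\bar x)\ge u(a)+c(a,\bar x)$ for all $b\in\mathrm{cl}\,M$, and $\mathrm{Dom}\,\partial^cu=\{a:\partial^cu(a)\ne\emptyset\}$. *Extended twist (A1′).* Put $\mathrm{Dom}(c\text{-Exp}_y)=-Dc(y,\bar N(y))\subset T_y^*M$ and $\mathrm{Dom}(c\text{-Exp})=\{(y,p^*)\in T^*M:p^*\in\mathrm{Dom}(c\text{-Exp}_y)\}$. Every mountain has non-empty subdifferential at each point of $M$ where it is finite, and there is a continuous map $c\text{-Exp}'$ from the closure of $\mathrm{Dom}(c\text{-Exp})$ in $T^*M$ to $\mathrm{cl}\,\bar M$ such that for every mountain $f$, focused at $\bar x$, every $y\in M$ with $f(y)$ finite and every extreme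 point $p^*$ of $\partial f(y)$, $(y,p^*)$ lies in this closure and $c\text{-Exp}'_y\,p^*=\bar x$. **Theorem (Mountains supporting to first order support globally).** Let $c$ satisfy (A0), (A1), (A2), (A3w) and (A1′) with $N$ horizontally convex. Assume that whenever $(x_k,\bar x_k)\in M\times\mathrm{cl}\,\bar M$ converges in $M\times\mathrm{cl}\,\bar M$, $c(x_k,\bar x_k)<\infty$, $c(\cdot,\bar x_k)$ is differentiable at $x_k$, and $c(x_k,\bar x_k)\to+\infty$, then $|Dc(x_k,\bar x_k)|\to+\infty$ (norm in coordinates near $\lim x_k$). Fix $x\in M$ such that 1. $\mathrm{cl}\,\bar M$ appears convex from $x$; 2. $\bigcap_{0<t<1}N(\bar x(t))$ is dense in $M$ for each continuous curve $t\in[0,1]\mapsto(x,\bar x(t))\in\{x\}\times\mathrm{cl}\,\bar M$ whose restriction to $]0,1[$ is an affinely parametrized geodesic of $(N,h)$; 3. for each mountain $f$ finite at $x$, the extreme points of $\partial f(x)$ belong to the closure of $\mathrm{Dom}(c\text{-Exp}_x)$ in $T_x^*M$. Let $u\in\mathcal S^{-c}_{\mathrm{cl}\,\bar M}$, and suppose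 there are a coordinate neighbourhood $U\subset M$ of $x$ on which $u$ is finite and which is contained in $\mathrm{Dom}\,\partial^cu$, and a constant $C<\infty$, such that each mountain $f$ which supports $u$ to first order at some $y\in U$ is finite on $U$ and satisfies $|\nabla f|\le C$ and $D^2f\ge -C\,\mathrm I$ distributionally in the given coordinates on $U$. Then every mountain $f$ which supports $u$ to first order at $x$ satisfies $f\le u$ on all of $\mathrm{cl}\,M$. -/

import Mathlib

open scoped Manifold ContDiff Topology

noncomputable section

/-! Pseudo-Riemannian geometry in one coordinate patch. -/

namespace PseudoRiem

variable {ι : Type*} [Fintype ι] [DecidableEq ι]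

/-- The partial derivative `∂F/∂zᵃ` at `z`. -/
def pd (a : ι) (F : (ι → ℝ) → ℝ) (z : ι → ℝ) : ℝ :=
  fderiv ℝ F z (Pi.single a 1)

/-- Levi-Civita symbols `Γ_{ab}^m = ½ h^{mk} (h_{kb,a} + h_{ak,b} - h_{ab,k})` of the metric `h`. -/
def christoffel (h : (ι → ℝ) → Matrix ι ι ℝ) (a b m : ι) (z : ι → ℝ) : ℝ :=
  (1 / 2) * ∑ k, (h z)⁻¹ m k *
    (pd a (fun y => h y k b) z + pd b (fun y => h y a k) z - pd k (fun y => h y a b) z)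

/-- `R_{abk}^m`, with the sign for which the round sphere has positive sectional curvature below. -/
def riemannUp (h : (ι → ℝ) → Matrix ι ι ℝ) (a b k m : ι) (z : ι → ℝ) : ℝ :=
  -pd a (christoffel h b k m) z + pd b (christoffel h a k m) z
    + ∑ f, (christoffel h k a f z * christoffel h b f m z
          - christoffel h k b f z * christoffel h a f m z)

/-- The Riemann tensor with all indices lowered. -/
def riemann (h : (ι → ℝ) → Matrix ι ι ℝ) (a b k l : ι) (z : ι → ℝ) : ℝ :=
  ∑ m, riemannUp h a b k m z * h z m l

/-- The (unnormalized) sectional curvature of `P ∧ Q`. -/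
def sec (h : (ι → ℝ) → Matrix ι ι ℝ) (z P Q : ι → ℝ) : ℝ :=
  ∑ a, ∑ b, ∑ k, ∑ l, riemann h a b k l z * P a * Q b * P k * Q l

end PseudoRiem

/-- Euclidean `n`-space, the model of the manifolds below. -/
abbrev Eu (n : ℕ) := EuclideanSpace ℝ (Fin n)

/-- The cotangent space `T*_x M`. -/
abbrev Cotangent (n : ℕ) {M : Type*} [TopologicalSpace M] [ChartedSpace (Eu n) M] (x : M) :=
  TangentSpace 𝓘(ℝ, Eu n) x →L[ℝ] Bundle.Trivial M ℝ x

/-- The cotangent bundle `T*M`, topologized by Mathlib as the bundle of continuous linear maps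
from `TM` to the trivial line bundle. -/
abbrev CotangentBundle (n : ℕ) (M : Type*) [TopologicalSpace M] [ChartedSpace (Eu n) M] :=
  Bundle.TotalSpace (Eu n →L[ℝ] ℝ) (fun x : M => Cotangent n x)

namespace OT

/-! Throughout, `M` and `M'` are `n`-manifolds, embedded by `i : M → K` and `i' : M' → K'` as dense
subsets of compact metrizable spaces, so that `K = cl M` and `K' = cl M'`; the cost is
`c : K → K' → EReal`, and `N` is a subset of `M × M'`. -/

variable {n : ℕ} {M M' K K' : Type*}
  [TopologicalSpace M] [ChartedSpace (Eu n) M]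
  [TopologicalSpace M'] [ChartedSpace (Eu n) M']
  [TopologicalSpace K] [TopologicalSpace K']

/-- The points of `M'` visible from `x`. -/
def visibleFrom (N : Set (M × M')) (x : M) : Set M' := {w | (x, w) ∈ N}

/-- The points of `M` visible from `w`. -/
def visibleTo (N : Set (M × M')) (w : M') : Set M := {y | (y, w) ∈ N}

/-! ### The pseudo-metric of a cost -/

section Metric

variable (n) in
/-- Coordinates of `q ∈ M × M'` in the preferred charts around the two components of `p`. -/
def coords (p q : M × M') : Fin n ⊕ Fin n → ℝ :=
  Sum.elim (fun a => chartAt (Eu n) p.1 q.1 a) (fun b => chartAt (Eu n) p.2 q.2 b)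

variable (n) (i : M → K) (i' : M' → K') (c : K → K' → EReal)

/-- The cost written in the preferred charts around the two components of `p`. -/
def localCost (p : M × M') (z : Fin n ⊕ Fin n → ℝ) : ℝ :=
  (c (i ((chartAt (Eu n) p.1).symm (WithLp.toLp 2 fun a => z (Sum.inl a))))
     (i' ((chartAt (Eu n) p.2).symm (WithLp.toLp 2 fun b => z (Sum.inr b))))).toReal

/-- The matrix `c_{a b̄}` of mixed second partial derivatives in these charts. -/
def mixedHessian (p : M × M') (z : Fin n ⊕ Fin n → ℝ) : Matrix (Fin n) (Fin n) ℝ :=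
  Matrix.of fun a b =>
    PseudoRiem.pd (Sum.inr b) (PseudoRiem.pd (Sum.inl a) (localCost n i i' c p)) z

/-- The pseudo-metric `h = ½ (0, -D̄Dc; -DD̄c, 0)` in these charts. -/
def costMetric (p : M × M') (z : Fin n ⊕ Fin n → ℝ) :
    Matrix (Fin n ⊕ Fin n) (Fin n ⊕ Fin n) ℝ :=
  (1 / 2 : ℝ) • Matrix.fromBlocks 0 (-mixedHessian n i i' c p z)
    (-(mixedHessian n i i' c p z).transpose) 0

/-- The curve `γ` stays in `N` and is (affinely parametrized) geodesic for the pseudo-metric at all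
times of the open set `I`. -/
def IsGeodesicOn (N : Set (M × M')) (γ : ℝ → M × M') (I : Set ℝ) : Prop :=
  ContinuousOn γ I ∧ (∀ t ∈ I, γ t ∈ N) ∧
  ∀ t ∈ I, ContDiffAt ℝ 2 (fun s => coords n (γ t) (γ s)) t ∧
    ∀ m, deriv (deriv fun s => coords n (γ t) (γ s) m) t
      + ∑ a, ∑ b, PseudoRiem.christoffel (costMetric n i i' c (γ t)) a b m (coords n (γ t) (γ t))
          * deriv (fun s => coords n (γ t) (γ s) a) t
          * deriv (fun s => coords n (γ t) (γ s) b) t = 0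

/-- `p` and `q` are linked by a geodesic of `N` inside `W`: a geodesic on an open interval (which
may be unbounded, as when an end point of the geodesic on the boundary of `N` is infinitely
far) whose limits at the two ends of the interval are `p` and `q`. -/
def LinkedIn (N : Set (M × M')) (W : Set (K × K')) (p q : K × K') : Prop :=
  ∃ (I : Set ℝ) (γ : ℝ → M × M'), IsOpen I ∧ I.OrdConnected ∧ I.Nonempty ∧
    IsGeodesicOn n i i' c N γ I ∧ (∀ t ∈ I, (i (γ t).1, i' (γ t).2) ∈ W) ∧
    Filter.Tendsto (fun t : I => (i (γ t).1, i' (γ t).2)) Filter.atBot (𝓝 p) ∧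
    Filter.Tendsto (fun t : I => (i (γ t).1, i' (γ t).2)) Filter.atTop (𝓝 q)

/-- Geodesic convexity of `W ⊆ cl N`: distinct points of `W` are linked in `W` by a geodesic of
`N`, whose end points may lie on the boundary of `N`. -/
def GeodesicallyConvex (N : Set (M × M')) (W : Set (K × K')) : Prop :=
  ∀ p ∈ W, ∀ q ∈ W, p ≠ q → LinkedIn n i i' c N W p q

/-- `W' ⊆ cl M'` appears convex from `x ∈ M`. -/
def AppearsConvexFrom (N : Set (M × M')) (x : M) (W' : Set K') : Prop :=
  W' ⊆ closure (i' '' visibleFrom N x) ∧ GeodesicallyConvex n i i' c N ({i x} ×ˢ W')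

/-- `W ⊆ cl M` appears convex from `w ∈ M'`. -/
def AppearsConvexTo (N : Set (M × M')) (w : M') (W : Set K) : Prop :=
  W ⊆ closure (i '' visibleTo N w) ∧ GeodesicallyConvex n i i' c N (W ×ˢ {i' w})

/-- `N` is horizontally convex. -/
def HorizontallyConvex (N : Set (M × M')) : Prop :=
  ∀ w : M', AppearsConvexTo n i i' c N w (i '' visibleTo N w)

/-! ### Conditions on the cost -/

/-- Smoothness: the cost is finite and four times continuously differentiable on `N`. -/
def SmoothOn (N : Set (M × M')) : Prop :=
  (∀ p ∈ N, c (i p.1) (i' p.2) < ⊤) ∧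
  ContMDiffOn (𝓘(ℝ, Eu n).prod 𝓘(ℝ, Eu n)) 𝓘(ℝ, ℝ) 4
    (fun p : M × M' => (c (i p.1) (i' p.2)).toReal) N

/-- Non-degeneracy: `p̄ ↦ c_{a b̄} p̄^b̄` is bijective at each point of `N`. -/
def NonDegenerate (N : Set (M × M')) : Prop :=
  ∀ p ∈ N, Function.Bijective (mixedHessian n i i' c p (coords n p p)).mulVec

/-- Weak regularity on `N`: non-degeneracy, and `sec (P ⊕ 0) ∧ (0 ⊕ P') ≥ 0` for all null vectors
`P ⊕ P'`. -/
def WeaklyRegular (N : Set (M × M')) : Prop :=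
  NonDegenerate n i i' c N ∧
  ∀ p ∈ N, ∀ P P' : Fin n → ℝ,
    (Sum.elim P P') ⬝ᵥ (costMetric n i i' c p (coords n p p)).mulVec (Sum.elim P P') = 0 →
    0 ≤ PseudoRiem.sec (costMetric n i i' c p) (coords n p p) (Sum.elim P 0) (Sum.elim 0 P')

end Metric

section Twist

variable (n) (i : M → K) (i' : M' → K') (c : K → K' → EReal)

/-- The covector `-Dc(x, w)` at `x`, for `w ∈ cl M'`. -/
def negDc (x : M) (w : K') : Cotangent n x :=
  -(mfderiv 𝓘(ℝ, Eu n) 𝓘(ℝ, ℝ) (fun y : M => (c (i y) w).toReal) x : Cotangent n x)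

/-- Twist: for each `x`, the map `w ↦ -Dc(x, w)` is injective on the points visible from `x`. -/
def Twisted (N : Set (M × M')) : Prop :=
  ∀ x : M, Set.InjOn (fun w : M' => negDc n i c x (i' w)) (visibleFrom N x)

/-- The domain `-Dc(x, N(x)) ⊆ T*_x M` of the cost exponential at `x`. -/
def domCExpAt (N : Set (M × M')) (x : M) : Set (Cotangent n x) :=
  (fun w : M' => negDc n i c x (i' w)) '' visibleFrom N x

/-- The domain of the cost exponential, as a subset of `T*M`. -/
def domCExp (N : Set (M × M')) : Set (CotangentBundle n M) :=
  {q | q.2 ∈ domCExpAt n i i' c N q.1}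

end Twist

/-! ### Mountains and `c`-convex functions -/

section Mountains

/-- The mountain `-c(·, w) + lam` on `cl M`, focused at `w ∈ cl M'`. -/
def mountain (c : K → K' → EReal) (w : K') (lam : ℝ) : K → EReal :=
  fun a => -c a w + (lam : EReal)

/-- The subdifferential at `x ∈ M` of `u`, computed in the preferred chart around `x` (through which
`T_x M` is identified with the model space). -/
def subdifferential (n : ℕ) {M : Type*} [TopologicalSpace M] [ChartedSpace (Eu n) M]
    (u : M → EReal) (x : M) : Set (Cotangent n x) :=
  {q | ∀ ε : ℝ, 0 < ε → ∀ᶠ y in 𝓝 x,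
    u x + ((q (chartAt (Eu n) x y - chartAt (Eu n) x x : Eu n) : ℝ) : EReal)
      ≤ u y + ((ε * ‖chartAt (Eu n) x y - chartAt (Eu n) x x‖ : ℝ) : EReal)}

/-- `c`-convex functions with foci in `W' ⊆ cl M'`: functions `u : cl M → ℝ ∪ {+∞}`, finite
somewhere on `M`, of the form `u(a) = sup_{w ∈ W'} -c(a, w) - v(w)` with `v : W' → ℝ ∪ {+∞}`. -/
def IsCConvex (i : M → K) (c : K → K' → EReal) (W' : Set K') (u : K → EReal) : Prop :=
  (∀ a, u a ≠ ⊥) ∧ (∃ x : M, u (i x) < ⊤) ∧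
  ∃ v : K' → EReal, (∀ w ∈ W', v w ≠ ⊥) ∧ ∀ a, u a = ⨆ w ∈ W', (-c a w - v w)

/-- The `c`-contact set `∂ᶜu(a) ⊆ cl M'` at `a ∈ cl M`. -/
def contactSet (c : K → K' → EReal) (u : K → EReal) (a : K) : Set K' :=
  {w | c a w < ⊤ ∧ ∀ b, u a + c a w ≤ u b + c b w}

/-- `f` supports `u` to first order at `x ∈ M`: `u(x) = f(x) < ∞` and
`u(y) ≥ f(y) + o(|y - x|)` as `y → x`. -/
def SupportsToFirstOrder (n : ℕ) {M : Type*} [TopologicalSpace M] [ChartedSpace (Eu n) M]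
    (i : M → K) (u f : K → EReal) (x : M) : Prop :=
  u (i x) = f (i x) ∧ u (i x) < ⊤ ∧ ∀ ε : ℝ, 0 < ε → ∀ᶠ y in 𝓝 x,
    f (i y) ≤ u (i y) + ((ε * ‖chartAt (Eu n) x y - chartAt (Eu n) x x‖ : ℝ) : EReal)

/-- `|∇F| ≤ C` on `Ω` in the sense of distributions. -/
def DistribGradLE (Ω : Set (Eu n)) (F : Eu n → ℝ) (C : ℝ) : Prop :=
  ∀ ψ : Eu n → ℝ, ContDiff ℝ ∞ ψ → HasCompactSupport ψ → tsupport ψ ⊆ Ω →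
    ∀ v : Eu n, |∫ z, F z * fderiv ℝ ψ z v| ≤ C * ‖v‖ * ∫ z, |ψ z|

/-- `D²F ≥ -C I` on `Ω` in the sense of distributions. -/
def DistribHessGE (Ω : Set (Eu n)) (F : Eu n → ℝ) (C : ℝ) : Prop :=
  ∀ ψ : Eu n → ℝ, ContDiff ℝ ∞ ψ → HasCompactSupport ψ → tsupport ψ ⊆ Ω → (∀ z, 0 ≤ ψ z) →
    ∀ v : Eu n, -C * ‖v‖ ^ 2 * ∫ z, ψ z ≤ ∫ z, F z * fderiv ℝ (fun y => fderiv ℝ ψ y v) z v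

/-- In the coordinates `φ`, the function `f` is finite, with `|∇f| ≤ C` and `D²f ≥ -C I` in the
sense of distributions, on the coordinate neighbourhood `φ.source`. -/
def BoundsInChart (i : M → K) (φ : OpenPartialHomeomorph M (Eu n)) (C : ℝ) (f : K → EReal) :
    Prop :=
  (∀ y ∈ φ.source, f (i y) ≠ ⊥ ∧ f (i y) ≠ ⊤) ∧
  DistribGradLE φ.target (fun z => (f (i (φ.symm z))).toReal) C ∧
  DistribHessGE φ.target (fun z => (f (i (φ.symm z))).toReal) C

/-- Whenever points `(x_k, w_k)` of `M × cl M'` at which `c` is finite and differentiable in its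
first argument converge in `M × cl M'` and `c(x_k, w_k) → +∞`, then `|Dc(x_k, w_k)| → +∞`, the norm
being that of coordinates near the limit of `x_k`. -/
def GradientBlowup (n : ℕ) {M : Type*} [TopologicalSpace M] [ChartedSpace (Eu n) M]
    (i : M → K) (c : K → K' → EReal) : Prop :=
  ∀ (xs : ℕ → M) (ws : ℕ → K') (x : M) (w : K'),
    (∀ k, c (i (xs k)) (ws k) < ⊤) →
    (∀ k, MDifferentiableAt 𝓘(ℝ, Eu n) 𝓘(ℝ, ℝ) (fun y : M => (c (i y) (ws k)).toReal) (xs k)) →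
    Filter.Tendsto xs Filter.atTop (𝓝 x) → Filter.Tendsto ws Filter.atTop (𝓝 w) →
    Filter.Tendsto (fun k => c (i (xs k)) (ws k)) Filter.atTop (𝓝 ⊤) →
    Filter.Tendsto (fun k =>
        ‖fderiv ℝ (fun z : Eu n => (c (i ((chartAt (Eu n) x).symm z)) (ws k)).toReal)
          (chartAt (Eu n) x (xs k))‖) Filter.atTop Filter.atTop

/-- The extended twist condition: mountains are subdifferentiable wherever they are finite
on `M`, and there is a continuous map `X` from the closure of the domain of the cost
exponential in `T*M` to `cl M'` such that every extreme point `q` of the subdifferential at `y ∈ M`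
of a mountain focused at `w` (and finite at `y`) belongs to this closure and has `X(y, q) = w`. -/
def ExtendedTwist (n : ℕ) {M : Type*} [TopologicalSpace M] [ChartedSpace (Eu n) M]
    [IsManifold 𝓘(ℝ, Eu n) ∞ M] (i : M → K) (i' : M' → K') (c : K → K' → EReal)
    (N : Set (M × M')) : Prop :=
  (∀ (w : K') (lam : ℝ) (y : M), c (i y) w < ⊤ →
    (subdifferential n (fun z => mountain c w lam (i z)) y).Nonempty) ∧
  ∃ X : CotangentBundle n M → K', ContinuousOn X (closure (domCExp n i i' c N)) ∧
    ∀ (w : K') (lam : ℝ) (y : M), c (i y) w < ⊤ →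
      ∀ q ∈ Set.extremePoints ℝ (subdifferential n (fun z => mountain c w lam (i z)) y),
        (⟨y, q⟩ : CotangentBundle n M) ∈ closure (domCExp n i i' c N) ∧ X ⟨y, q⟩ = w

end Mountains

end OT

end

/-! Normalize each mountain to vanish at `x`. The proof has a geometric half, that the foci of the
mountains lying below `u` and touching it at `x` form a convex set when seen through `-Dc(x, ·)`,
and an analytic half, that every subgradient of `u` at `x` belongs to such a focus.

Geometric half. Let `w(t)` be a geodesic seen from `x`, so that `Dc(x, w(t))` is affine in `t`. The
sliding mountain `f_t(y) = c(x, w(t)) - c(y, w(t))` should satisfy `f_t ≤ max f_0 f_1`. Suppose that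
`y` is visible from all `w(t)` and that `∂_t f_t(y) = 0` at some time. Join `x` to `y` by the
horizontal geodesic over `w(t)`, along which `D̄c` is affine. Along it the acceleration `∂_t² c(·,
w(t))` has second derivative `-2 sec`, which is non-positive because the vanishing of `∂_t f_t(y)`
is exactly the null condition in (A3w); and it starts at `x` with slope zero because `∂_t² Dc(x,
w(t)) = 0`. Hence `∂_t² f_t(y) ≥ 0` at that time (`deriv2_cost_le`). This weak inequality alone does
not stop `∂_t f_t` from decreasing through zero. Moving `y` in a one-parameter family and a Gronwall
argument do (`exists_nonpos_before_zero`, `exists_deriv_nonpos`), so `t ↦ f_t(y)` is quasi-convex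
(`sliding_le_max`). Density and continuity extend the inequality to all of `cl M`, and then to foci
given by the closure of the domain of the exponential at `x`, where gradient blow-up keeps `c(x, ·)`
finite. A mountain below the larger of two mountains below `u` is below `u`; so the set `G` of
covectors in that closure whose exponential is in contact with `u` at `x` is closed and convex
(`isClosed_convex_contact`).

Analytic half. The distributional bounds make the mountains in contact near `x` uniformly Lipschitz
and semiconvex. Given a subgradient `q` of `u` at `x` and a direction `e`, take mountains in contact
at points approaching `x` along `e`, with subgradients `p_k`. Semiconvexity compares the values of
`u`, and a limit gives a mountain in contact at `x` with a subgradient `p` such that `q e ≤ p e`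
(`exists_contact_subgradient`). The subdifferential of that mountain is compact and convex, and its
extreme points lie in `G` by the extended twist, so it lies in `G` by Krein–Milman. Hahn–Banach then
gives `q ∈ G` (`mem_of_forall_exists_apply_le`).

Conclusion. If `f` supports `u` to first order at `x`, its subdifferential there is contained in
that of `u`, hence in `G`. An extreme point of it has the focus of `f` as exponential, so this focus
is in contact, which is the inequality `f ≤ u`. -/

noncomputable section

namespace PseudoRiem

/-! ### Partial derivatives and the chain rule along curves. -/

section Partial

variable {ι : Type*} [Fintype ι] [DecidableEq ι]

lemma pd_congr {F G : (ι → ℝ) → ℝ} {z : ι → ℝ} (h : F =ᶠ[𝓝 z] G) (a : ι) :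
    pd a F z = pd a G z := by
  rw [pd, pd, h.fderiv_eq]

lemma pd_const (a : ι) (r : ℝ) (z : ι → ℝ) : pd a (fun _ => r) z = 0 := by
  simp [pd]

lemma pd_zero_of_eventually {F : (ι → ℝ) → ℝ} {z : ι → ℝ} (a : ι)
    (h : ∀ᶠ y in 𝓝 z, F y = 0) : pd a F z = 0 := by
  rw [pd_congr (G := fun _ => (0 : ℝ)) h, pd_const]

lemma pd_contDiffAt {F : (ι → ℝ) → ℝ} {z : ι → ℝ} {m k : WithTop ℕ∞} (h : ContDiffAt ℝ k F z)
    (hmk : m + 1 ≤ k) (a : ι) : ContDiffAt ℝ m (pd a F) z :=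
  (h.fderiv_right hmk).clm_apply contDiffAt_const

lemma pd_mul {F G : (ι → ℝ) → ℝ} {z : ι → ℝ} (hF : DifferentiableAt ℝ F z)
    (hG : DifferentiableAt ℝ G z) (a : ι) :
    pd a (fun y => F y * G y) z = pd a F z * G z + F z * pd a G z := by
  simp only [pd]
  rw [fderiv_fun_mul hF hG]
  simp only [add_apply, smul_apply, smul_eq_mul]
  ring

lemma pd_sum {κ : Type*} (s : Finset κ) {F : κ → (ι → ℝ) → ℝ} {z : ι → ℝ}
    (hF : ∀ j ∈ s, DifferentiableAt ℝ (F j) z) (a : ι) :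
    pd a (fun y => ∑ j ∈ s, F j y) z = ∑ j ∈ s, pd a (F j) z := by
  simp only [pd]
  rw [fderiv_fun_sum hF, sum_apply]

lemma pd_mul_const {F : (ι → ℝ) → ℝ} {z : ι → ℝ} (hF : DifferentiableAt ℝ F z) (r : ℝ) (a : ι) :
    pd a (fun y => F y * r) z = pd a F z * r := by
  simp only [pd]
  rw [fderiv_mul_const hF]
  simp [mul_comm]

lemma pd_const_mul {F : (ι → ℝ) → ℝ} {z : ι → ℝ} (r : ℝ) (a : ι) :
    pd a (fun y => r * F y) z = r * pd a F z := by
  simp only [pd]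
  rw [show (fun y => r * F y) = r • F from rfl, fderiv_const_smul_field]
  simp

lemma pd_add {F G : (ι → ℝ) → ℝ} {z : ι → ℝ} (hF : DifferentiableAt ℝ F z)
    (hG : DifferentiableAt ℝ G z) (a : ι) :
    pd a (fun y => F y + G y) z = pd a F z + pd a G z := by
  simp only [pd]
  rw [fderiv_fun_add hF hG, add_apply]

lemma pd_comm {F : (ι → ℝ) → ℝ} {z : ι → ℝ} (h : ContDiffAt ℝ 2 F z) (a b : ι) :
    pd a (pd b F) z = pd b (pd a F) z := by
  have hd : DifferentiableAt ℝ (fderiv ℝ F) z :=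
    (h.fderiv_right (m := 1) (by norm_num)).differentiableAt (by norm_num)
  have key : ∀ a b : ι, pd a (pd b F) z =
      fderiv ℝ (fderiv ℝ F) z (Pi.single a 1) (Pi.single b 1) := by
    intro a b
    rw [pd, show pd b F = fun y => fderiv ℝ F y (Pi.single b 1) from rfl,
      fderiv_clm_apply hd (differentiableAt_const _)]
    simp
  rw [key, key]
  exact (h.isSymmSndFDerivAt (by simp)) _ _

lemma fderiv_eq_sum_pd (F : (ι → ℝ) → ℝ) (z v : ι → ℝ) :
    fderiv ℝ F z v = ∑ a, pd a F z * v a := by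
  conv_lhs => rw [← Finset.univ_sum_single v]
  rw [map_sum]
  refine Finset.sum_congr rfl fun a _ => ?_
  rw [show (Pi.single a (v a) : ι → ℝ) = v a • Pi.single a 1 by
    rw [← Pi.single_smul', smul_eq_mul, mul_one]]
  rw [map_smul, smul_eq_mul, mul_comm, pd]

lemma hasDerivAt_comp_curve {F : (ι → ℝ) → ℝ} {ζ : ℝ → ι → ℝ} {t : ℝ}
    (hF : DifferentiableAt ℝ F (ζ t)) (hζ : DifferentiableAt ℝ ζ t) :
    HasDerivAt (fun s => F (ζ s)) (∑ a, pd a F (ζ t) * deriv (fun s => ζ s a) t) t := by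
  have h := hF.hasFDerivAt.comp_hasDerivAt t hζ.hasDerivAt
  rw [fderiv_eq_sum_pd] at h
  have h' : ∀ a, deriv (fun s => ζ s a) t = deriv ζ t a := fun a =>
    (hasDerivAt_pi.1 hζ.hasDerivAt a).deriv
  simp only [h']
  exact h

lemma deriv_comp_curve {F : (ι → ℝ) → ℝ} {ζ : ℝ → ι → ℝ} {t : ℝ}
    (hF : DifferentiableAt ℝ F (ζ t)) (hζ : DifferentiableAt ℝ ζ t) :
    deriv (fun s => F (ζ s)) t = ∑ a, pd a F (ζ t) * deriv (fun s => ζ s a) t :=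
  (hasDerivAt_comp_curve hF hζ).deriv

lemma contDiffAt_deriv {E : Type*} [NormedAddCommGroup E] [NormedSpace ℝ E] {f : ℝ → E} {t : ℝ}
    {m k : WithTop ℕ∞} (h : ContDiffAt ℝ k f t) (hmk : m + 1 ≤ k) :
    ContDiffAt ℝ m (deriv f) t := by
  have : ContDiffAt ℝ m (fun s => fderiv ℝ f s 1) t :=
    (h.fderiv_right hmk).clm_apply contDiffAt_const
  simpa [fderiv_apply_one_eq_deriv] using this

lemma hasDerivAt_deriv_comp_curve {F : (ι → ℝ) → ℝ} {ζ : ℝ → ι → ℝ} {t : ℝ}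
    (hF : ContDiffAt ℝ 2 F (ζ t)) (hζ : ContDiffAt ℝ 2 ζ t) :
    HasDerivAt (deriv fun s => F (ζ s))
      (∑ a, ((∑ b, pd b (pd a F) (ζ t) * deriv (fun s => ζ s b) t) * deriv (fun s => ζ s a) t
        + pd a F (ζ t) * deriv (deriv fun s => ζ s a) t)) t := by
  have h1 : ∀ᶠ s in 𝓝 t, deriv (fun s => F (ζ s)) s
      = ∑ a, pd a F (ζ s) * deriv (fun s => ζ s a) s := by
    have hF' := hζ.continuousAt.eventually (hF.eventually (by simp))
    filter_upwards [hF', hζ.eventually (by simp)] with s hs hs'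
    exact deriv_comp_curve (hs.differentiableAt (by simp)) (hs'.differentiableAt (by simp))
  refine HasDerivAt.congr_of_eventuallyEq ?_ h1
  refine HasDerivAt.fun_sum fun a _ => ?_
  have h2 : HasDerivAt (deriv fun s => ζ s a) (deriv (deriv fun s => ζ s a) t) t := by
    have : ContDiffAt ℝ 2 (fun s => ζ s a) t := (contDiffAt_pi.1 hζ) a
    exact ((contDiffAt_deriv (m := 1) this (by norm_num)).differentiableAt (by simp)).hasDerivAt
  exact (hasDerivAt_comp_curve ((pd_contDiffAt (m := 1) hF (by norm_num) a).differentiableAt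
    (by simp)) (hζ.differentiableAt (by simp))).mul h2

end Partial

/-! ### Christoffel symbols and cross-curvature of the metric of a cost. -/

section CostMetric

variable {n : ℕ}

/-- The matrix of mixed second partial derivatives of `L`. -/
def mixed (L : (Fin n ⊕ Fin n → ℝ) → ℝ) (z : Fin n ⊕ Fin n → ℝ) : Matrix (Fin n) (Fin n) ℝ :=
  Matrix.of fun a b => pd (Sum.inr b) (pd (Sum.inl a) L) z

/-- The pseudo-metric of the cost function `L`. -/
def metricOf (L : (Fin n ⊕ Fin n → ℝ) → ℝ) (z : Fin n ⊕ Fin n → ℝ) :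
    Matrix (Fin n ⊕ Fin n) (Fin n ⊕ Fin n) ℝ :=
  (1 / 2 : ℝ) • Matrix.fromBlocks 0 (-mixed L z) (-(mixed L z).transpose) 0

variable {L : (Fin n ⊕ Fin n → ℝ) → ℝ} {z : Fin n ⊕ Fin n → ℝ}

lemma mixed_apply (a b : Fin n) : mixed L z a b = pd (Sum.inr b) (pd (Sum.inl a) L) z := rfl

lemma metricOf_inv (h : IsUnit (mixed L z).det) :
    (metricOf L z)⁻¹ = Matrix.fromBlocks 0 ((-2 : ℝ) • ((mixed L z)⁻¹).transpose)
      ((-2 : ℝ) • (mixed L z)⁻¹) 0 := by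
  apply Matrix.inv_eq_right_inv
  rw [metricOf, Matrix.smul_mul, Matrix.fromBlocks_multiply]
  simp only [Matrix.zero_mul, Matrix.mul_zero, zero_add, add_zero, Matrix.mul_smul,
    Matrix.neg_mul, Matrix.mul_nonsing_inv _ h, ← Matrix.transpose_mul,
    Matrix.nonsing_inv_mul _ h, Matrix.transpose_one]
  rw [Matrix.fromBlocks_smul]
  simp [smul_smul]

lemma metricOf_inl_inl (a b : Fin n) : metricOf L z (Sum.inl a) (Sum.inl b) = 0 := by
  simp [metricOf]

lemma metricOf_inr_inr (a b : Fin n) : metricOf L z (Sum.inr a) (Sum.inr b) = 0 := by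
  simp [metricOf]

lemma metricOf_inl_inr (a b : Fin n) :
    metricOf L z (Sum.inl a) (Sum.inr b) = -(1 / 2) * mixed L z a b := by
  simp [metricOf]

lemma metricOf_inr_inl (a b : Fin n) :
    metricOf L z (Sum.inr a) (Sum.inl b) = -(1 / 2) * mixed L z b a := by
  simp [metricOf]

/-- The metric and its inverse have only off-diagonal blocks, so `k` is a barred index and the third
term of the Levi-Civita formula differentiates a zero entry. The factors `-2` and `-1/2` cancel. -/
lemma christoffel_inl (hu : IsUnit (mixed L z).det) (a b m : Fin n) :
    christoffel (metricOf L) (Sum.inl a) (Sum.inl b) (Sum.inl m) z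
      = (1 / 2) * ∑ k, (mixed L z)⁻¹ k m *
        (pd (Sum.inl a) (fun y => mixed L y b k) z + pd (Sum.inl b) (fun y => mixed L y a k) z) := by
  simp only [christoffel, metricOf_inv hu, Fintype.sum_sum_type, Matrix.fromBlocks_apply₁₁,
    Matrix.fromBlocks_apply₁₂, metricOf_inl_inl, metricOf_inl_inr, metricOf_inr_inl, pd_const,
    pd_const_mul, Matrix.zero_apply, Matrix.smul_apply, Matrix.transpose_apply, smul_eq_mul,
    zero_mul, Finset.sum_const_zero, zero_add]
  congr 1
  refine Finset.sum_congr rfl fun k _ => ?_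
  ring

lemma christoffel_inr (hu : IsUnit (mixed L z).det) (a b m : Fin n) :
    christoffel (metricOf L) (Sum.inr a) (Sum.inr b) (Sum.inr m) z
      = (1 / 2) * ∑ k, (mixed L z)⁻¹ m k *
        (pd (Sum.inr a) (fun y => mixed L y k b) z + pd (Sum.inr b) (fun y => mixed L y k a) z) := by
  simp only [christoffel, metricOf_inv hu, Fintype.sum_sum_type, Matrix.fromBlocks_apply₂₂,
    Matrix.fromBlocks_apply₂₁, metricOf_inr_inr, metricOf_inl_inr, metricOf_inr_inl, pd_const,
    pd_const_mul, Matrix.zero_apply, Matrix.smul_apply, smul_eq_mul,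
    zero_mul, Finset.sum_const_zero, add_zero]
  congr 1
  refine Finset.sum_congr rfl fun k _ => ?_
  ring

lemma pd_inl_mixed_symm (hL : ContDiffAt ℝ 3 L z) (a b k : Fin n) :
    pd (Sum.inl a) (fun y => mixed L y b k) z = pd (Sum.inl b) (fun y => mixed L y a k) z := by
  have h2 : ∀ j : Fin n ⊕ Fin n, ContDiffAt ℝ 2 (pd j L) z :=
    fun j => pd_contDiffAt hL (by norm_num) j
  change pd (Sum.inl a) (pd (Sum.inr k) (pd (Sum.inl b) L)) z
    = pd (Sum.inl b) (pd (Sum.inr k) (pd (Sum.inl a) L)) z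
  rw [pd_comm (h2 (Sum.inl b)), pd_comm (h2 (Sum.inl a))]
  refine pd_congr (ι := Fin n ⊕ Fin n) ?_ _
  filter_upwards [hL.eventually (by simp)] with y hy
  exact pd_comm (hy.of_le (by norm_num)) _ _

lemma pd_inr_mixed_symm (hL : ContDiffAt ℝ 3 L z) (a b k : Fin n) :
    pd (Sum.inr a) (fun y => mixed L y k b) z = pd (Sum.inr b) (fun y => mixed L y k a) z :=
  pd_comm (pd_contDiffAt (m := 2) hL (by norm_num) _) _ _

/-- Symmetry of third derivatives merges the two terms of the symbol, and contraction with the mixed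
Hessian removes its inverse. This inverse-free form, `Γ_ab^m c_{m l̄} = c_{ab l̄}`, is what yields
both the affine behaviour of `D̄c` along geodesics and the curvature formula. -/
lemma sum_christoffel_inl (hu : IsUnit (mixed L z).det) (hL : ContDiffAt ℝ 3 L z)
    (a b l : Fin n) :
    ∑ m, christoffel (metricOf L) (Sum.inl a) (Sum.inl b) (Sum.inl m) z * mixed L z m l
      = pd (Sum.inl a) (fun y => mixed L y b l) z := by
  have h1 : ∀ m, christoffel (metricOf L) (Sum.inl a) (Sum.inl b) (Sum.inl m) z
      = Matrix.vecMul (fun k => pd (Sum.inl a) (fun y => mixed L y b k) z) (mixed L z)⁻¹ m := by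
    intro m
    rw [christoffel_inl hu, Finset.mul_sum]
    simp only [Matrix.vecMul, dotProduct]
    refine Finset.sum_congr rfl fun k _ => ?_
    rw [pd_inl_mixed_symm hL b a]
    ring
  simp only [h1]
  change Matrix.vecMul (Matrix.vecMul (fun k => pd (Sum.inl a) (fun y => mixed L y b k) z)
    (mixed L z)⁻¹) (mixed L z) l = _
  rw [Matrix.vecMul_vecMul, Matrix.nonsing_inv_mul _ hu, Matrix.vecMul_one]

lemma sum_christoffel_inr (hu : IsUnit (mixed L z).det) (hL : ContDiffAt ℝ 3 L z)
    (a b l : Fin n) :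
    ∑ m, mixed L z l m * christoffel (metricOf L) (Sum.inr a) (Sum.inr b) (Sum.inr m) z
      = pd (Sum.inr a) (fun y => mixed L y l b) z := by
  have h1 : ∀ m, christoffel (metricOf L) (Sum.inr a) (Sum.inr b) (Sum.inr m) z
      = Matrix.mulVec (mixed L z)⁻¹ (fun k => pd (Sum.inr a) (fun y => mixed L y k b) z) m := by
    intro m
    rw [christoffel_inr hu, Finset.mul_sum]
    simp only [Matrix.mulVec, dotProduct]
    refine Finset.sum_congr rfl fun k _ => ?_
    rw [pd_inr_mixed_symm hL b a]
    ring
  simp only [h1]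
  change Matrix.mulVec (mixed L z) (Matrix.mulVec (mixed L z)⁻¹
    (fun k => pd (Sum.inr a) (fun y => mixed L y k b) z)) l = _
  rw [Matrix.mulVec_mulVec, Matrix.mul_nonsing_inv _ hu, Matrix.one_mulVec]

lemma christoffel_inl_inl_inr (hu : IsUnit (mixed L z).det) (a b m : Fin n) :
    christoffel (metricOf L) (Sum.inl a) (Sum.inl b) (Sum.inr m) z = 0 := by
  simp [christoffel, metricOf_inv hu, pd_const, metricOf_inl_inl]

/-- One of the three terms differentiates a diagonal block; the other two cancel because the entries
are second derivatives of one function. The symbols with mixed lower indices therefore vanish, and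
the geodesic equation decouples into horizontal and vertical parts. -/
lemma christoffel_inl_inr (hu : IsUnit (mixed L z).det) (hL : ContDiffAt ℝ 3 L z)
    (a b : Fin n) (m : Fin n ⊕ Fin n) :
    christoffel (metricOf L) (Sum.inl a) (Sum.inr b) m z = 0 := by
  rw [christoffel, metricOf_inv hu]
  rcases m with m | m
  · simp only [Fintype.sum_sum_type, Matrix.fromBlocks_apply₁₁, Matrix.fromBlocks_apply₁₂,
      metricOf_inl_inl, metricOf_inr_inr, metricOf_inl_inr, pd_const,
      pd_const_mul, Matrix.zero_apply, zero_mul, Finset.sum_const_zero, zero_add]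
    refine mul_eq_zero_of_right _ (Finset.sum_eq_zero fun k _ => ?_)
    rw [pd_inr_mixed_symm hL b k]
    ring
  · simp only [Fintype.sum_sum_type, Matrix.fromBlocks_apply₂₁, Matrix.fromBlocks_apply₂₂,
      metricOf_inl_inl, metricOf_inr_inr, metricOf_inl_inr, pd_const,
      pd_const_mul, Matrix.zero_apply, zero_mul, Finset.sum_const_zero, add_zero]
    refine mul_eq_zero_of_right _ (Finset.sum_eq_zero fun k _ => ?_)
    rw [pd_inl_mixed_symm hL a k]
    ring

lemma christoffel_inr_inl (hu : IsUnit (mixed L z).det) (hL : ContDiffAt ℝ 3 L z)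
    (a b : Fin n) (m : Fin n ⊕ Fin n) :
    christoffel (metricOf L) (Sum.inr a) (Sum.inl b) m z = 0 := by
  rw [christoffel, metricOf_inv hu]
  rcases m with m | m
  · simp only [Fintype.sum_sum_type, Matrix.fromBlocks_apply₁₁, Matrix.fromBlocks_apply₁₂,
      metricOf_inl_inl, metricOf_inr_inr, metricOf_inr_inl, pd_const,
      pd_const_mul, Matrix.zero_apply, zero_mul, Finset.sum_const_zero, zero_add]
    refine mul_eq_zero_of_right _ (Finset.sum_eq_zero fun k _ => ?_)
    rw [pd_inr_mixed_symm hL a k]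
    ring
  · simp only [Fintype.sum_sum_type, Matrix.fromBlocks_apply₂₁, Matrix.fromBlocks_apply₂₂,
      metricOf_inl_inl, metricOf_inr_inr, metricOf_inr_inl, pd_const,
      pd_const_mul, Matrix.zero_apply, zero_mul, Finset.sum_const_zero, add_zero]
    refine mul_eq_zero_of_right _ (Finset.sum_eq_zero fun k _ => ?_)
    rw [pd_inl_mixed_symm hL b k]
    ring

lemma mixed_contDiffAt {m k : WithTop ℕ∞} (hL : ContDiffAt ℝ k L z) (hmk : m + 1 + 1 ≤ k)
    (a b : Fin n) : ContDiffAt ℝ m (fun y => mixed L y a b) z :=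
  pd_contDiffAt (pd_contDiffAt (m := m + 1) hL hmk _) le_rfl _

lemma eventually_isUnit_mixed (hu : IsUnit (mixed L z).det) (hL : ContDiffAt ℝ 3 L z) :
    ∀ᶠ y in 𝓝 z, IsUnit (mixed L y).det := by
  have hc : ContinuousAt (mixed L) z := by
    refine continuousAt_pi.2 fun a => continuousAt_pi.2 fun b => ?_
    exact (mixed_contDiffAt (m := 1) hL (by norm_num) a b).continuousAt
  have hdet : Continuous fun A : Matrix (Fin n) (Fin n) ℝ => A.det := continuous_id.matrix_det
  have hd : ContinuousAt (fun y => (mixed L y).det) z :=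
    hdet.continuousAt.comp (f := mixed L) hc
  filter_upwards [hd.eventually_ne (IsUnit.ne_zero hu)] with y hy
  exact hy.isUnit

section Inverse

-- Any Banach algebra norm on matrices would do: it only gives access to the smoothness of inversion
-- in the ring.
attribute [local instance] Matrix.linftyOpNormedRing Matrix.linftyOpNormedAlgebra

lemma inv_mixed_differentiableAt (hu : IsUnit (mixed L z).det) (hL : ContDiffAt ℝ 3 L z)
    (a b : Fin n) : DifferentiableAt ℝ (fun y => (mixed L y)⁻¹ a b) z := by
  have h1 : DifferentiableAt ℝ (mixed L) z := by
    rw [show mixed L = fun y => ∑ a, ∑ b, mixed L y a b • Matrix.single a b (1 : ℝ) by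
      funext y
      conv_lhs => rw [Matrix.matrix_eq_sum_single (mixed L y)]
      simp]
    refine DifferentiableAt.fun_sum fun a _ => DifferentiableAt.fun_sum fun b _ => ?_
    exact ((mixed_contDiffAt (m := 1) hL (by norm_num) a b).differentiableAt (by simp)).smul_const _
  obtain ⟨u, hu'⟩ := (Matrix.isUnit_iff_isUnit_det _).2 hu
  have h2 : DifferentiableAt ℝ (Ring.inverse : Matrix (Fin n) (Fin n) ℝ → _) (mixed L z) := by
    rw [← hu']
    exact (contDiffAt_ringInverse ℝ (n := 1) u).differentiableAt (by simp)
  have h3 : DifferentiableAt ℝ (fun y => Ring.inverse (mixed L y)) z := h2.comp z h1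
  simp only [Matrix.nonsing_inv_eq_ringInverse]
  let ev : Matrix (Fin n) (Fin n) ℝ →ₗ[ℝ] ℝ := Matrix.entryLinearMap ℝ ℝ a b
  exact (LinearMap.toContinuousLinearMap ev).differentiableAt.comp z h3

end Inverse

lemma christoffel_inl_differentiableAt (hu : IsUnit (mixed L z).det) (hL : ContDiffAt ℝ 4 L z)
    (a b m : Fin n) : DifferentiableAt ℝ
      (fun y => christoffel (metricOf L) (Sum.inl a) (Sum.inl b) (Sum.inl m) y) z := by
  have hL3 : ContDiffAt ℝ 3 L z := hL.of_le (by norm_num)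
  have h1 : (fun y => christoffel (metricOf L) (Sum.inl a) (Sum.inl b) (Sum.inl m) y) =ᶠ[𝓝 z]
      fun z => (1 / 2) * ∑ k, (mixed L z)⁻¹ k m * (pd (Sum.inl a) (fun y => mixed L y b k) z
        + pd (Sum.inl b) (fun y => mixed L y a k) z) := by
    filter_upwards [eventually_isUnit_mixed hu hL3] with y hy
    exact christoffel_inl hy a b m
  refine DifferentiableAt.congr_of_eventuallyEq ?_ h1
  refine DifferentiableAt.const_mul (DifferentiableAt.fun_sum fun k _ => ?_) _
  have h2 : ∀ a b k : Fin n,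
      DifferentiableAt ℝ (pd (Sum.inl a) (fun y => mixed L y b k)) z := fun a b k =>
    (pd_contDiffAt (m := 1) (mixed_contDiffAt (m := 2) hL (by norm_num) b k)
      (by norm_num) _).differentiableAt (by simp)
  exact (inv_mixed_differentiableAt hu hL3 k m).mul ((h2 a b k).add (h2 b a k))

/-- The curvature of the cost metric on `(P ⊕ 0) ∧ (0 ⊕ Q)`. -/
lemma sec_metricOf (hu : IsUnit (mixed L z).det) (hL : ContDiffAt ℝ 4 L z) (P Q : Fin n → ℝ) :
    sec (metricOf L) z (Sum.elim P 0) (Sum.elim 0 Q) =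
      -(1 / 2) * ∑ a, ∑ b, ∑ k, ∑ l, (pd (Sum.inr b) (pd (Sum.inl a) fun y => mixed L y k l) z
        - ∑ m, christoffel (metricOf L) (Sum.inl a) (Sum.inl k) (Sum.inl m) z
          * pd (Sum.inr b) (fun y => mixed L y m l) z) * P a * Q b * P k * Q l := by
  have hL3 : ContDiffAt ℝ 3 L z := hL.of_le (by norm_num)
  have hev : ∀ᶠ y in 𝓝 z, IsUnit (mixed L y).det ∧ ContDiffAt ℝ 3 L y :=
    (eventually_isUnit_mixed hu hL3).and (hL3.eventually (by simp))
  have h1 : ∀ a b k m : Fin n, riemannUp (metricOf L) (Sum.inl a) (Sum.inr b) (Sum.inl k)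
      (Sum.inl m) z = pd (Sum.inr b)
        (fun y => christoffel (metricOf L) (Sum.inl a) (Sum.inl k) (Sum.inl m) y) z := by
    intro a b k m
    -- Each of the other terms contains a symbol with mixed lower indices, or one with two unbarred
    -- lower indices and a barred upper one. These vanish throughout a neighbourhood of `z`, so the
    -- derivative of such a symbol vanishes too.
    rw [riemannUp, pd_zero_of_eventually (F := christoffel (metricOf L) (Sum.inr b) (Sum.inl k)
      (Sum.inl m)) _ (hev.mono fun y hy => christoffel_inr_inl hy.1 hy.2 _ _ _)]
    simp [Fintype.sum_sum_type, christoffel_inl_inr hu hL3, christoffel_inr_inl hu hL3,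
      christoffel_inl_inl_inr hu]
  have h2 : ∀ a b k l : Fin n, riemann (metricOf L) (Sum.inl a) (Sum.inr b) (Sum.inl k)
      (Sum.inr l) z = -(1 / 2) * (pd (Sum.inr b) (pd (Sum.inl a) fun y => mixed L y k l) z
        - ∑ m, christoffel (metricOf L) (Sum.inl a) (Sum.inl k) (Sum.inl m) z
          * pd (Sum.inr b) (fun y => mixed L y m l) z) := by
    intro a b k l
    -- The `b̄`-derivative of the identity `Γ_ak^m c_{m l̄} = c_{ak l̄}` trades the derivative of
    -- the symbol for fourth and third derivatives of the cost.
    have h3 : pd (Sum.inr b) (pd (Sum.inl a) fun y => mixed L y k l) z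
        = ∑ m, (pd (Sum.inr b)
            (fun y => christoffel (metricOf L) (Sum.inl a) (Sum.inl k) (Sum.inl m) y) z
              * mixed L z m l
          + christoffel (metricOf L) (Sum.inl a) (Sum.inl k) (Sum.inl m) z
          * pd (Sum.inr b) (fun y => mixed L y m l) z) := by
      have hd : ∀ m, DifferentiableAt ℝ (fun y => mixed L y m l) z := fun m =>
        (mixed_contDiffAt (m := 1) hL (by norm_num) m l).differentiableAt (by simp)
      rw [← pd_congr (hev.mono fun y hy => sum_christoffel_inl hy.1 hy.2 a k l),
        pd_sum _ (F := fun m y => christoffel (metricOf L) (Sum.inl a) (Sum.inl k) (Sum.inl m) y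
          * mixed L y m l) (fun m _ => (christoffel_inl_differentiableAt hu hL a k m).mul (hd m))]
      refine Finset.sum_congr rfl fun m _ => ?_
      rw [pd_mul (christoffel_inl_differentiableAt hu hL a k m) (hd m)]
    rw [h3, Finset.sum_add_distrib, add_sub_cancel_right, Finset.mul_sum, riemann,
      Fintype.sum_sum_type]
    simp only [h1, metricOf_inl_inr, metricOf_inr_inr, mul_zero, Finset.sum_const_zero, add_zero]
    refine Finset.sum_congr rfl fun m _ => ?_
    ring
  simp only [sec, Fintype.sum_sum_type, Sum.elim_inl, Sum.elim_inr, Pi.zero_apply, mul_zero,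
    zero_mul, Finset.sum_const_zero, add_zero, zero_add, h2, Finset.mul_sum]
  refine Finset.sum_congr rfl fun a _ => Finset.sum_congr rfl fun b _ =>
    Finset.sum_congr rfl fun k _ => Finset.sum_congr rfl fun l _ => ?_
  ring

end CostMetric

/-! ### Second derivatives of functions along horizontal and vertical geodesics. -/

variable {n : ℕ} {L Φ : (Fin n ⊕ Fin n → ℝ) → ℝ} {ζ : ℝ → Fin n ⊕ Fin n → ℝ} {t : ℝ}

/-- The geodesic equation at time `t` for the curve `ζ` in the cost metric of `L`. -/
def GeodesicEqAt (L : (Fin n ⊕ Fin n → ℝ) → ℝ) (ζ : ℝ → Fin n ⊕ Fin n → ℝ) (t : ℝ) : Prop :=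
  ∀ m, deriv (deriv fun s => ζ s m) t + ∑ a, ∑ b, christoffel (metricOf L) a b m (ζ t)
    * deriv (fun s => ζ s a) t * deriv (fun s => ζ s b) t = 0

lemma deriv_eventually_const {f : ℝ → ℝ} {r : ℝ} (h : ∀ᶠ s in 𝓝 t, f s = r) :
    deriv f t = 0 ∧ deriv (deriv f) t = 0 := by
  have h' : f =ᶠ[𝓝 t] fun _ => r := h
  have h1 : deriv f =ᶠ[𝓝 t] fun _ => 0 := by
    refine h'.eventuallyEq_nhds.mono fun s hs => ?_
    rw [hs.deriv_eq]; simp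
  exact ⟨h1.self_of_nhds, by rw [h1.deriv_eq]; simp⟩

/-- Second derivative of a function along a geodesic with constant second component. -/
lemma hasDerivAt_deriv_horizontal (hΦ : ContDiffAt ℝ 2 Φ (ζ t)) (hζ : ContDiffAt ℝ 2 ζ t)
    (hc : ∀ b, ∀ᶠ s in 𝓝 t, ζ s (Sum.inr b) = ζ t (Sum.inr b)) (hg : GeodesicEqAt L ζ t) :
    HasDerivAt (deriv fun s => Φ (ζ s))
      (∑ a, ∑ b, (pd (Sum.inl a) (pd (Sum.inl b) Φ) (ζ t)
        - ∑ m, christoffel (metricOf L) (Sum.inl a) (Sum.inl b) (Sum.inl m) (ζ t)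
          * pd (Sum.inl m) Φ (ζ t))
        * deriv (fun s => ζ s (Sum.inl a)) t * deriv (fun s => ζ s (Sum.inl b)) t) t := by
  convert hasDerivAt_deriv_comp_curve hΦ hζ using 1
  have h1 : ∀ b, deriv (fun s => ζ s (Sum.inr b)) t = 0 := fun b => (deriv_eventually_const (hc b)).1
  have h2 : ∀ b, deriv (deriv fun s => ζ s (Sum.inr b)) t = 0 :=
    fun b => (deriv_eventually_const (hc b)).2
  have h3 : ∀ m, deriv (deriv fun s => ζ s (Sum.inl m)) t = -∑ a, ∑ b,
      christoffel (metricOf L) (Sum.inl a) (Sum.inl b) (Sum.inl m) (ζ t)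
        * deriv (fun s => ζ s (Sum.inl a)) t * deriv (fun s => ζ s (Sum.inl b)) t := by
    intro m
    have := hg (Sum.inl m)
    simp only [Fintype.sum_sum_type, h1, mul_zero, zero_mul, Finset.sum_const_zero, add_zero] at this
    linarith
  simp only [Fintype.sum_sum_type, h1, h2, h3, mul_zero, Finset.sum_const_zero, add_zero,
    Finset.sum_add_distrib, sub_mul, Finset.sum_sub_distrib, mul_neg, Finset.sum_neg_distrib,
    ← sub_eq_add_neg, Finset.mul_sum, Finset.sum_mul]
  congr 1
  · rw [Finset.sum_comm]
  · refine Finset.sum_comm_cycle.trans ?_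
    refine Finset.sum_congr rfl fun m _ => Finset.sum_congr rfl fun a _ =>
      Finset.sum_congr rfl fun b _ => ?_
    ring

/-- Second derivative of a function along a geodesic with constant first component. -/
lemma hasDerivAt_deriv_vertical (hΦ : ContDiffAt ℝ 2 Φ (ζ t)) (hζ : ContDiffAt ℝ 2 ζ t)
    (hc : ∀ b, ∀ᶠ s in 𝓝 t, ζ s (Sum.inl b) = ζ t (Sum.inl b)) (hg : GeodesicEqAt L ζ t) :
    HasDerivAt (deriv fun s => Φ (ζ s))
      (∑ a, ∑ b, (pd (Sum.inr a) (pd (Sum.inr b) Φ) (ζ t)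
        - ∑ m, christoffel (metricOf L) (Sum.inr a) (Sum.inr b) (Sum.inr m) (ζ t)
          * pd (Sum.inr m) Φ (ζ t))
        * deriv (fun s => ζ s (Sum.inr a)) t * deriv (fun s => ζ s (Sum.inr b)) t) t := by
  convert hasDerivAt_deriv_comp_curve hΦ hζ using 1
  have h1 : ∀ b, deriv (fun s => ζ s (Sum.inl b)) t = 0 := fun b => (deriv_eventually_const (hc b)).1
  have h2 : ∀ b, deriv (deriv fun s => ζ s (Sum.inl b)) t = 0 :=
    fun b => (deriv_eventually_const (hc b)).2
  have h3 : ∀ m, deriv (deriv fun s => ζ s (Sum.inr m)) t = -∑ a, ∑ b,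
      christoffel (metricOf L) (Sum.inr a) (Sum.inr b) (Sum.inr m) (ζ t)
        * deriv (fun s => ζ s (Sum.inr a)) t * deriv (fun s => ζ s (Sum.inr b)) t := by
    intro m
    have := hg (Sum.inr m)
    simp only [Fintype.sum_sum_type, h1, mul_zero, zero_mul, Finset.sum_const_zero, zero_add] at this
    linarith
  simp only [Fintype.sum_sum_type, h1, h2, h3, mul_zero, Finset.sum_const_zero,
    zero_add, Finset.sum_add_distrib, sub_mul, Finset.sum_sub_distrib, mul_neg, Finset.sum_neg_distrib,
    ← sub_eq_add_neg, Finset.mul_sum, Finset.sum_mul]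
  rw [zero_sub, ← sub_eq_add_neg]
  congr 1
  · rw [Finset.sum_comm]
  · refine Finset.sum_comm_cycle.trans ?_
    refine Finset.sum_congr rfl fun m _ => Finset.sum_congr rfl fun a _ =>
      Finset.sum_congr rfl fun b _ => ?_
    ring

/-- The covariant Hessian of `∂L/∂z^k̄` in unbarred directions is `c_{ab k̄} - Γ_ab^m c_{m k̄}`,
which is zero. Thus the components of `D̄c(·, w)` are affine in the parameter of a horizontal
geodesic. -/
lemma deriv2_barred_along_horizontal (hu : IsUnit (mixed L (ζ t)).det)
    (hL : ContDiffAt ℝ 3 L (ζ t)) (hζ : ContDiffAt ℝ 2 ζ t)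
    (hc : ∀ b, ∀ᶠ s in 𝓝 t, ζ s (Sum.inr b) = ζ t (Sum.inr b)) (hg : GeodesicEqAt L ζ t)
    (k : Fin n) : deriv (deriv fun s => pd (Sum.inr k) L (ζ s)) t = 0 := by
  rw [(hasDerivAt_deriv_horizontal (pd_contDiffAt hL (by norm_num) _) hζ hc hg).deriv]
  refine Finset.sum_eq_zero fun a _ => Finset.sum_eq_zero fun b _ => ?_
  have hcomm : ∀ m : Fin n, pd (Sum.inl m) (pd (Sum.inr k) L) =ᶠ[𝓝 (ζ t)]
      fun y => mixed L y m k := fun m => by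
    filter_upwards [hL.eventually (by simp)] with y hy
    exact pd_comm (hy.of_le (by norm_num)) _ _
  have h2 := sum_christoffel_inl hu hL a b k
  rw [pd_congr (hcomm b), ← h2]
  simp [(hcomm _).self_of_nhds]

lemma deriv2_unbarred_along_vertical (hu : IsUnit (mixed L (ζ t)).det)
    (hL : ContDiffAt ℝ 3 L (ζ t)) (hζ : ContDiffAt ℝ 2 ζ t)
    (hc : ∀ b, ∀ᶠ s in 𝓝 t, ζ s (Sum.inl b) = ζ t (Sum.inl b)) (hg : GeodesicEqAt L ζ t)
    (k : Fin n) : deriv (deriv fun s => pd (Sum.inl k) L (ζ s)) t = 0 := by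
  rw [(hasDerivAt_deriv_vertical (pd_contDiffAt hL (by norm_num) _) hζ hc hg).deriv]
  refine Finset.sum_eq_zero fun a _ => Finset.sum_eq_zero fun b _ => ?_
  have h2 := sum_christoffel_inr hu hL a b k
  change (pd (Sum.inr a) (fun y => mixed L y k b) (ζ t)
    - ∑ m, christoffel (metricOf L) (Sum.inr a) (Sum.inr b) (Sum.inr m) (ζ t)
      * mixed L (ζ t) k m) * _ * _ = 0
  rw [← h2]
  simp [mul_comm]

/-- The second derivative of `y ↦ ∂²/∂t² L(y, w(t))` in terms of velocity `Q` and
acceleration `R` of `w`. -/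
def accel (L : (Fin n ⊕ Fin n → ℝ) → ℝ) (Q R : Fin n → ℝ) (z : Fin n ⊕ Fin n → ℝ) : ℝ :=
  (∑ k, ∑ l, pd (Sum.inr k) (pd (Sum.inr l) L) z * (Q k * Q l)) + ∑ k, pd (Sum.inr k) L z * R k

lemma accel_contDiffAt {z : Fin n ⊕ Fin n → ℝ} (hL : ContDiffAt ℝ 4 L z) (Q R : Fin n → ℝ) :
    ContDiffAt ℝ 2 (accel L Q R) z := by
  refine ContDiffAt.add ?_ ?_
  · refine ContDiffAt.sum fun k _ => ContDiffAt.sum fun l _ => ContDiffAt.mul ?_ contDiffAt_const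
    exact pd_contDiffAt (m := 2) (pd_contDiffAt (m := 3) hL (by norm_num) _) (by norm_num) _
  · refine ContDiffAt.sum fun k _ => ContDiffAt.mul ?_ contDiffAt_const
    exact pd_contDiffAt (m := 2) hL (by norm_num) _

lemma pd_inl_accel {z : Fin n ⊕ Fin n → ℝ} (hL : ContDiffAt ℝ 4 L z) (Q R : Fin n → ℝ)
    (a : Fin n) : pd (Sum.inl a) (accel L Q R) z
      = (∑ k, ∑ l, pd (Sum.inr k) (fun y => mixed L y a l) z * (Q k * Q l))
        + ∑ k, mixed L z a k * R k := by
  have hd1 : ∀ k l : Fin n, DifferentiableAt ℝ (pd (Sum.inr k) (pd (Sum.inr l) L)) z := fun k l =>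
    (pd_contDiffAt (m := 1) (pd_contDiffAt (m := 2) hL (by norm_num) _) (by norm_num)
      _).differentiableAt (by simp)
  have hd2 : ∀ k : Fin n, DifferentiableAt ℝ (pd (Sum.inr k) L) z := fun k =>
    (pd_contDiffAt (m := 1) hL (by norm_num) _).differentiableAt (by simp)
  have hcomm : ∀ k : Fin n, pd (Sum.inl a) (pd (Sum.inr k) L) =ᶠ[𝓝 z]
      fun y => mixed L y a k := fun k => by
    filter_upwards [hL.eventually (by simp)] with y hy
    exact pd_comm (hy.of_le (by norm_num)) _ _
  rw [show accel L Q R = fun z => (∑ k, ∑ l, pd (Sum.inr k) (pd (Sum.inr l) L) z * (Q k * Q l))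
    + ∑ k, pd (Sum.inr k) L z * R k from rfl, pd_add, pd_sum, pd_sum]
  · congr 1
    · refine Finset.sum_congr rfl fun k _ => ?_
      rw [pd_sum _ fun l _ => (hd1 k l).mul_const _]
      refine Finset.sum_congr rfl fun l _ => ?_
      rw [pd_mul_const (hd1 k l), pd_comm (pd_contDiffAt (m := 2) hL (by norm_num) _),
        pd_congr (hcomm l)]
    · refine Finset.sum_congr rfl fun k _ => ?_
      rw [pd_mul_const (hd2 k), (hcomm k).self_of_nhds]
  · exact fun k _ => (hd2 k).mul_const _
  · exact fun k _ => DifferentiableAt.fun_sum fun l _ => (hd1 k l).mul_const _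
  · exact DifferentiableAt.fun_sum fun k _ => DifferentiableAt.fun_sum fun l _ =>
      (hd1 k l).mul_const _
  · exact DifferentiableAt.fun_sum fun k _ => (hd2 k).mul_const _

/-- The cross-curvature as a fourth derivative of the cost. -/
lemma deriv2_accel_along_horizontal (hu : IsUnit (mixed L (ζ t)).det)
    (hL : ContDiffAt ℝ 4 L (ζ t)) (hζ : ContDiffAt ℝ 2 ζ t)
    (hc : ∀ b, ∀ᶠ s in 𝓝 t, ζ s (Sum.inr b) = ζ t (Sum.inr b)) (hg : GeodesicEqAt L ζ t)
    (Q R : Fin n → ℝ) :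
    deriv (deriv fun s => accel L Q R (ζ s)) t = -2 * sec (metricOf L) (ζ t)
      (Sum.elim (fun a => deriv (fun s => ζ s (Sum.inl a)) t) 0) (Sum.elim 0 Q) := by
  rw [(hasDerivAt_deriv_horizontal (accel_contDiffAt hL Q R) hζ hc hg).deriv, sec_metricOf hu hL]
  set P : Fin n → ℝ := fun a => deriv (fun s => ζ s (Sum.inl a)) t
  have hL3 : ContDiffAt ℝ 3 L (ζ t) := hL.of_le (by norm_num)
  have hm : ∀ a l : Fin n, ContDiffAt ℝ 2 (fun y => mixed L y a l) (ζ t) := fun a l =>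
    mixed_contDiffAt hL (by norm_num) a l
  have h1 : ∀ a b : Fin n, pd (Sum.inl a) (pd (Sum.inl b) (accel L Q R)) (ζ t)
      - ∑ m, christoffel (metricOf L) (Sum.inl a) (Sum.inl b) (Sum.inl m) (ζ t)
          * pd (Sum.inl m) (accel L Q R) (ζ t)
      = ∑ k, ∑ l, (pd (Sum.inr k) (pd (Sum.inl a) fun y => mixed L y b l) (ζ t)
        - ∑ m, christoffel (metricOf L) (Sum.inl a) (Sum.inl b) (Sum.inl m) (ζ t)
          * pd (Sum.inr k) (fun y => mixed L y m l) (ζ t)) * (Q k * Q l) := by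
    intro a b
    have hd1 : ∀ k l, DifferentiableAt ℝ (pd (Sum.inr k) (fun y => mixed L y b l)) (ζ t) :=
      fun k l => (pd_contDiffAt (m := 1) (hm b l) (by norm_num) _).differentiableAt (by simp)
    have hd2 : ∀ k, DifferentiableAt ℝ (fun y => mixed L y b k) (ζ t) :=
      fun k => (hm b k).differentiableAt (by simp)
    rw [pd_congr (show pd (Sum.inl b) (accel L Q R) =ᶠ[𝓝 (ζ t)] _ from
      (hL.eventually (by simp)).mono fun y hy => pd_inl_accel hy Q R b), pd_add, pd_sum, pd_sum]
    · have h3 : ∀ m, pd (Sum.inl m) (accel L Q R) (ζ t) = _ := fun m => pd_inl_accel hL Q R m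
      simp only [h3]
      -- The part of the covariant Hessian containing the acceleration `R` cancels, for the same
      -- reason that `D̄c` is affine along horizontal geodesics. Only the velocity `Q` enters the
      -- curvature.
      have h4 : ∑ k, pd (Sum.inl a) (fun z => mixed L z b k * R k) (ζ t) = ∑ m,
          christoffel (metricOf L) (Sum.inl a) (Sum.inl b) (Sum.inl m) (ζ t)
            * ∑ k, mixed L (ζ t) m k * R k := by
        simp only [Finset.mul_sum]
        rw [Finset.sum_comm]
        refine Finset.sum_congr rfl fun k _ => ?_
        rw [pd_mul_const (hd2 k), ← sum_christoffel_inl hu hL3 a b k, Finset.sum_mul]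
        refine Finset.sum_congr rfl fun m _ => ?_
        ring
      simp only [mul_add, Finset.sum_add_distrib]
      rw [h4, add_sub_add_right_eq_sub]
      simp only [sub_mul, Finset.sum_sub_distrib]
      congr 1
      · refine Finset.sum_congr rfl fun k _ => ?_
        rw [pd_sum _ fun l _ => (hd1 k l).mul_const _]
        refine Finset.sum_congr rfl fun l _ => ?_
        rw [pd_mul_const (hd1 k l), pd_comm (hm b l)]
      · simp only [Finset.mul_sum, Finset.sum_mul]
        rw [Finset.sum_comm_cycle, Finset.sum_comm_cycle]
        refine Finset.sum_congr rfl fun k _ => Finset.sum_congr rfl fun l _ =>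
          Finset.sum_congr rfl fun m _ => ?_
        ring
    · exact fun k _ => (hd2 k).mul_const _
    · exact fun k _ => DifferentiableAt.fun_sum fun l _ => (hd1 k l).mul_const _
    · exact DifferentiableAt.fun_sum fun k _ => DifferentiableAt.fun_sum fun l _ =>
        (hd1 k l).mul_const _
    · exact DifferentiableAt.fun_sum fun k _ => (hd2 k).mul_const _
  simp only [h1]
  rw [← mul_assoc, show (-2 : ℝ) * -(1 / 2) = 1 by norm_num, one_mul]
  simp only [Finset.sum_mul]
  refine Finset.sum_congr rfl fun a _ => ?_
  rw [Finset.sum_comm]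
  refine Finset.sum_congr rfl fun k _ => Finset.sum_congr rfl fun b _ =>
    Finset.sum_congr rfl fun l _ => ?_
  ring

/-- A function of one variable with vanishing second derivative is affine. -/
lemma affine_of_deriv2_eq_zero {f : ℝ → ℝ} {I : Set ℝ} (hI : IsOpen I) (hI' : I.OrdConnected)
    (hf : ∀ t ∈ I, ContDiffAt ℝ 2 f t) (hf' : ∀ t ∈ I, deriv (deriv f) t = 0) :
    ∃ a b : ℝ, ∀ t ∈ I, f t = a + b * t := by
  rcases I.eq_empty_or_nonempty with rfl | ⟨t₀, ht₀⟩
  · exact ⟨0, 0, by simp⟩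
  have hp := hI'.isPreconnected
  have hd : ∀ t ∈ I, deriv f t = deriv f t₀ := fun t ht =>
    hI.is_const_of_deriv_eq_zero hp (fun s hs => ((contDiffAt_deriv (m := 1) (hf s hs)
      (by norm_num)).differentiableAt (by simp)).differentiableWithinAt) hf' ht ht₀
  have hdf : ∀ t ∈ I, HasDerivAt f (deriv f t₀) t := fun t ht => by
    rw [← hd t ht]
    exact ((hf t ht).differentiableAt (by simp)).hasDerivAt
  refine ⟨f t₀ - deriv f t₀ * t₀, deriv f t₀, fun t ht => ?_⟩
  have hD : ∀ s ∈ I, HasDerivAt (fun s => f s - deriv f t₀ * s) 0 s := fun s hs => by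
    have := (hdf s hs).fun_sub ((hasDerivAt_id s).const_mul (deriv f t₀))
    rwa [mul_one, sub_self] at this
  have := hI.is_const_of_deriv_eq_zero hp (f := fun s => f s - deriv f t₀ * s)
    (fun s hs => (hD s hs).differentiableAt.differentiableWithinAt)
    (fun s hs => (hD s hs).deriv) ht ht₀
  linarith

end PseudoRiem

end

noncomputable section

namespace OT

open PseudoRiem Filter

/-! ### The derivatives `D̄c` and `Dc` on the manifolds, affine along geodesics. -/

section Coordinates

variable {n : ℕ} {M M' K K' : Type*}
  [TopologicalSpace M] [ChartedSpace (Eu n) M] [TopologicalSpace M'] [ChartedSpace (Eu n) M']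
  {i : M → K} {i' : M' → K'} {c : K → K' → EReal} {N : Set (M × M')}

lemma localCost_elim (p : M × M') (z w : Eu n) :
    localCost n i i' c p (Sum.elim z w) =
      (c (i ((chartAt (Eu n) p.1).symm z)) (i' ((chartAt (Eu n) p.2).symm w))).toReal := rfl

lemma coords_eq_elim (p q : M × M') :
    coords n p q = Sum.elim (chartAt (Eu n) p.1 q.1) (chartAt (Eu n) p.2 q.2) := rfl

lemma localCost_coords {p q : M × M'} (h1 : q.1 ∈ (chartAt (Eu n) p.1).source)
    (h2 : q.2 ∈ (chartAt (Eu n) p.2).source) :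
    localCost n i i' c p (coords n p q) = (c (i q.1) (i' q.2)).toReal := by
  rw [coords_eq_elim, localCost_elim, (chartAt (Eu n) p.1).left_inv h1,
    (chartAt (Eu n) p.2).left_inv h2]

lemma coords_continuousAt {p q : M × M'} (h1 : q.1 ∈ (chartAt (Eu n) p.1).source)
    (h2 : q.2 ∈ (chartAt (Eu n) p.2).source) : ContinuousAt (coords n p) q := by
  have c1 : ContinuousAt (fun q : M × M' => chartAt (Eu n) p.1 q.1) q :=
    ((chartAt (Eu n) p.1).continuousAt h1).comp continuousAt_fst
  have c2 : ContinuousAt (fun q : M × M' => chartAt (Eu n) p.2 q.2) q :=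
    ((chartAt (Eu n) p.2).continuousAt h2).comp continuousAt_snd
  refine continuousAt_pi.2 fun m => ?_
  rcases m with a | b
  · exact (EuclideanSpace.proj (𝕜 := ℝ) a).continuous.continuousAt.comp c1
  · exact (EuclideanSpace.proj (𝕜 := ℝ) b).continuous.continuousAt.comp c2

lemma localCost_contDiffAt [IsManifold 𝓘(ℝ, Eu n) ∞ M] [IsManifold 𝓘(ℝ, Eu n) ∞ M']
    (hN : IsOpen N) (hA0 : SmoothOn n i i' c N) {p q : M × M'} (hq : q ∈ N)
    (h1 : q.1 ∈ (chartAt (Eu n) p.1).source) (h2 : q.2 ∈ (chartAt (Eu n) p.2).source) :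
    ContDiffAt ℝ 4 (localCost n i i' c p) (coords n p q) := by
  have hc := (hA0.2 q hq).contMDiffAt (hN.mem_nhds hq)
  let e1 : (Fin n ⊕ Fin n → ℝ) → Eu n := fun z => WithLp.toLp 2 fun a => z (Sum.inl a)
  let e2 : (Fin n ⊕ Fin n → ℝ) → Eu n := fun z => WithLp.toLp 2 fun a => z (Sum.inr a)
  have he1 : ContDiff ℝ 4 e1 := by
    refine contDiff_euclidean.2 fun a => ?_
    exact contDiff_apply ℝ ℝ (Sum.inl a)
  have he2 : ContDiff ℝ 4 e2 := by
    refine contDiff_euclidean.2 fun a => ?_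
    exact contDiff_apply ℝ ℝ (Sum.inr a)
  have hm1 : ContMDiffAt 𝓘(ℝ, Fin n ⊕ Fin n → ℝ) 𝓘(ℝ, Eu n) 4
      (fun z => (chartAt (Eu n) p.1).symm (e1 z)) (coords n p q) := by
    refine ContMDiffAt.comp (coords n p q) (I' := 𝓘(ℝ, Eu n)) ?_ he1.contMDiff.contMDiffAt
    exact (contMDiffAt_symm_of_mem_maximalAtlas (n := ∞) (IsManifold.chart_mem_maximalAtlas p.1)
      ((chartAt (Eu n) p.1).map_source h1)).of_le ENat.LEInfty.out
  have hm2 : ContMDiffAt 𝓘(ℝ, Fin n ⊕ Fin n → ℝ) 𝓘(ℝ, Eu n) 4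
      (fun z => (chartAt (Eu n) p.2).symm (e2 z)) (coords n p q) := by
    refine ContMDiffAt.comp (coords n p q) (I' := 𝓘(ℝ, Eu n)) ?_ he2.contMDiff.contMDiffAt
    exact (contMDiffAt_symm_of_mem_maximalAtlas (n := ∞) (IsManifold.chart_mem_maximalAtlas p.2)
      ((chartAt (Eu n) p.2).map_source h2)).of_le ENat.LEInfty.out
  have hpt : ((chartAt (Eu n) p.1).symm (e1 (coords n p q)),
      (chartAt (Eu n) p.2).symm (e2 (coords n p q))) = q :=
    Prod.ext ((chartAt (Eu n) p.1).left_inv h1) ((chartAt (Eu n) p.2).left_inv h2)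
  rw [← contMDiffAt_iff_contDiffAt]
  have hc' := hpt.symm ▸ hc
  exact ContMDiffAt.comp (coords n p q)
    (g := fun p : M × M' => (c (i p.1) (i' p.2)).toReal) hc' (hm1.prodMk hm2)

lemma costMetric_eq (p : M × M') : costMetric n i i' c p = metricOf (localCost n i i' c p) := rfl

lemma isUnit_mixed (hnd : NonDegenerate n i i' c N) {p : M × M'} (hp : p ∈ N) :
    IsUnit (mixed (localCost n i i' c p) (coords n p p)).det := by
  rw [← Matrix.isUnit_iff_isUnit_det, ← Matrix.mulVec_injective_iff_isUnit]
  exact (hnd p hp).1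

lemma pd_eq_deriv {ι : Type*} [Fintype ι] [DecidableEq ι] {F : (ι → ℝ) → ℝ} {z : ι → ℝ}
    (hF : DifferentiableAt ℝ F z) (a : ι) :
    pd a F z = deriv (fun τ : ℝ => F (z + τ • Pi.single a 1)) 0 :=
  (hF.lineDeriv_eq_fderiv).symm

variable (n i i' c) in
/-- The derivative `D̄c(y, w)` of the cost in its second variable, in the preferred chart at `w`. -/
def barGrad (w : M') (y : M) (k : Fin n) : ℝ :=
  deriv (fun τ : ℝ => (c (i y) (i' ((chartAt (Eu n) w).symm
    (chartAt (Eu n) w w + τ • EuclideanSpace.single k 1)))).toReal) 0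

variable (n i i' c) in
/-- The derivative `Dc(x, w)` of the cost in its first variable, in the preferred chart at `x`. -/
def unbarGrad (x : M) (w : M') (k : Fin n) : ℝ :=
  deriv (fun τ : ℝ => (c (i ((chartAt (Eu n) x).symm
    (chartAt (Eu n) x x + τ • EuclideanSpace.single k 1))) (i' w)).toReal) 0

variable [IsManifold 𝓘(ℝ, Eu n) ∞ M] [IsManifold 𝓘(ℝ, Eu n) ∞ M']

/-- The left side involves no chart at `y`. One function can thus be followed along a whole
geodesic, while the geodesic equation is written in a chart that changes from point to point. -/
lemma barGrad_eq_pd (hN : IsOpen N) (hA0 : SmoothOn n i i' c N) {y₀ y : M} {w : M'}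
    (hy : (y, w) ∈ N) (h1 : y ∈ (chartAt (Eu n) y₀).source) (k : Fin n) :
    barGrad n i i' c w y k =
      pd (Sum.inr k) (localCost n i i' c (y₀, w)) (coords n (y₀, w) (y, w)) := by
  rw [pd_eq_deriv ((localCost_contDiffAt hN hA0 (p := (y₀, w)) hy h1
    (mem_chart_source _ _)).differentiableAt (by simp)), barGrad]
  congr 1
  funext τ
  have h : coords n (y₀, w) (y, w) + τ • Pi.single (Sum.inr k) (1 : ℝ)
      = Sum.elim (chartAt (Eu n) y₀ y)
        (chartAt (Eu n) w w + τ • EuclideanSpace.single k (1 : ℝ) : Eu n) := by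
    funext m
    rcases m with a | b
    · simp [coords]
    · simp [coords, Pi.single_apply]
  rw [h, localCost_elim, (chartAt (Eu n) y₀).left_inv h1]

lemma unbarGrad_eq_pd (hN : IsOpen N) (hA0 : SmoothOn n i i' c N) {x : M} {w₀ w : M'}
    (hy : (x, w) ∈ N) (h1 : w ∈ (chartAt (Eu n) w₀).source) (k : Fin n) :
    unbarGrad n i i' c x w k =
      pd (Sum.inl k) (localCost n i i' c (x, w₀)) (coords n (x, w₀) (x, w)) := by
  rw [pd_eq_deriv ((localCost_contDiffAt hN hA0 (p := (x, w₀)) hy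
    (mem_chart_source _ _) h1).differentiableAt (by simp)), unbarGrad]
  congr 1
  funext τ
  have h : coords n (x, w₀) (x, w) + τ • Pi.single (Sum.inl k) (1 : ℝ)
      = Sum.elim (chartAt (Eu n) x x + τ • EuclideanSpace.single k (1 : ℝ) : Eu n)
        (chartAt (Eu n) w₀ w) := by
    funext m
    rcases m with a | b
    · simp [coords, Pi.single_apply]
    · simp [coords]
  rw [h, localCost_elim, (chartAt (Eu n) w₀).left_inv h1]

lemma barGrad_continuousAt (hN : IsOpen N) (hA0 : SmoothOn n i i' c N) {y : M} {w : M'}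
    (hy : (y, w) ∈ N) (k : Fin n) : ContinuousAt (fun y => barGrad n i i' c w y k) y := by
  have h1 : (fun y' => barGrad n i i' c w y' k) =ᶠ[𝓝 y]
      fun y' => pd (Sum.inr k) (localCost n i i' c (y, w)) (coords n (y, w) (y', w)) := by
    have : ∀ᶠ y' in 𝓝 y, (y', w) ∈ N :=
      (continuous_id.prodMk continuous_const).continuousAt.eventually (hN.mem_nhds hy)
    filter_upwards [this, (chartAt (Eu n) y).open_source.mem_nhds (mem_chart_source _ _)]
      with y' h1 h2
    exact barGrad_eq_pd hN hA0 h1 h2 k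
  refine ContinuousAt.congr ?_ h1.symm
  have h2 : ContinuousAt (pd (Sum.inr k) (localCost n i i' c (y, w))) (coords n (y, w) (y, w)) :=
    (pd_contDiffAt (m := 3) (localCost_contDiffAt hN hA0 (p := (y, w)) hy (mem_chart_source _ _)
      (mem_chart_source _ _)) (by norm_num) _).continuousAt
  exact ContinuousAt.comp (f := fun y' => coords n (y, w) (y', w)) h2
    (ContinuousAt.comp (f := fun y' => (y', w)) (coords_continuousAt (p := (y, w))
      (mem_chart_source _ _) (mem_chart_source _ _)) (by fun_prop))

lemma unbarGrad_continuousAt (hN : IsOpen N) (hA0 : SmoothOn n i i' c N) {x : M} {w : M'}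
    (hy : (x, w) ∈ N) (k : Fin n) : ContinuousAt (fun w => unbarGrad n i i' c x w k) w := by
  have h1 : (fun w' => unbarGrad n i i' c x w' k) =ᶠ[𝓝 w]
      fun w' => pd (Sum.inl k) (localCost n i i' c (x, w)) (coords n (x, w) (x, w')) := by
    have : ∀ᶠ w' in 𝓝 w, (x, w') ∈ N :=
      (continuous_const.prodMk continuous_id).continuousAt.eventually (hN.mem_nhds hy)
    filter_upwards [this, (chartAt (Eu n) w).open_source.mem_nhds (mem_chart_source _ _)]
      with y' h1 h2
    exact unbarGrad_eq_pd hN hA0 h1 h2 k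
  refine ContinuousAt.congr ?_ h1.symm
  have h2 : ContinuousAt (pd (Sum.inl k) (localCost n i i' c (x, w))) (coords n (x, w) (x, w)) :=
    (pd_contDiffAt (m := 3) (localCost_contDiffAt hN hA0 (p := (x, w)) hy (mem_chart_source _ _)
      (mem_chart_source _ _)) (by norm_num) _).continuousAt
  exact ContinuousAt.comp (f := fun w' => coords n (x, w) (x, w')) h2
    (ContinuousAt.comp (f := fun w' => (x, w')) (coords_continuousAt (p := (x, w))
      (mem_chart_source _ _) (mem_chart_source _ _)) (by fun_prop))

lemma slice_differentiableAt (hN : IsOpen N) (hA0 : SmoothOn n i i' c N) {x y : M} {w : M'}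
    (hy : (y, w) ∈ N) (hyx : y ∈ (chartAt (Eu n) x).source) :
    DifferentiableAt ℝ (fun z : Eu n => (c (i ((chartAt (Eu n) x).symm z)) (i' w)).toReal)
      (chartAt (Eu n) x y) := by
  have h := (localCost_contDiffAt hN hA0 (p := (x, w)) hy hyx
    (mem_chart_source _ _)).differentiableAt (by simp)
  have he : DifferentiableAt ℝ (fun z : Eu n => (Sum.elim z (chartAt (Eu n) w w) :
      Fin n ⊕ Fin n → ℝ)) (chartAt (Eu n) x y) := by
    refine differentiableAt_pi.2 fun m => ?_
    rcases m with a | b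
    · exact (EuclideanSpace.proj (𝕜 := ℝ) a).differentiableAt
    · exact differentiableAt_const _
  have h3 := DifferentiableAt.comp (chartAt (Eu n) x y) (g := localCost n i i' c (x, w)) h he
  refine h3.congr_of_eventuallyEq (Eventually.of_forall fun z => ?_)
  simp only [Function.comp, localCost_elim]
  rw [(chartAt (Eu n) w).left_inv (mem_chart_source _ _)]

lemma negDc_eq_fderiv (hN : IsOpen N) (hA0 : SmoothOn n i i' c N) {x : M} {w : M'}
    (hy : (x, w) ∈ N) : (negDc n i c x (i' w) : Eu n →L[ℝ] ℝ) =
      -fderiv ℝ (fun z : Eu n => (c (i ((chartAt (Eu n) x).symm z)) (i' w)).toReal)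
        (chartAt (Eu n) x x) := by
  have hm : MDifferentiableAt 𝓘(ℝ, Eu n) 𝓘(ℝ, ℝ) (fun y : M => (c (i y) (i' w)).toReal) x := by
    have hc := (hA0.2 _ hy).contMDiffAt (hN.mem_nhds hy)
    exact (ContMDiffAt.comp x (f := fun y : M => (y, w)) hc
      (contMDiffAt_id.prodMk contMDiffAt_const)).mdifferentiableAt (by simp)
  rw [negDc, hm.mfderiv]
  simp only [writtenInExtChartAt, extChartAt, mfld_simps, fderivWithin_univ]
  rfl

lemma negDc_apply_single (hN : IsOpen N) (hA0 : SmoothOn n i i' c N) {x : M} {w : M'}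
    (hy : (x, w) ∈ N) (k : Fin n) :
    (negDc n i c x (i' w) : Eu n →L[ℝ] ℝ) (EuclideanSpace.single k 1) = -unbarGrad n i i' c x w k := by
  refine (DFunLike.congr_fun (F := Eu n →L[ℝ] ℝ) (negDc_eq_fderiv hN hA0 hy) _).trans ?_
  rw [neg_apply, ← (slice_differentiableAt hN hA0 hy (mem_chart_source _ _)).lineDeriv_eq_fderiv]
  rfl

lemma coords_horizontal_const {p : M × M'} {γ : ℝ → M × M'} {t : ℝ} {w : M'}
    (h : ∀ᶠ s in 𝓝 t, (γ s).2 = w) (b : Fin n) :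
    ∀ᶠ s in 𝓝 t, coords n p (γ s) (Sum.inr b) = coords n p (γ t) (Sum.inr b) := by
  filter_upwards [h] with s hs
  simp [coords, hs, h.self_of_nhds]

lemma coords_vertical_const {p : M × M'} {γ : ℝ → M × M'} {t : ℝ} {x : M}
    (h : ∀ᶠ s in 𝓝 t, (γ s).1 = x) (b : Fin n) :
    ∀ᶠ s in 𝓝 t, coords n p (γ s) (Sum.inl b) = coords n p (γ t) (Sum.inl b) := by
  filter_upwards [h] with s hs
  simp [coords, hs, h.self_of_nhds]

lemma IsGeodesicOn.geodesicEqAt {γ : ℝ → M × M'} {I : Set ℝ} (h : IsGeodesicOn n i i' c N γ I)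
    {t : ℝ} (ht : t ∈ I) :
    GeodesicEqAt (localCost n i i' c (γ t)) (fun s => coords n (γ t) (γ s)) t :=
  (h.2.2 t ht).2

/-- Along a geodesic with constant second component, `D̄c` is affine. -/
lemma barGrad_affine (hN : IsOpen N) (hA0 : SmoothOn n i i' c N) (hnd : NonDegenerate n i i' c N)
    {γ : ℝ → M × M'} {I : Set ℝ} (hI : IsOpen I) (hI' : I.OrdConnected)
    (hγ : IsGeodesicOn n i i' c N γ I) {w : M'} (hw : ∀ t ∈ I, (γ t).2 = w) (k : Fin n) :
    ∃ a b : ℝ, ∀ t ∈ I, barGrad n i i' c w (γ t).1 k = a + b * t := by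
  have key : ∀ t ∈ I, (fun s => barGrad n i i' c w (γ s).1 k) =ᶠ[𝓝 t] fun s =>
      pd (Sum.inr k) (localCost n i i' c (γ t)) (coords n (γ t) (γ s)) := by
    intro t ht
    have hc : ContinuousAt γ t := (hγ.1 t ht).continuousAt (hI.mem_nhds ht)
    have h1 := (continuousAt_fst.comp hc).eventually
      ((chartAt (Eu n) (γ t).1).open_source.mem_nhds (mem_chart_source _ _))
    filter_upwards [h1, hI.mem_nhds ht] with s hs hs'
    have e1 : γ t = ((γ t).1, w) := Prod.ext rfl (hw t ht)
    have e2 : γ s = ((γ s).1, w) := Prod.ext rfl (hw s hs')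
    rw [barGrad_eq_pd hN hA0 (y := (γ s).1) (e2 ▸ hγ.2.1 s hs') hs k, ← e1, ← e2]
  have hL : ∀ t ∈ I, ContDiffAt ℝ 4 (localCost n i i' c (γ t)) (coords n (γ t) (γ t)) :=
    fun t ht => localCost_contDiffAt hN hA0 (hγ.2.1 t ht) (mem_chart_source _ _)
      (mem_chart_source _ _)
  refine affine_of_deriv2_eq_zero hI hI' (fun t ht => ?_) fun t ht => ?_
  · refine ContDiffAt.congr_of_eventuallyEq ?_ (key t ht)
    exact ContDiffAt.comp t (pd_contDiffAt (m := 2) (hL t ht) (by norm_num) _) (hγ.2.2 t ht).1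
  · have : deriv (fun s => barGrad n i i' c w (γ s).1 k) =ᶠ[𝓝 t] _ :=
      (key t ht).eventuallyEq_nhds.mono fun s hs => hs.deriv_eq
    rw [this.deriv_eq]
    refine deriv2_barred_along_horizontal (ζ := fun s => coords n (γ t) (γ s))
      (isUnit_mixed hnd (hγ.2.1 t ht)) ((hL t ht).of_le (by norm_num)) (hγ.2.2 t ht).1 (fun b => ?_)
      (hγ.geodesicEqAt ht) k
    exact coords_horizontal_const ((hI.eventually_mem ht).mono hw) b

/-- Along a geodesic with constant first component, `Dc` is affine. -/
lemma unbarGrad_affine (hN : IsOpen N) (hA0 : SmoothOn n i i' c N)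
    (hnd : NonDegenerate n i i' c N)
    {γ : ℝ → M × M'} {I : Set ℝ} (hI : IsOpen I) (hI' : I.OrdConnected)
    (hγ : IsGeodesicOn n i i' c N γ I) {x : M} (hx : ∀ t ∈ I, (γ t).1 = x) (k : Fin n) :
    ∃ a b : ℝ, ∀ t ∈ I, unbarGrad n i i' c x (γ t).2 k = a + b * t := by
  have key : ∀ t ∈ I, (fun s => unbarGrad n i i' c x (γ s).2 k) =ᶠ[𝓝 t] fun s =>
      pd (Sum.inl k) (localCost n i i' c (γ t)) (coords n (γ t) (γ s)) := by
    intro t ht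
    have hc : ContinuousAt γ t := (hγ.1 t ht).continuousAt (hI.mem_nhds ht)
    have h1 := (continuousAt_snd.comp hc).eventually
      ((chartAt (Eu n) (γ t).2).open_source.mem_nhds (mem_chart_source _ _))
    filter_upwards [h1, hI.mem_nhds ht] with s hs hs'
    have e1 : γ t = (x, (γ t).2) := Prod.ext (hx t ht) rfl
    have e2 : γ s = (x, (γ s).2) := Prod.ext (hx s hs') rfl
    rw [unbarGrad_eq_pd hN hA0 (w := (γ s).2) (e2 ▸ hγ.2.1 s hs') hs k, ← e1, ← e2]
  have hL : ∀ t ∈ I, ContDiffAt ℝ 4 (localCost n i i' c (γ t)) (coords n (γ t) (γ t)) :=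
    fun t ht => localCost_contDiffAt hN hA0 (hγ.2.1 t ht) (mem_chart_source _ _)
      (mem_chart_source _ _)
  refine affine_of_deriv2_eq_zero hI hI' (fun t ht => ?_) fun t ht => ?_
  · refine ContDiffAt.congr_of_eventuallyEq ?_ (key t ht)
    exact ContDiffAt.comp t (pd_contDiffAt (m := 2) (hL t ht) (by norm_num) _) (hγ.2.2 t ht).1
  · have : deriv (fun s => unbarGrad n i i' c x (γ s).2 k) =ᶠ[𝓝 t] _ :=
      (key t ht).eventuallyEq_nhds.mono fun s hs => hs.deriv_eq
    rw [this.deriv_eq]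
    refine deriv2_unbarred_along_vertical (ζ := fun s => coords n (γ t) (γ s))
      (isUnit_mixed hnd (hγ.2.1 t ht)) ((hL t ht).of_le (by norm_num)) (hγ.2.2 t ht).1 (fun b => ?_)
      (hγ.geodesicEqAt ht) k
    exact coords_vertical_const ((hI.eventually_mem ht).mono hx) b

/-- `D̄c(·, w)` is locally bi-Lipschitz. -/
lemma barGrad_antilipschitz (hN : IsOpen N) (hA0 : SmoothOn n i i' c N)
    (hnd : NonDegenerate n i i' c N) {y : M} {w : M'} (hy : (y, w) ∈ N) :
    ∃ κ : ℝ, 0 ≤ κ ∧ ∀ᶠ q in 𝓝 (y, y), ‖coords n (y, w) (q.1, w) - coords n (y, w) (q.2, w)‖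
      ≤ κ * ‖barGrad n i i' c w q.1 - barGrad n i i' c w q.2‖ := by
  set L := localCost n i i' c (y, w)
  set z₀ : Fin n → ℝ := fun a => chartAt (Eu n) y y a
  set w₀ : Fin n → ℝ := fun a => chartAt (Eu n) w w a
  have hz₀ : coords n (y, w) (y, w) = Sum.elim z₀ w₀ := rfl
  have hL : ContDiffAt ℝ 4 L (Sum.elim z₀ w₀) := by
    rw [← hz₀]
    exact localCost_contDiffAt hN hA0 (p := (y, w)) hy (mem_chart_source _ _) (mem_chart_source _ _)
  let F : (Fin n → ℝ) → Fin n → ℝ := fun z k => pd (Sum.inr k) L (Sum.elim z w₀)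
  let J : (Fin n → ℝ) → Fin n ⊕ Fin n → ℝ := fun z => Sum.elim z w₀
  have hJ : ContDiff ℝ 4 J := by
    refine contDiff_pi.2 fun m => ?_
    rcases m with a | b
    · exact contDiff_apply ℝ ℝ a
    · exact contDiff_const
  have hF : ContDiffAt ℝ 1 F z₀ := by
    refine contDiffAt_pi.2 fun k => ?_
    exact ContDiffAt.comp z₀ (pd_contDiffAt (m := 1) hL (by norm_num) _)
      (hJ.contDiffAt.of_le (by norm_num))
  set A : Matrix (Fin n) (Fin n) ℝ := (mixed L (Sum.elim z₀ w₀)).transpose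
  have hA : IsUnit A := by
    rw [Matrix.isUnit_iff_isUnit_det, Matrix.det_transpose]
    exact isUnit_mixed hnd hy
  -- The derivative of `D̄c(·, w)` is the transposed mixed Hessian, invertible by (A2). The inverse
  -- function theorem, in its quantitative form, then gives the lower Lipschitz bound.
  have hFd : ∀ v, fderiv ℝ F z₀ v = A.mulVec v := by
    intro v
    have hd : DifferentiableAt ℝ F z₀ := hF.differentiableAt (by simp)
    funext k
    have h1 : fderiv ℝ F z₀ v k = fderiv ℝ (fun z => F z k) z₀ v := by
      rw [show (fun z => F z k) = (ContinuousLinearMap.proj (R := ℝ) (φ := fun _ : Fin n => ℝ) k) ∘ F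
        from rfl, ((ContinuousLinearMap.proj k).hasFDerivAt.comp z₀ hd.hasFDerivAt).fderiv]
      rfl
    rw [h1, fderiv_eq_sum_pd]
    simp only [Matrix.mulVec, dotProduct]
    refine Finset.sum_congr rfl fun a _ => ?_
    congr 1
    have hk : DifferentiableAt ℝ (pd (Sum.inr k) L) (Sum.elim z₀ w₀) :=
      (pd_contDiffAt (m := 1) hL (by norm_num) _).differentiableAt (by simp)
    rw [pd_eq_deriv ((differentiableAt_pi.1 hd) k)]
    change _ = pd (Sum.inr k) (pd (Sum.inl a) L) (Sum.elim z₀ w₀)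
    rw [pd_comm (hL.of_le (by norm_num)), pd_eq_deriv hk]
    congr 1
    funext τ
    simp only [F]
    congr 1
    funext m
    rcases m with b | b
    · simp [Pi.single_apply]
    · simp
  have hbij : Function.Bijective A.mulVec :=
    ⟨Matrix.mulVec_injective_of_isUnit hA, Matrix.mulVec_surjective_iff_isUnit.2 hA⟩
  let e : (Fin n → ℝ) ≃L[ℝ] (Fin n → ℝ) :=
    (LinearEquiv.ofBijective (Matrix.mulVecLin A) hbij).toContinuousLinearEquiv
  have he : fderiv ℝ F z₀ = (e : (Fin n → ℝ) →L[ℝ] (Fin n → ℝ)) := by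
    ext v : 1
    exact hFd v
  have hst : HasStrictFDerivAt F (e : (Fin n → ℝ) →L[ℝ] (Fin n → ℝ)) z₀ := by
    rw [← he]
    exact hF.hasStrictFDerivAt (by simp)
  obtain ⟨s, hzs, hso, hs⟩ := hst.approximates_deriv_on_open_nhds
  -- For `n = 0` the inverse has norm zero and the strict inequality fails, whence the first
  -- alternative.
  have hpos : Subsingleton (Fin n → ℝ) ∨
      ‖(e.symm : (Fin n → ℝ) →L[ℝ] (Fin n → ℝ))‖₊⁻¹ / 2
        < ‖(e.symm : (Fin n → ℝ) →L[ℝ] (Fin n → ℝ))‖₊⁻¹ := by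
    rcases subsingleton_or_nontrivial (Fin n → ℝ) with h | h
    · exact Or.inl h
    · refine Or.inr (NNReal.half_lt_self ?_)
      exact inv_ne_zero (ne_of_gt e.nnnorm_symm_pos)
  have hanti := hs.antilipschitz hpos
  set κ := (‖(e.symm : (Fin n → ℝ) →L[ℝ] (Fin n → ℝ))‖₊⁻¹ -
    ‖(e.symm : (Fin n → ℝ) →L[ℝ] (Fin n → ℝ))‖₊⁻¹ / 2)⁻¹
  refine ⟨κ, κ.2, ?_⟩
  have hev : ∀ᶠ y' in 𝓝 y, (y', w) ∈ N ∧ y' ∈ (chartAt (Eu n) y).source ∧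
      (fun a => chartAt (Eu n) y y' a) ∈ s := by
    have h1 : ∀ᶠ y' in 𝓝 y, (y', w) ∈ N :=
      (continuous_id.prodMk continuous_const).continuousAt.eventually (hN.mem_nhds hy)
    have h2 : ContinuousAt (fun y' => (fun a => chartAt (Eu n) y y' a : Fin n → ℝ)) y := by
      refine continuousAt_pi.2 fun a => ?_
      exact (EuclideanSpace.proj (𝕜 := ℝ) a).continuous.continuousAt.comp
        ((chartAt (Eu n) y).continuousAt (mem_chart_source _ _))
    exact h1.and (((chartAt (Eu n) y).open_source.eventually_mem (mem_chart_source _ _)).and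
      (h2.eventually (hso.mem_nhds hzs)))
  rw [nhds_prod_eq]
  filter_upwards [hev.prod_mk hev] with q hq
  obtain ⟨⟨a1, a2, a3⟩, b1, b2, b3⟩ := hq
  have hB : ∀ y', (y', w) ∈ N → y' ∈ (chartAt (Eu n) y).source →
      barGrad n i i' c w y' = F (fun a => chartAt (Eu n) y y' a) := by
    intro y' h1 h2
    funext k
    rw [barGrad_eq_pd hN hA0 h1 h2 k]
    rfl
  have h3 := hanti.le_mul_dist ⟨_, a3⟩ ⟨_, b3⟩
  simp only [Subtype.dist_eq, dist_eq_norm, Set.domRestrict_apply] at h3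
  rw [hB _ a1 a2, hB _ b1 b2]
  refine le_trans ?_ h3
  refine (pi_norm_le_iff_of_nonneg (norm_nonneg _)).2 fun m => ?_
  rcases m with a | b
  · exact norm_le_pi_norm (f := (fun a => chartAt (Eu n) y q.1 a : Fin n → ℝ)
      - fun a => chartAt (Eu n) y q.2 a) a
  · simp [coords]

end Coordinates

/-! ### Reparametrizing by the unit interval. -/

section Interval

/-- Since `b ≠ 0`, time is an affine function of `f` and inherits finite limits at both ends. This
excludes the unbounded intervals that the definition of linkage allows. -/
lemma exists_Ioo_of_affine_limits {I : Set ℝ} (hI : IsOpen I) (hI' : I.OrdConnected)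
    (hne : I.Nonempty) {f : ℝ → ℝ} {a b l₀ l₁ : ℝ} (hb : b ≠ 0) (hf : ∀ t ∈ I, f t = a + b * t)
    (h0 : Tendsto (fun t : I => f t) atBot (𝓝 l₀)) (h1 : Tendsto (fun t : I => f t) atTop (𝓝 l₁)) :
    ∃ α β : ℝ, α < β ∧ I = Set.Ioo α β := by
  have : Nonempty I := hne.to_subtype
  have hval : ∀ t : I, (t : ℝ) = (f t - a) / b := fun t => by
    rw [hf t t.2]; field_simp; ring
  have h0' : Tendsto (fun t : I => (t : ℝ)) atBot (𝓝 ((l₀ - a) / b)) := by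
    exact ((h0.sub_const a).div_const b).congr fun t => (hval t).symm
  have h1' : Tendsto (fun t : I => (t : ℝ)) atTop (𝓝 ((l₁ - a) / b)) := by
    exact ((h1.sub_const a).div_const b).congr fun t => (hval t).symm
  have hbelow : BddBelow I := by
    obtain ⟨s, hs⟩ := eventually_atBot.1 (h0'.eventually (lt_mem_nhds (sub_one_lt _)))
    refine ⟨(l₀ - a) / b - 1, fun t ht => ?_⟩
    rcases le_total t s with h | h
    · exact (hs ⟨t, ht⟩ h).le
    · exact (hs s le_rfl).le.trans h
  have habove : BddAbove I := by
    obtain ⟨s, hs⟩ := eventually_atTop.1 (h1'.eventually (gt_mem_nhds (lt_add_one _)))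
    refine ⟨(l₁ - a) / b + 1, fun t ht => ?_⟩
    rcases le_total t s with h | h
    · exact h.trans (hs s le_rfl).le
    · exact (hs ⟨t, ht⟩ h).le
  have hIoo : I = Set.Ioo (sInf I) (sSup I) := by
    refine Set.Subset.antisymm (fun t ht => ⟨?_, ?_⟩) ?_
    · obtain ⟨l, hl, hl'⟩ := exists_Ioc_subset_of_mem_nhds (hI.mem_nhds ht) ⟨t - 1, sub_one_lt t⟩
      obtain ⟨s, hs, hs'⟩ := exists_between hl
      exact (csInf_le hbelow (hl' ⟨hs, hs'.le⟩)).trans_lt hs'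
    · obtain ⟨l, hl, hl'⟩ := exists_Ico_subset_of_mem_nhds (hI.mem_nhds ht) ⟨t + 1, lt_add_one t⟩
      obtain ⟨s, hs, hs'⟩ := exists_between hl
      exact hs.trans_le (le_csSup habove (hl' ⟨hs.le, hs'⟩))
    · exact IsConnected.Ioo_csInf_csSup_subset ⟨hne, hI'.isPreconnected⟩ hbelow habove
  refine ⟨sInf I, sSup I, ?_, hIoo⟩
  obtain ⟨t, ht⟩ := hne
  rw [hIoo] at ht
  exact ht.1.trans ht.2

lemma tendsto_affine_right {α β : ℝ} (h : α < β) :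
    Tendsto (fun t : ℝ => α + (β - α) * t) (𝓝[>] 0) (𝓝[>] α) := by
  refine tendsto_nhdsWithin_iff.2 ⟨?_, ?_⟩
  · have : Continuous fun t : ℝ => α + (β - α) * t := by fun_prop
    simpa using (this.tendsto 0).mono_left nhdsWithin_le_nhds
  · filter_upwards [self_mem_nhdsWithin] with t ht
    have : 0 < (β - α) * t := mul_pos (sub_pos.2 h) ht
    simpa using this

lemma tendsto_affine_left {α β : ℝ} (h : α < β) :
    Tendsto (fun t : ℝ => α + (β - α) * t) (𝓝[<] 1) (𝓝[<] β) := by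
  refine tendsto_nhdsWithin_iff.2 ⟨?_, ?_⟩
  · have : Continuous fun t : ℝ => α + (β - α) * t := by fun_prop
    simpa using (this.tendsto 1).mono_left nhdsWithin_le_nhds
  · filter_upwards [self_mem_nhdsWithin] with t ht
    have : 0 < (β - α) * (1 - t) := mul_pos (sub_pos.2 h) (sub_pos.2 ht)
    simp only [Set.mem_Iio]; linarith

lemma affine_mem_Ioo {α β t : ℝ} (h : α < β) (ht : t ∈ Set.Ioo (0 : ℝ) 1) :
    α + (β - α) * t ∈ Set.Ioo α β := by
  have h1 : 0 < (β - α) * t := mul_pos (sub_pos.2 h) ht.1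
  have h2 : 0 < (β - α) * (1 - t) := mul_pos (sub_pos.2 h) (sub_pos.2 ht.2)
  constructor <;> linarith

/-- If the components of a curve on an open interval are affine, not all constant, and have limits
at both ends, then the interval is bounded and the curve is the affine interpolation. -/
lemma exists_affine_reparam {κ : Type*} {I : Set ℝ} (hI : IsOpen I) (hI' : I.OrdConnected)
    (hne : I.Nonempty) {f : ℝ → κ → ℝ} (hf : ∀ k, ∃ a b : ℝ, ∀ t ∈ I, f t k = a + b * t)
    {l₀ l₁ : κ → ℝ} (h0 : ∀ k, Tendsto (fun t : I => f t k) atBot (𝓝 (l₀ k)))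
    (h1 : ∀ k, Tendsto (fun t : I => f t k) atTop (𝓝 (l₁ k)))
    (hnc : ¬ ∀ s ∈ I, ∀ t ∈ I, f s = f t) :
    ∃ α β : ℝ, α < β ∧ I = Set.Ioo α β ∧
      ∀ t ∈ Set.Ioo (0 : ℝ) 1, ∀ k, f (α + (β - α) * t) k = (1 - t) * l₀ k + t * l₁ k := by
  choose a b hab using hf
  obtain ⟨k₀, hk₀⟩ : ∃ k, b k ≠ 0 := by
    by_contra! hcon
    exact hnc fun s hs t ht => funext fun k => by rw [hab k s hs, hab k t ht, hcon k]; simp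
  obtain ⟨α, β, hαβ, rfl⟩ := exists_Ioo_of_affine_limits hI hI' hne hk₀ (hab k₀) (h0 k₀) (h1 k₀)
  refine ⟨α, β, hαβ, rfl, fun t ht k => ?_⟩
  have hcont : Continuous fun t : ℝ => a k + b k * t := by fun_prop
  have e0 : a k + b k * α = l₀ k := by
    have t1 := (tendsto_comp_coe_Ioo_atBot (f := fun t => f t k) hαβ).1 (h0 k)
    have t2 : Tendsto (fun t => f t k) (𝓝[>] α) (𝓝 (a k + b k * α)) := by
      refine Tendsto.congr' ?_ ((hcont.tendsto α).mono_left nhdsWithin_le_nhds)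
      filter_upwards [Ioo_mem_nhdsGT hαβ] with s hs using (hab k s hs).symm
    exact tendsto_nhds_unique t2 t1
  have e1 : a k + b k * β = l₁ k := by
    have t1 := (tendsto_comp_coe_Ioo_atTop (f := fun t => f t k) hαβ).1 (h1 k)
    have t2 : Tendsto (fun t => f t k) (𝓝[<] β) (𝓝 (a k + b k * β)) := by
      refine Tendsto.congr' ?_ ((hcont.tendsto β).mono_left nhdsWithin_le_nhds)
      filter_upwards [Ioo_mem_nhdsLT hαβ] with s hs using (hab k s hs).symm
    exact tendsto_nhds_unique t2 t1
  rw [hab k _ (affine_mem_Ioo hαβ ht), ← e0, ← e1]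
  ring

end Interval

/-! ### Geodesics parametrized by `]0, 1[` along which `Dc` or `D̄c` interpolates its end values. -/

section Geodesics

variable {n : ℕ} {M M' K K' : Type*}
  [TopologicalSpace M] [ChartedSpace (Eu n) M] [TopologicalSpace M'] [ChartedSpace (Eu n) M']
  {i : M → K} {i' : M' → K'} {c : K → K' → EReal} {N : Set (M × M')}

lemma IsGeodesicOn.congr {γ γ' : ℝ → M × M'} {I : Set ℝ} (h : IsGeodesicOn n i i' c N γ I)
    (hI : IsOpen I) (heq : ∀ t ∈ I, γ' t = γ t) : IsGeodesicOn n i i' c N γ' I := by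
  refine ⟨h.1.congr heq, fun t ht => heq t ht ▸ h.2.1 t ht, fun t ht => ?_⟩
  have hev : γ' =ᶠ[𝓝 t] γ := (hI.eventually_mem ht).mono heq
  have hc : (fun s => coords n (γ t) (γ' s)) =ᶠ[𝓝 t] fun s => coords n (γ t) (γ s) :=
    hev.mono fun s hs => by simp only [hs]
  have hm : ∀ m, (fun s => coords n (γ t) (γ' s) m) =ᶠ[𝓝 t] fun s => coords n (γ t) (γ s) m :=
    fun m => hc.mono fun s hs => congrFun hs m
  have hm2 : ∀ m, deriv (fun s => coords n (γ t) (γ' s) m) =ᶠ[𝓝 t]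
      deriv (fun s => coords n (γ t) (γ s) m) := fun m =>
    (hm m).eventuallyEq_nhds.mono fun s hs => hs.deriv_eq
  rw [heq t ht]
  refine ⟨(h.2.2 t ht).1.congr_of_eventuallyEq hc, fun m => ?_⟩
  rw [(hm2 m).deriv_eq]
  simp only [(hm _).deriv_eq]
  exact (h.2.2 t ht).2 m

lemma deriv_comp_affine (f : ℝ → ℝ) (α l : ℝ) :
    deriv (fun s => f (α + l * s)) = fun s => l * deriv f (α + l * s) := by
  funext s
  rw [show (fun s => f (α + l * s)) = fun s => (fun r => f (α + r)) (l * s) from rfl,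
    deriv_comp_mul_left l (fun r => f (α + r)), deriv_comp_const_add, smul_eq_mul]

lemma IsGeodesicOn.comp_affine {γ : ℝ → M × M'} {I J : Set ℝ} (h : IsGeodesicOn n i i' c N γ I)
    {α l : ℝ} (hJ : ∀ t ∈ J, α + l * t ∈ I) :
    IsGeodesicOn n i i' c N (fun t => γ (α + l * t)) J := by
  refine ⟨h.1.comp (by fun_prop) hJ, fun t ht => h.2.1 _ (hJ t ht), fun t ht => ⟨?_, fun m => ?_⟩⟩
  · exact ContDiffAt.comp t (g := fun s => coords n (γ (α + l * t)) (γ s))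
      (f := fun s => α + l * s) (h.2.2 _ (hJ t ht)).1 (by fun_prop)
  · have h1 := (h.2.2 _ (hJ t ht)).2 m
    have h2 : ∀ a, deriv (fun s => coords n (γ (α + l * t)) (γ (α + l * s)) a)
        = fun s => l * deriv (fun s => coords n (γ (α + l * t)) (γ s) a) (α + l * s) := fun a =>
      deriv_comp_affine (fun s => coords n (γ (α + l * t)) (γ s) a) α l
    simp only [h2]
    rw [deriv_const_mul_field', deriv_comp_affine (deriv fun s => coords n (γ (α + l * t)) (γ s) m)]
    have h3 := congrArg (fun r => l * l * r) h1
    simp only [mul_add, mul_zero, Finset.mul_sum] at h3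
    rw [← h3]
    congr 1
    · ring
    · refine Finset.sum_congr rfl fun a _ => Finset.sum_congr rfl fun b _ => ?_
      ring

variable [TopologicalSpace K] [TopologicalSpace K']
  [IsManifold 𝓘(ℝ, Eu n) ∞ M] [IsManifold 𝓘(ℝ, Eu n) ∞ M']

/-- Two points seen from `x` that are linked by a geodesic are joined by a geodesic parametrized by
`]0, 1[` along which `Dc` interpolates. -/
lemma exists_vertical_geodesic (hi : Topology.IsEmbedding i) (hi' : Topology.IsEmbedding i')
    (hN : IsOpen N) (hA0 : SmoothOn n i i' c N) (hnd : NonDegenerate n i i' c N)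
    (hA1 : Twisted n i i' c N) [T2Space K'] {x : M} {w₀ w₁ : M'} (h₀ : (x, w₀) ∈ N)
    (h₁ : (x, w₁) ∈ N) (hne : w₀ ≠ w₁)
    {W : Set K'} (hl : LinkedIn n i i' c N ({i x} ×ˢ W) (i x, i' w₀) (i x, i' w₁)) :
    ∃ w : ℝ → M', IsGeodesicOn n i i' c N (fun t => (x, w t)) (Set.Ioo 0 1) ∧
      Tendsto w (𝓝[>] 0) (𝓝 w₀) ∧ Tendsto w (𝓝[<] 1) (𝓝 w₁) ∧
      ∀ t ∈ Set.Ioo (0 : ℝ) 1, ∀ k, unbarGrad n i i' c x (w t) k =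
        (1 - t) * unbarGrad n i i' c x w₀ k + t * unbarGrad n i i' c x w₁ k := by
  obtain ⟨I, γ, hI, hI', hIne, hγ, hW, hb, ht⟩ := hl
  have : Nonempty I := hIne.to_subtype
  have hx : ∀ t ∈ I, (γ t).1 = x := fun t ht => hi.injective (hW t ht).1
  have hb' : Tendsto (fun t : I => (γ t).2) atBot (𝓝 w₀) :=
    hi'.isInducing.tendsto_nhds_iff.2 ((continuous_snd.tendsto _).comp hb)
  have ht' : Tendsto (fun t : I => (γ t).2) atTop (𝓝 w₁) :=
    hi'.isInducing.tendsto_nhds_iff.2 ((continuous_snd.tendsto _).comp ht)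
  have haff := unbarGrad_affine hN hA0 hnd hI hI' hγ hx
  have hmem : ∀ t ∈ I, (x, (γ t).2) ∈ N := fun t ht => by
    have := hγ.2.1 t ht
    rwa [← hx t ht]
  -- If `Dc` were constant along the geodesic, the twist condition would make the geodesic constant
  -- and its two limits equal.
  have hnc : ¬ ∀ s ∈ I, ∀ t ∈ I, unbarGrad n i i' c x (γ s).2 = unbarGrad n i i' c x (γ t).2 := by
    intro hcon
    have hcst : ∀ s ∈ I, ∀ t ∈ I, (γ s).2 = (γ t).2 := by
      intro s hs t ht
      refine hA1 x (hmem s hs) (hmem t ht) ?_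
      have : (negDc n i c x (i' (γ s).2) : Eu n →L[ℝ] ℝ) = negDc n i c x (i' (γ t).2) := by
        refine ContinuousLinearMap.coe_injective
          ((EuclideanSpace.basisFun (Fin n) ℝ).toBasis.ext fun k => ?_)
        have h1 := negDc_apply_single hN hA0 (hmem s hs) k
        have h2 := negDc_apply_single hN hA0 (hmem t ht) k
        simp only [OrthonormalBasis.coe_toBasis, EuclideanSpace.basisFun_apply]
        refine h1.trans (Eq.trans ?_ h2.symm)
        rw [hcon s hs t ht]
      exact this
    obtain ⟨t₀, ht₀⟩ := hIne
    have hT : T2Space M' := hi'.t2Space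
    have e0 : w₀ = (γ t₀).2 := tendsto_nhds_unique hb'
      (tendsto_const_nhds.congr fun t => (hcst t t.2 t₀ ht₀).symm)
    have e1 : w₁ = (γ t₀).2 := tendsto_nhds_unique ht'
      (tendsto_const_nhds.congr fun t => (hcst t t.2 t₀ ht₀).symm)
    exact hne (e0.trans e1.symm)
  obtain ⟨α, β, hαβ, rfl, hr⟩ := exists_affine_reparam hI hI' hIne
    (f := fun t => unbarGrad n i i' c x (γ t).2) haff
    (fun k => (unbarGrad_continuousAt hN hA0 h₀ k).tendsto.comp hb')
    (fun k => (unbarGrad_continuousAt hN hA0 h₁ k).tendsto.comp ht') hnc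
  refine ⟨fun t => (γ (α + (β - α) * t)).2, ?_, ?_, ?_, fun t ht k => hr t ht k⟩
  · refine (hγ.comp_affine (J := Set.Ioo 0 1) fun t ht => affine_mem_Ioo hαβ ht).congr isOpen_Ioo
      fun t ht => ?_
    exact Prod.ext (hx _ (affine_mem_Ioo hαβ ht)).symm rfl
  · exact ((tendsto_comp_coe_Ioo_atBot (f := fun t => (γ t).2) hαβ).1 hb').comp
      (tendsto_affine_right hαβ)
  · exact ((tendsto_comp_coe_Ioo_atTop (f := fun t => (γ t).2) hαβ).1 ht').comp
      (tendsto_affine_left hαβ)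

/-- Points of `N(w)` that are linked by a geodesic are joined by a geodesic parametrized by
`]0, 1[` along which `D̄c` interpolates. -/
lemma exists_horizontal_geodesic (hi : Topology.IsEmbedding i) (hi' : Topology.IsEmbedding i')
    (hN : IsOpen N) (hA0 : SmoothOn n i i' c N) (hnd : NonDegenerate n i i' c N)
    [T2Space K] {w : M'} {y₀ y₁ : M} (h₀ : (y₀, w) ∈ N)
    (h₁ : (y₁, w) ∈ N) (hne : y₀ ≠ y₁)
    {W : Set K} (hl : LinkedIn n i i' c N (W ×ˢ {i' w}) (i y₀, i' w) (i y₁, i' w)) :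
    ∃ y : ℝ → M, IsGeodesicOn n i i' c N (fun t => (y t, w)) (Set.Ioo 0 1) ∧
      Tendsto y (𝓝[>] 0) (𝓝 y₀) ∧ Tendsto y (𝓝[<] 1) (𝓝 y₁) ∧
      ∀ t ∈ Set.Ioo (0 : ℝ) 1, ∀ k, barGrad n i i' c w (y t) k =
        (1 - t) * barGrad n i i' c w y₀ k + t * barGrad n i i' c w y₁ k := by
  obtain ⟨I, γ, hI, hI', hIne, hγ, hW, hb, ht⟩ := hl
  have : Nonempty I := hIne.to_subtype
  have hx : ∀ t ∈ I, (γ t).2 = w := fun t ht => hi'.injective (hW t ht).2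
  have hb' : Tendsto (fun t : I => (γ t).1) atBot (𝓝 y₀) :=
    hi.isInducing.tendsto_nhds_iff.2 ((continuous_fst.tendsto _).comp hb)
  have ht' : Tendsto (fun t : I => (γ t).1) atTop (𝓝 y₁) :=
    hi.isInducing.tendsto_nhds_iff.2 ((continuous_fst.tendsto _).comp ht)
  have haff := barGrad_affine hN hA0 hnd hI hI' hγ hx
  have hmem : ∀ t ∈ I, ((γ t).1, w) ∈ N := fun t ht => by
    have := hγ.2.1 t ht
    rwa [← hx t ht]
  have hnc : ¬ ∀ s ∈ I, ∀ t ∈ I, barGrad n i i' c w (γ s).1 = barGrad n i i' c w (γ t).1 := by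
    intro hcon
    -- The twist condition concerns `Dc` only. Injectivity of `D̄c(·, w)` is available only locally,
    -- from (A2), so constancy follows from local constancy on the connected interval.
    have hloc : IsLocallyConstant fun t : I => (γ t).1 := by
      rw [IsLocallyConstant.iff_eventually_eq]
      intro t
      obtain ⟨κ, -, hκ⟩ := barGrad_antilipschitz hN hA0 hnd (hmem t t.2)
      have hc : ContinuousAt (fun s : I => (γ s).1) t :=
        (continuousOn_iff_continuous_domRestrict.1 hγ.1).fst.continuousAt
      have h1 := (hc.prodMk (continuousAt_const (y := (γ t).1))).eventually hκ
      have h2 := hc.eventually ((chartAt (Eu n) (γ t).1).open_source.eventually_mem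
        (mem_chart_source _ _))
      filter_upwards [h1, h2] with s hs hs'
      rw [hcon s s.2 t t.2, sub_self, norm_zero, mul_zero] at hs
      have h3 := sub_eq_zero.1 (norm_le_zero_iff.1 hs)
      refine (chartAt (Eu n) (γ t).1).injOn hs' (mem_chart_source _ _) ?_
      ext a
      exact congrFun h3 (Sum.inl a)
    have hcst : ∀ s ∈ I, ∀ t ∈ I, (γ s).1 = (γ t).1 := by
      intro s hs t ht
      have : PreconnectedSpace I := Subtype.preconnectedSpace hI'.isPreconnected
      exact hloc.apply_eq_of_preconnectedSpace ⟨s, hs⟩ ⟨t, ht⟩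
    obtain ⟨t₀, ht₀⟩ := hIne
    have hT : T2Space M := hi.t2Space
    have e0 : y₀ = (γ t₀).1 := tendsto_nhds_unique hb'
      (tendsto_const_nhds.congr fun t => (hcst t t.2 t₀ ht₀).symm)
    have e1 : y₁ = (γ t₀).1 := tendsto_nhds_unique ht'
      (tendsto_const_nhds.congr fun t => (hcst t t.2 t₀ ht₀).symm)
    exact hne (e0.trans e1.symm)
  obtain ⟨α, β, hαβ, rfl, hr⟩ := exists_affine_reparam hI hI' hIne
    (f := fun t => barGrad n i i' c w (γ t).1) haff
    (fun k => (barGrad_continuousAt hN hA0 h₀ k).tendsto.comp hb')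
    (fun k => (barGrad_continuousAt hN hA0 h₁ k).tendsto.comp ht') hnc
  refine ⟨fun t => (γ (α + (β - α) * t)).1, ?_, ?_, ?_, fun t ht k => hr t ht k⟩
  · refine (hγ.comp_affine (J := Set.Ioo 0 1) fun t ht => affine_mem_Ioo hαβ ht).congr isOpen_Ioo
      fun t ht => ?_
    exact Prod.ext rfl (hx _ (affine_mem_Ioo hαβ ht)).symm
  · exact ((tendsto_comp_coe_Ioo_atBot (f := fun t => (γ t).1) hαβ).1 hb').comp
      (tendsto_affine_right hαβ)
  · exact ((tendsto_comp_coe_Ioo_atTop (f := fun t => (γ t).1) hαβ).1 ht').comp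
      (tendsto_affine_left hαβ)

end Geodesics

/-! ### Concavity and quasi-convexity in one variable. -/

section RealLemmas

/-- A concave function on `]0, 1[` with non-positive slope at `0` is bounded by its value there. -/
lemma le_of_deriv2_nonpos {g : ℝ → ℝ} {A B : ℝ} (hg : ∀ s ∈ Set.Ioo (0 : ℝ) 1, ContDiffAt ℝ 2 g s)
    (hg2 : ∀ s ∈ Set.Ioo (0 : ℝ) 1, deriv (deriv g) s ≤ 0) (h0 : Tendsto g (𝓝[>] 0) (𝓝 A))
    (h1 : Tendsto g (𝓝[<] 1) (𝓝 B))
    (hslope : ∀ ε : ℝ, 0 < ε → ∀ᶠ s in 𝓝[>] (0 : ℝ), g s - A ≤ ε * s) : B ≤ A := by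
  have hconc : ConcaveOn ℝ (Set.Ioo (0 : ℝ) 1) g := by
    refine concaveOn_of_deriv2_nonpos (convex_Ioo 0 1)
      (fun s hs => (hg s hs).continuousAt.continuousWithinAt) ?_ ?_ ?_
    · rw [interior_Ioo]
      exact fun s hs => ((hg s hs).differentiableAt (by simp)).differentiableWithinAt
    · rw [interior_Ioo]
      exact fun s hs => ((contDiffAt_deriv (m := 1) (hg s hs) (by norm_num)).differentiableAt
        (by simp)).differentiableWithinAt
    · rw [interior_Ioo]
      exact hg2
  have key : ∀ s' ∈ Set.Ioo (0 : ℝ) 1, g s' ≤ A := by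
    intro s' hs'
    refine le_of_forall_pos_le_add fun ε hε => ?_
    obtain ⟨s, hs1, hs⟩ := ((hslope ε hε).and (Ioo_mem_nhdsGT hs'.1)).exists
    -- By concavity the secant from `r` to `s'` is no steeper than the secant from `r` to `s < s'`.
    -- As `r → 0` the value `g r` becomes `A`, and the second slope becomes at most `ε`.
    have h2 : ∀ᶠ r in 𝓝[>] (0 : ℝ), (g s' - g r) / (s' - r) ≤ (g s - g r) / (s - r) := by
      filter_upwards [Ioo_mem_nhdsGT hs.1] with r hr
      have hrI : r ∈ Set.Ioo (0 : ℝ) 1 := ⟨hr.1, by linarith [hr.2, hs.2, hs'.2]⟩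
      have hsI : s ∈ Set.Ioo (0 : ℝ) 1 := ⟨hs.1, by linarith [hs.2, hs'.2]⟩
      have h3 := hconc.neg.secant_mono hrI hsI hs' hr.2.ne' (hr.2.trans hs.2).ne' hs.2.le
      simp only [Pi.neg_apply, neg_sub_neg] at h3
      rw [← neg_sub (g s) (g r), ← neg_sub (g s') (g r), neg_div, neg_div] at h3
      exact neg_le_neg_iff.1 h3
    have hid : Tendsto (fun r : ℝ => r) (𝓝[>] 0) (𝓝 0) := tendsto_id.mono_left nhdsWithin_le_nhds
    have l1 : Tendsto (fun r => (g s' - g r) / (s' - r)) (𝓝[>] 0) (𝓝 ((g s' - A) / (s' - 0))) :=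
      (h0.const_sub _).div (hid.const_sub _) (by simpa using hs'.1.ne')
    have l2 : Tendsto (fun r => (g s - g r) / (s - r)) (𝓝[>] 0) (𝓝 ((g s - A) / (s - 0))) :=
      (h0.const_sub _).div (hid.const_sub _) (by simpa using hs.1.ne')
    have h3 := le_of_tendsto_of_tendsto l1 l2 h2
    rw [sub_zero, sub_zero] at h3
    have h4 : (g s - A) / s ≤ ε := (div_le_iff₀ hs.1).2 hs1
    have h5 := (div_le_iff₀ hs'.1).1 (h3.trans h4)
    nlinarith [hs'.1, hs'.2]
  refine le_of_tendsto h1 ?_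
  filter_upwards [Ioo_mem_nhdsLT (show (0 : ℝ) < 1 by norm_num)] with s hs using key s hs

lemma mul_le_sub_of_le_deriv {φ φ' : ℝ → ℝ} {δ m : ℝ}
    (h : ∀ τ ∈ Set.Ioo (-δ) δ, HasDerivAt φ (φ' τ) τ) (hm : ∀ τ ∈ Set.Ioo (-δ) δ, m ≤ φ' τ)
    {τ : ℝ} (h0 : 0 ≤ τ) (h1 : τ < δ) : m * τ ≤ φ τ - φ 0 := by
  have := (convex_Ioo (-δ) δ).mul_sub_le_image_sub_of_le_deriv (f := φ) (C := m)
    (fun s hs => (h s hs).continuousAt.continuousWithinAt)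
    (fun s hs => (h s (interior_subset hs)).differentiableAt.differentiableWithinAt)
    (fun s hs => by rw [(h s (interior_subset hs)).deriv]; exact hm s (interior_subset hs))
    0 ⟨by linarith, by linarith⟩ τ ⟨by linarith, h1⟩ h0
  simpa using this

/-- If `V` vanishes only where its time derivative `W` is non-negative, and depends strictly
monotonically on a parameter on which `W` depends in a Lipschitz way, then `V(·, 0)` cannot
decrease to zero. -/
lemma exists_nonpos_before_zero {V W : ℝ → ℝ → ℝ} {t₂ δ m C : ℝ} (hδ : 0 < δ) (hm : 0 < m)
    (hC : 0 ≤ C) (h1 : ∀ t ∈ Set.Ioc (t₂ - δ) t₂, HasDerivAt (fun t => V t 0) (W t 0) t)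
    (h2 : ∀ t ∈ Set.Ioc (t₂ - δ) t₂, ContinuousOn (V t) (Set.Ico 0 δ))
    (h2' : ∀ t ∈ Set.Ioc (t₂ - δ) t₂, ∀ τ ∈ Set.Ico 0 δ, V t τ ≤ V t 0 - m * τ)
    (h3 : ∀ t ∈ Set.Ioc (t₂ - δ) t₂, ∀ τ ∈ Set.Ico 0 δ, W t τ - C * τ ≤ W t 0)
    (h4 : ∀ t ∈ Set.Ioc (t₂ - δ) t₂, ∀ τ ∈ Set.Ico 0 δ, V t τ = 0 → 0 ≤ W t τ)
    (h0 : V t₂ 0 = 0) : ∃ t ∈ Set.Ioo (t₂ - δ) t₂, V t 0 ≤ 0 := by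
  by_contra! hcon
  have ht₂ : t₂ ∈ Set.Ioc (t₂ - δ) t₂ := ⟨by linarith, le_rfl⟩
  have hc : ContinuousAt (fun t => V t 0) t₂ := (h1 t₂ ht₂).continuousAt
  -- Keeps the parameter `V t 0 / m` below `δ`, within the range where the hypotheses hold.
  have hsmall : ∀ᶠ t in 𝓝 t₂, V t 0 < m * δ / 2 :=
    hc.eventually (gt_mem_nhds (by simp only [h0]; positivity))
  obtain ⟨a, ha, ha'⟩ := exists_Ioc_subset_of_mem_nhds hsmall ⟨t₂ - δ, by linarith⟩
  set b := (max a (t₂ - δ) + t₂) / 2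
  have hmax : max a (t₂ - δ) < t₂ := max_lt ha (by linarith)
  have hb1 : max a (t₂ - δ) < b := by simp only [b]; linarith
  have hb2 : b < t₂ := by simp only [b]; linarith
  have hsub : ∀ t ∈ Set.Icc b t₂, t ∈ Set.Ioc (t₂ - δ) t₂ := fun t ht =>
    ⟨((le_max_right _ _).trans_lt hb1).trans_le ht.1, ht.2⟩
  have hsub' : ∀ t ∈ Set.Icc b t₂, V t 0 < m * δ / 2 := fun t ht =>
    ha' ⟨((le_max_left _ _).trans_lt hb1).trans_le ht.1, ht.2⟩
  -- Since `V t ·` falls at rate at least `m`, it vanishes at some `τ ≤ V t 0 / m`, where `W t τ ≥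
  -- 0`. Returning to `τ = 0` costs at most `C * τ`, and a Gronwall inequality results: `V t 0`
  -- decays at most exponentially and cannot reach zero.
  have hW : ∀ t ∈ Set.Ioo b t₂, -(C / m) * V t 0 ≤ W t 0 := by
    intro t ht
    have ht' := hsub t ⟨ht.1.le, ht.2.le⟩
    have hpos : 0 < V t 0 := hcon t ⟨ht'.1, ht.2⟩
    have hlt : V t 0 / m < δ := by
      rw [div_lt_iff₀ hm]
      nlinarith [hsub' t ⟨ht.1.le, ht.2.le⟩]
    have hnn : 0 ≤ V t 0 / m := by positivity
    have hle : V t (V t 0 / m) ≤ 0 := by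
      have := h2' t ht' _ ⟨hnn, hlt⟩
      rw [mul_div_cancel₀ _ hm.ne', sub_self] at this
      exact this
    have hcont : ContinuousOn (V t) (Set.Icc 0 (V t 0 / m)) :=
      (h2 t ht').mono fun τ hτ => ⟨hτ.1, hτ.2.trans_lt hlt⟩
    obtain ⟨τ, hτ, hτ0⟩ := intermediate_value_Icc' hnn hcont ⟨hle, hpos.le⟩
    have hτ' : τ ∈ Set.Ico 0 δ := ⟨hτ.1, hτ.2.trans_lt hlt⟩
    have h5 := h3 t ht' τ hτ'
    have h6 := h4 t ht' τ hτ' hτ0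
    have h7 : C * τ ≤ C * (V t 0 / m) := mul_le_mul_of_nonneg_left hτ.2 hC
    have h8 : C * (V t 0 / m) = C / m * V t 0 := by ring
    linarith
  have hder : ∀ t ∈ Set.Icc b t₂, HasDerivAt (fun t => V t 0 * Real.exp (C / m * t))
      (W t 0 * Real.exp (C / m * t) + V t 0 * (Real.exp (C / m * t) * (C / m))) t := by
    intro t ht
    refine (h1 t (hsub t ht)).mul ?_
    simpa using ((hasDerivAt_id t).const_mul (C / m)).exp
  have hmono : MonotoneOn (fun t => V t 0 * Real.exp (C / m * t)) (Set.Icc b t₂) := by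
    refine monotoneOn_of_deriv_nonneg (convex_Icc _ _)
      (fun t ht => (hder t ht).continuousAt.continuousWithinAt)
      (fun t ht => (hder t (interior_subset ht)).differentiableAt.differentiableWithinAt)
      fun t ht => ?_
    rw [(hder t (interior_subset ht)).deriv]
    rw [interior_Icc] at ht
    have := hW t ht
    have he := Real.exp_pos (C / m * t)
    have : 0 ≤ (W t 0 + C / m * V t 0) * Real.exp (C / m * t) :=
      mul_nonneg (by linarith) he.le
    linarith
  have h5 := hmono ⟨le_rfl, hb2.le⟩ ⟨hb2.le, le_rfl⟩ hb2.le
  simp only [h0, zero_mul] at h5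
  have h6 : 0 < V b 0 := hcon b ⟨(hsub b ⟨le_rfl, hb2.le⟩).1, hb2⟩
  exact absurd h5 (not_le.2 (mul_pos h6 (Real.exp_pos _)))

/-- A function whose derivative cannot decrease to zero is quasi-convex. -/
lemma le_max_of_no_descent {f : ℝ → ℝ} (hf : ∀ t ∈ Set.Ioo (0 : ℝ) 1, ContDiffAt ℝ 2 f t)
    (hz : ∀ t ∈ Set.Ioo (0 : ℝ) 1, deriv f t = 0 → ∀ a < t, ∃ s ∈ Set.Ioo a t, deriv f s ≤ 0)
    {a t b : ℝ} (ha : 0 < a) (hat : a < t) (htb : t < b) (hb : b < 1) :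
    f t ≤ max (f a) (f b) := by
  rcases le_or_gt (f t) (f a) with h | h
  · exact h.trans (le_max_left _ _)
  refine le_trans ?_ (le_max_right _ _)
  have hI : ∀ s ∈ Set.Icc a b, s ∈ Set.Ioo (0 : ℝ) 1 := fun s hs =>
    ⟨ha.trans_le hs.1, hs.2.trans_lt hb⟩
  have hcont : ContinuousOn f (Set.Icc a b) := fun s hs =>
    (hf s (hI s hs)).continuousAt.continuousWithinAt
  have hdiff : ∀ s ∈ Set.Icc a b, DifferentiableAt ℝ f s := fun s hs =>
    (hf s (hI s hs)).differentiableAt (by simp)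
  -- As `f t > f a`, the derivative is positive at some `t₁ < t`. It remains positive up to `b`: at
  -- its first zero `hz` would produce an earlier non-positive value. So `f` increases from `t` to
  -- `b`.
  obtain ⟨t₁, ht₁, ht₁'⟩ := exists_deriv_eq_slope f hat
    (hcont.mono (Set.Icc_subset_Icc_right htb.le))
    (fun s hs => (hdiff s ⟨hs.1.le, hs.2.le.trans htb.le⟩).differentiableWithinAt)
  have hpos₁ : 0 < deriv f t₁ := by
    rw [ht₁']; exact div_pos (by linarith) (by linarith)
  have hdc : ContinuousOn (deriv f) (Set.Icc a b) := fun s hs =>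
    (contDiffAt_deriv (m := 1) (hf s (hI s hs)) (by norm_num)).continuousAt.continuousWithinAt
  have hpos : ∀ s ∈ Set.Icc t₁ b, 0 < deriv f s := by
    by_contra! hcon
    set S := Set.Icc t₁ b ∩ deriv f ⁻¹' Set.Iic 0
    have hS : IsClosed S := (hdc.mono (Set.Icc_subset_Icc_left ht₁.1.le)).preimage_isClosed_of_isClosed
      isClosed_Icc isClosed_Iic
    have hSne : S.Nonempty := by
      obtain ⟨s, hs, hs'⟩ := hcon
      exact ⟨s, hs, hs'⟩
    have hSb : BddBelow S := ⟨t₁, fun s hs => hs.1.1⟩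
    have hmem := hS.csInf_mem hSne hSb
    set t₂ := sInf S
    have hlt : t₁ < t₂ := by
      refine lt_of_le_of_ne hmem.1.1 fun h => ?_
      have h2 : deriv f t₂ ≤ 0 := hmem.2
      rw [← h] at h2
      linarith
    have hbefore : ∀ s ∈ Set.Ico t₁ t₂, 0 < deriv f s := by
      intro s hs
      by_contra! hle
      exact absurd (csInf_le hSb (show s ∈ S from ⟨⟨hs.1, hs.2.le.trans hmem.1.2⟩, hle⟩))
        (not_le.2 hs.2)
    have ht₂ : t₂ ∈ Set.Icc a b := ⟨ht₁.1.le.trans hmem.1.1, hmem.1.2⟩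
    have hzero : deriv f t₂ = 0 := by
      refine le_antisymm hmem.2 ?_
      have hc : Tendsto (deriv f) (𝓝[<] t₂) (𝓝 (deriv f t₂)) :=
        (contDiffAt_deriv (m := 1) (hf t₂ (hI t₂ ht₂)) (by norm_num)).continuousAt.tendsto.mono_left
          nhdsWithin_le_nhds
      refine ge_of_tendsto hc ?_
      filter_upwards [Ioo_mem_nhdsLT hlt] with s hs using (hbefore s ⟨hs.1.le, hs.2⟩).le
    obtain ⟨s, hs, hs'⟩ := hz t₂ (hI t₂ ht₂) hzero t₁ hlt
    exact absurd hs' (not_le.2 (hbefore s ⟨hs.1.le, hs.2⟩))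
  have hmono : MonotoneOn f (Set.Icc t₁ b) := by
    refine monotoneOn_of_deriv_nonneg (convex_Icc _ _) (hcont.mono (Set.Icc_subset_Icc_left ht₁.1.le))
      (fun s hs => ?_) fun s hs => (hpos s (interior_subset hs)).le
    have := interior_subset hs
    exact (hdiff s ⟨ht₁.1.le.trans this.1, this.2⟩).differentiableWithinAt
  exact hmono ⟨ht₁.2.le, htb.le⟩ ⟨ht₁.2.le.trans htb.le, le_rfl⟩ htb.le

end RealLemmas

/-! ### Time derivatives of the cost along a moving focus. -/

section TimeDerivatives

variable {n : ℕ} {M M' K K' : Type*}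
  [TopologicalSpace M] [ChartedSpace (Eu n) M] [TopologicalSpace M'] [ChartedSpace (Eu n) M']
  {i : M → K} {i' : M' → K'} {c : K → K' → EReal} {N : Set (M × M')}

variable (n) in
/-- Coordinates of a point of `M'` in the preferred chart at `w₀`. -/
def barCoord (w₀ w : M') (k : Fin n) : ℝ := chartAt (Eu n) w₀ w k

lemma coords_inr (p q : M × M') (k : Fin n) :
    coords n p q (Sum.inr k) = barCoord n p.2 q.2 k := rfl

lemma contDiffAt_coords_vertical {p : M × M'} {y : M} {w : ℝ → M'} {t : ℝ} {k : WithTop ℕ∞}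
    (h : ContDiffAt ℝ k (fun s => barCoord n p.2 (w s)) t) :
    ContDiffAt ℝ k (fun s => coords n p (y, w s)) t := by
  refine contDiffAt_pi.2 fun m => ?_
  rcases m with a | b
  · exact contDiffAt_const (c := chartAt (Eu n) p.1 y a)
  · exact contDiffAt_pi.1 h b

variable [IsManifold 𝓘(ℝ, Eu n) ∞ M] [IsManifold 𝓘(ℝ, Eu n) ∞ M']

lemma IsGeodesicOn.contDiffAt_barCoord {x : M} {w : ℝ → M'} {I : Set ℝ}
    (h : IsGeodesicOn n i i' c N (fun t => (x, w t)) I) {t : ℝ} (ht : t ∈ I) :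
    ContDiffAt ℝ 2 (fun s => barCoord n (w t) (w s)) t :=
  contDiffAt_pi.2 fun k => contDiffAt_pi.1 (h.2.2 t ht).1 (Sum.inr k)

lemma cost_eventuallyEq {p : M × M'} {y : M} {w : ℝ → M'} {t : ℝ} (hw : ContinuousAt w t)
    (hy : y ∈ (chartAt (Eu n) p.1).source) (hwt : w t ∈ (chartAt (Eu n) p.2).source) :
    (fun s => (c (i y) (i' (w s))).toReal) =ᶠ[𝓝 t]
      fun s => localCost n i i' c p (coords n p (y, w s)) := by
  filter_upwards [hw.eventually ((chartAt (Eu n) p.2).open_source.eventually_mem hwt)] with s hs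
  rw [localCost_coords (q := (y, w s)) hy hs]

/-- First and second time derivatives of `c(y, w(t))`. -/
lemma hasDerivAt_cost (hN : IsOpen N) (hA0 : SmoothOn n i i' c N) {p : M × M'} {y : M}
    {w : ℝ → M'} {t : ℝ} (hw : ContinuousAt w t) (hyN : (y, w t) ∈ N)
    (hy : y ∈ (chartAt (Eu n) p.1).source) (hwt : w t ∈ (chartAt (Eu n) p.2).source)
    (hc : ContDiffAt ℝ 2 (fun s => barCoord n p.2 (w s)) t) :
    ContDiffAt ℝ 2 (fun s => (c (i y) (i' (w s))).toReal) t ∧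
    deriv (fun s => (c (i y) (i' (w s))).toReal) t = ∑ k, pd (Sum.inr k) (localCost n i i' c p)
      (coords n p (y, w t)) * deriv (fun s => barCoord n p.2 (w s) k) t ∧
    deriv (deriv fun s => (c (i y) (i' (w s))).toReal) t = accel (localCost n i i' c p)
      (fun k => deriv (fun s => barCoord n p.2 (w s) k) t)
      (fun k => deriv (deriv fun s => barCoord n p.2 (w s) k) t) (coords n p (y, w t)) := by
  have hev := cost_eventuallyEq (i := i) (i' := i') (c := c) hw hy hwt
  have hL := localCost_contDiffAt hN hA0 (p := p) hyN hy hwt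
  have hζ := contDiffAt_coords_vertical (y := y) hc
  have hL2 : ContDiffAt ℝ 2 (localCost n i i' c p) (coords n p (y, w t)) := hL.of_le (by norm_num)
  have hz1 : ∀ a, deriv (fun s => coords n p (y, w s) (Sum.inl a)) t = 0 := fun a =>
    (deriv_eventually_const (r := coords n p (y, w t) (Sum.inl a)) (.of_forall fun s => rfl)).1
  have hz2 : ∀ a, deriv (deriv fun s => coords n p (y, w s) (Sum.inl a)) t = 0 := fun a =>
    (deriv_eventually_const (r := coords n p (y, w t) (Sum.inl a)) (.of_forall fun s => rfl)).2
  refine ⟨?_, ?_, ?_⟩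
  · exact (ContDiffAt.comp t (g := localCost n i i' c p) (f := fun s => coords n p (y, w s))
      hL2 hζ).congr_of_eventuallyEq hev
  · rw [hev.deriv_eq, deriv_comp_curve (ζ := fun s => coords n p (y, w s))
      (hL2.differentiableAt (by simp)) (hζ.differentiableAt (by simp)), Fintype.sum_sum_type]
    simp only [hz1, mul_zero, Finset.sum_const_zero, zero_add]
    rfl
  · have hev' : deriv (fun s => (c (i y) (i' (w s))).toReal) =ᶠ[𝓝 t] _ :=
      hev.eventuallyEq_nhds.mono fun s hs => hs.deriv_eq
    rw [hev'.deriv_eq, (hasDerivAt_deriv_comp_curve (ζ := fun s => coords n p (y, w s))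
      hL2 hζ).deriv, Fintype.sum_sum_type]
    simp only [hz1, hz2, mul_zero, Finset.sum_const_zero, zero_add, add_zero,
      Fintype.sum_sum_type, coords_inr, Finset.sum_add_distrib, accel, Finset.sum_mul]
    congr 1
    rw [Finset.sum_comm]
    refine Finset.sum_congr rfl fun a _ => Finset.sum_congr rfl fun b _ => ?_
    ring

end TimeDerivatives

/-! ### Comparison of accelerations by means of (A3w). -/

section Comparison

variable {n : ℕ} {M M' K K' : Type*}
  [TopologicalSpace M] [ChartedSpace (Eu n) M] [TopologicalSpace M'] [ChartedSpace (Eu n) M']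
  [TopologicalSpace K] [TopologicalSpace K']
  {i : M → K} {i' : M' → K'} {c : K → K' → EReal} {N : Set (M × M')}

/-- In this form the null condition says that the derivative of `D̄c` in the direction `P`
annihilates `Q`. -/
lemma metricOf_quadratic (L : (Fin n ⊕ Fin n → ℝ) → ℝ) (z : Fin n ⊕ Fin n → ℝ) (P Q : Fin n → ℝ) :
    (Sum.elim P Q) ⬝ᵥ (metricOf L z).mulVec (Sum.elim P Q)
      = -∑ b, (∑ a, mixed L z a b * P a) * Q b := by
  simp only [dotProduct, Matrix.mulVec, Fintype.sum_sum_type, Sum.elim_inl, Sum.elim_inr,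
    metricOf_inl_inl, metricOf_inr_inr, metricOf_inl_inr, metricOf_inr_inl, zero_mul,
    Finset.sum_const_zero, zero_add, add_zero, Finset.mul_sum, Finset.sum_mul]
  rw [Finset.sum_comm, ← Finset.sum_add_distrib, ← Finset.sum_neg_distrib]
  refine Finset.sum_congr rfl fun b _ => ?_
  rw [← Finset.sum_add_distrib, ← Finset.sum_neg_distrib]
  refine Finset.sum_congr rfl fun a _ => ?_
  ring

variable [IsManifold 𝓘(ℝ, Eu n) ∞ M] [IsManifold 𝓘(ℝ, Eu n) ∞ M']

lemma eventually_mem_slice (hN : IsOpen N) {y : M} {w : M'} (hy : (y, w) ∈ N) :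
    ∀ᶠ y' in 𝓝 y, (y', w) ∈ N ∧ y' ∈ (chartAt (Eu n) y).source :=
  ((continuous_id.prodMk continuous_const).continuousAt.eventually (hN.mem_nhds hy)).and
    ((chartAt (Eu n) y).open_source.eventually_mem (mem_chart_source _ _))

lemma coords_slice_continuousAt (y : M) (w : M') :
    ContinuousAt (fun y' => coords n (y, w) (y', w)) y :=
  ContinuousAt.comp (f := fun y' => (y', w)) (coords_continuousAt (p := (y, w))
      (mem_chart_source _ _) (mem_chart_source _ _)) (by fun_prop)

/-- The unbarred derivatives of `y ↦ ∂²/∂t² c(y, w(t))` vanish at `x` if `(x, w(t))` is a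
geodesic. -/
lemma pd_accel_eq_zero_of_vertical (hN : IsOpen N) (hA0 : SmoothOn n i i' c N)
    (hnd : NonDegenerate n i i' c N) {x : M} {w : ℝ → M'} {I : Set ℝ}
    (hγ : IsGeodesicOn n i i' c N (fun t => (x, w t)) I) {t : ℝ} (ht : t ∈ I) (a : Fin n) :
    pd (Sum.inl a) (accel (localCost n i i' c (x, w t))
      (fun k => deriv (fun s => barCoord n (w t) (w s) k) t)
      (fun k => deriv (deriv fun s => barCoord n (w t) (w s) k) t))
      (coords n (x, w t) (x, w t)) = 0 := by
  have hL : ContDiffAt ℝ 4 (localCost n i i' c (x, w t)) (coords n (x, w t) (x, w t)) :=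
    localCost_contDiffAt hN hA0 (hγ.2.1 t ht) (mem_chart_source _ _) (mem_chart_source _ _)
  have h1 := deriv2_unbarred_along_vertical (ζ := fun s => coords n (x, w t) (x, w s))
    (isUnit_mixed hnd (hγ.2.1 t ht)) (hL.of_le (by norm_num)) (hγ.2.2 t ht).1
    (fun b => .of_forall fun s => rfl) (hγ.geodesicEqAt ht) a
  rw [(hasDerivAt_deriv_comp_curve (ζ := fun s => coords n (x, w t) (x, w s))
      (pd_contDiffAt (m := 2) hL (by norm_num) _) (hγ.2.2 t ht).1).deriv, Fintype.sum_sum_type] at h1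
  have hz1 : ∀ a, deriv (fun s => coords n (x, w t) (x, w s) (Sum.inl a)) t = 0 := fun a =>
    (deriv_eventually_const (r := coords n (x, w t) (x, w t) (Sum.inl a)) (.of_forall fun s => rfl)).1
  have hz2 : ∀ a, deriv (deriv fun s => coords n (x, w t) (x, w s) (Sum.inl a)) t = 0 := fun a =>
    (deriv_eventually_const (r := coords n (x, w t) (x, w t) (Sum.inl a)) (.of_forall fun s => rfl)).2
  simp only [hz1, hz2, mul_zero, Finset.sum_const_zero, zero_add, add_zero,
      Fintype.sum_sum_type, Finset.sum_add_distrib, Finset.sum_mul] at h1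
  rw [pd_inl_accel hL, ← h1, Finset.sum_comm]
  congr 1
  refine Finset.sum_congr rfl fun a _ => Finset.sum_congr rfl fun b _ => ?_
  rw [mul_assoc]
  rfl

/-- If the first time derivatives of the cost along `w` agree at `x` and `y`, the second time
derivatives are ordered. -/
lemma deriv2_cost_le (hi : Topology.IsEmbedding i) (hi' : Topology.IsEmbedding i')
    (hN : IsOpen N) (hA0 : SmoothOn n i i' c N) (hA3w : WeaklyRegular n i i' c N) [T2Space K]
    (hconv : HorizontallyConvex n i i' c N) {x y : M} {w : ℝ → M'} {I : Set ℝ} (hI : IsOpen I)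
    (hγ : IsGeodesicOn n i i' c N (fun t => (x, w t)) I) {t : ℝ} (ht : t ∈ I)
    (hy : (y, w t) ∈ N)
    (h0 : deriv (fun s => (c (i x) (i' (w s))).toReal) t
      = deriv (fun s => (c (i y) (i' (w s))).toReal) t) :
    deriv (deriv fun s => (c (i y) (i' (w s))).toReal) t
      ≤ deriv (deriv fun s => (c (i x) (i' (w s))).toReal) t := by
  rcases eq_or_ne x y with rfl | hne
  · exact le_rfl
  have hnd := hA3w.1
  have hx : (x, w t) ∈ N := hγ.2.1 t ht
  have hwc : ContinuousAt w t :=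
    continuousAt_snd.comp ((hγ.1 t ht).continuousAt (hI.mem_nhds ht))
  set w₀ := w t with hw₀
  set Q : Fin n → ℝ := fun k => deriv (fun s => barCoord n w₀ (w s) k) t with hQ
  set R : Fin n → ℝ := fun k => deriv (deriv fun s => barCoord n w₀ (w s) k) t with hR
  have hbc : ContDiffAt ℝ 2 (fun s => barCoord n w₀ (w s)) t := hγ.contDiffAt_barCoord ht
  -- The acceleration of the cost seen from `y'`. Along the horizontal geodesic from `x` to `y` it
  -- is concave, with slope zero at `x`.
  let G : M → ℝ := fun y' => deriv (deriv fun s => (c (i y') (i' (w s))).toReal) t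
  have hG : ∀ p₁ y' : M, (y', w₀) ∈ N → y' ∈ (chartAt (Eu n) p₁).source →
      G y' = accel (localCost n i i' c (p₁, w₀)) Q R (coords n (p₁, w₀) (y', w₀)) :=
    fun p₁ y' h1 h2 => (hasDerivAt_cost hN hA0 (p := (p₁, w₀)) hwc h1 h2
      (mem_chart_source _ _) hbc).2.2
  have hgrad : ∀ y', (y', w₀) ∈ N → deriv (fun s => (c (i y') (i' (w s))).toReal) t
      = ∑ k, barGrad n i i' c w₀ y' k * Q k := fun y' h1 => by
    rw [(hasDerivAt_cost hN hA0 (p := (y', w₀)) hwc h1 (mem_chart_source _ _)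
      (mem_chart_source _ _) hbc).2.1]
    refine Finset.sum_congr rfl fun k _ => ?_
    rw [barGrad_eq_pd hN hA0 h1 (mem_chart_source _ y') k]
  rw [hgrad x hx, hgrad y hy] at h0
  have hGc : ∀ y', (y', w₀) ∈ N → ContinuousAt G y' := by
    intro y' h1
    have hev : (fun y'' => accel (localCost n i i' c (y', w₀)) Q R (coords n (y', w₀) (y'', w₀)))
        =ᶠ[𝓝 y'] G := (eventually_mem_slice hN h1).mono fun y'' h => (hG y' y'' h.1 h.2).symm
    refine ContinuousAt.congr ?_ hev
    have hL : ContDiffAt ℝ 4 (localCost n i i' c (y', w₀)) (coords n (y', w₀) (y', w₀)) :=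
      localCost_contDiffAt hN hA0 h1 (mem_chart_source _ _) (mem_chart_source _ _)
    exact ContinuousAt.comp (f := fun y'' => coords n (y', w₀) (y'', w₀))
      (accel_contDiffAt hL Q R).continuousAt (coords_slice_continuousAt y' w₀)
  obtain ⟨ys, hys, hys0, hys1, hysa⟩ := exists_horizontal_geodesic hi hi' hN hA0 hnd hx hy hne
    ((hconv w₀).2 (i x, i' w₀) ⟨⟨x, hx, rfl⟩, rfl⟩ (i y, i' w₀) ⟨⟨y, hy, rfl⟩, rfl⟩
      fun h => hne (hi.injective (congrArg Prod.fst h)))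
  have hmem : ∀ s ∈ Set.Ioo (0 : ℝ) 1, (ys s, w₀) ∈ N := hys.2.1
  have hysc : ∀ s ∈ Set.Ioo (0 : ℝ) 1, ContinuousAt ys s := fun s hs =>
    continuousAt_fst.comp ((hys.1 s hs).continuousAt (isOpen_Ioo.mem_nhds hs))
  have hL : ∀ p₁ : M, (p₁, w₀) ∈ N →
      ContDiffAt ℝ 4 (localCost n i i' c (p₁, w₀)) (coords n (p₁, w₀) (p₁, w₀)) := fun p₁ h1 =>
    localCost_contDiffAt hN hA0 h1 (mem_chart_source _ _) (mem_chart_source _ _)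
  have hgev : ∀ s ∈ Set.Ioo (0 : ℝ) 1, (fun r => G (ys r)) =ᶠ[𝓝 s] fun r =>
      accel (localCost n i i' c (ys s, w₀)) Q R (coords n (ys s, w₀) (ys r, w₀)) := fun s hs =>
    ((hysc s hs).eventually (eventually_mem_slice hN (hmem s hs))).mono fun r h =>
      hG (ys s) (ys r) h.1 h.2
  refine le_of_deriv2_nonpos (g := fun s => G (ys s)) (fun s hs => ?_) (fun s hs => ?_)
    ((hGc x hx).tendsto.comp hys0) ((hGc y hy).tendsto.comp hys1) fun ε hε => ?_
  · exact (ContDiffAt.comp s (f := fun r => coords n (ys s, w₀) (ys r, w₀))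
      (accel_contDiffAt (hL _ (hmem s hs)) Q R) (hys.2.2 s hs).1).congr_of_eventuallyEq (hgev s hs)
  · have hev' : deriv (fun r => G (ys r)) =ᶠ[𝓝 s] _ :=
      (hgev s hs).eventuallyEq_nhds.mono fun s hs => hs.deriv_eq
    rw [hev'.deriv_eq, deriv2_accel_along_horizontal (ζ := fun r => coords n (ys s, w₀) (ys r, w₀))
      (isUnit_mixed hnd (hmem s hs)) (hL _ (hmem s hs)) (hys.2.2 s hs).1
      (fun b => .of_forall fun r => rfl) (hys.geodesicEqAt hs)]
    have hsec := hA3w.2 _ (hmem s hs)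
      (fun a => deriv (fun r => coords n (ys s, w₀) (ys r, w₀) (Sum.inl a)) s) Q ?_
    · rw [costMetric_eq] at hsec
      linarith
    rw [costMetric_eq, metricOf_quadratic, neg_eq_zero]
    -- The mixed Hessian maps the velocity of the horizontal geodesic to the derivative of `D̄c`,
    -- which is the constant `D̄c(y) - D̄c(x)`. Paired with `Q` this is the difference of the first
    -- time derivatives, zero by `h0`; so the vector is null.
    have hslope : ∀ b, ∑ a, mixed (localCost n i i' c (ys s, w₀)) (coords n (ys s, w₀) (ys s, w₀)) a b
        * deriv (fun r => coords n (ys s, w₀) (ys r, w₀) (Sum.inl a)) s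
        = barGrad n i i' c w₀ y b - barGrad n i i' c w₀ x b := by
      intro b
      have e1 : (fun r => barGrad n i i' c w₀ (ys r) b) =ᶠ[𝓝 s] fun r =>
          pd (Sum.inr b) (localCost n i i' c (ys s, w₀)) (coords n (ys s, w₀) (ys r, w₀)) :=
        ((hysc s hs).eventually (eventually_mem_slice hN (hmem s hs))).mono fun r h =>
          barGrad_eq_pd hN hA0 h.1 h.2 b
      have e2 : (fun r => barGrad n i i' c w₀ (ys r) b) =ᶠ[𝓝 s] fun r =>
          (1 - r) * barGrad n i i' c w₀ x b + r * barGrad n i i' c w₀ y b :=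
        (isOpen_Ioo.eventually_mem hs).mono fun r hr => hysa r hr b
      have e3 : deriv (fun r : ℝ => (1 - r) * barGrad n i i' c w₀ x b
          + r * barGrad n i i' c w₀ y b) s = barGrad n i i' c w₀ y b - barGrad n i i' c w₀ x b := by
        have := (((hasDerivAt_id s).const_sub 1).mul_const (barGrad n i i' c w₀ x b)).fun_add
          ((hasDerivAt_id s).mul_const (barGrad n i i' c w₀ y b))
        refine this.deriv.trans ?_
        ring
      rw [← e3, ← e2.deriv_eq, e1.deriv_eq, deriv_comp_curve
        (ζ := fun r => coords n (ys s, w₀) (ys r, w₀))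
        ((pd_contDiffAt (m := 3) (hL _ (hmem s hs)) (by norm_num) _).differentiableAt (by simp))
        ((hys.2.2 s hs).1.differentiableAt (by simp)), Fintype.sum_sum_type]
      have hz : ∀ a, deriv (fun r => coords n (ys s, w₀) (ys r, w₀) (Sum.inr a)) s = 0 := fun a =>
        (deriv_eventually_const (r := coords n (ys s, w₀) (ys s, w₀) (Sum.inr a))
          (.of_forall fun s => rfl)).1
      simp only [hz, mul_zero, Finset.sum_const_zero, add_zero]
      refine Finset.sum_congr rfl fun a _ => ?_
      rw [pd_comm ((hL _ (hmem s hs)).of_le (by norm_num)), mixed_apply]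
    simp only [hslope, sub_mul, Finset.sum_sub_distrib]
    linarith
  -- The differential of `G` vanishes at `x`, but the geodesic is known only to have a limit there.
  -- The lower Lipschitz bound for `D̄c`, which is affine in `s`, bounds the coordinate distance
  -- from `x` by `κ * (s * D)`; a `o` of this distance is a `o` of `s`.
  · obtain ⟨κ, hκ0, hκ⟩ := barGrad_antilipschitz hN hA0 hnd hx
    set D := ‖barGrad n i i' c w₀ y - barGrad n i i' c w₀ x‖ with hD
    set Φ := accel (localCost n i i' c (x, w₀)) Q R with hΦ
    set z₀ := coords n (x, w₀) (x, w₀) with hz₀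
    have hΦd : HasFDerivAt Φ (fderiv ℝ Φ z₀) z₀ :=
      ((accel_contDiffAt (hL x hx) Q R).differentiableAt (by simp)).hasFDerivAt
    set ε' := ε / (κ * D + 1)
    have hD0 : 0 ≤ κ * D := mul_nonneg hκ0 (norm_nonneg _)
    have hε' : 0 < ε' := by positivity
    have hz : Tendsto (fun s => coords n (x, w₀) (ys s, w₀)) (𝓝[>] 0) (𝓝 z₀) :=
      (coords_slice_continuousAt x w₀).tendsto.comp hys0
    have h1 := hz.eventually (hΦd.isLittleO.bound hε')
    have h2 := (hys0.prodMk_nhds (tendsto_const_nhds (x := x))).eventually hκ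
    have h3 := hys0.eventually (eventually_mem_slice (n := n) hN hx)
    filter_upwards [h1, h2, h3, Ioo_mem_nhdsGT (show (0 : ℝ) < 1 by norm_num)] with s g1 g2 g3 hs
    have hlin : fderiv ℝ Φ z₀ (coords n (x, w₀) (ys s, w₀) - z₀) = 0 := by
      rw [fderiv_eq_sum_pd, Fintype.sum_sum_type]
      have e1 : ∀ a, pd (Sum.inl a) Φ z₀ = 0 := fun a =>
        pd_accel_eq_zero_of_vertical hN hA0 hnd hγ ht a
      have e2 : ∀ b, (coords n (x, w₀) (ys s, w₀) - z₀) (Sum.inr b) = 0 := fun b => sub_self _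
      simp [e1, e2]
    rw [hlin, sub_zero] at g1
    have hbar : barGrad n i i' c w₀ (ys s) - barGrad n i i' c w₀ x
        = s • (barGrad n i i' c w₀ y - barGrad n i i' c w₀ x) := by
      funext k
      simp only [Pi.sub_apply, Pi.smul_apply, smul_eq_mul, hysa s hs k]
      ring
    rw [hbar, norm_smul, Real.norm_of_nonneg hs.1.le] at g2
    have e3 : G (ys s) - G x ≤ ε' * (κ * (s * D)) := by
      rw [hG x (ys s) g3.1 g3.2, hG x x hx (mem_chart_source _ _)]
      exact (Real.le_norm_self _).trans (g1.trans (mul_le_mul_of_nonneg_left g2 hε'.le))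
    refine e3.trans ?_
    have e4 : ε' * (κ * D) ≤ ε := by
      rw [div_mul_eq_mul_div, div_le_iff₀ (by positivity)]
      nlinarith
    calc ε' * (κ * (s * D)) = ε' * (κ * D) * s := by ring
      _ ≤ ε * s := mul_le_mul_of_nonneg_right e4 hs.1.le

end Comparison

/-! ### Quasi-convexity of the sliding mountain. -/

section NoDescent

variable {n : ℕ} {M M' K K' : Type*}
  [TopologicalSpace M] [ChartedSpace (Eu n) M] [TopologicalSpace M'] [ChartedSpace (Eu n) M']
  [TopologicalSpace K] [TopologicalSpace K']
  {i : M → K} {i' : M' → K'} {c : K → K' → EReal} {N : Set (M × M')}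

lemma hasDerivAt_comp_line {Φ : (Fin n ⊕ Fin n → ℝ) → ℝ} {z e v : Fin n → ℝ} {τ : ℝ}
    (hΦ : DifferentiableAt ℝ Φ (Sum.elim (fun a => z a + τ * e a) v)) :
    HasDerivAt (fun τ => Φ (Sum.elim (fun a => z a + τ * e a) v))
      (∑ a, pd (Sum.inl a) Φ (Sum.elim (fun a => z a + τ * e a) v) * e a) τ := by
  have hl : ∀ a, HasDerivAt (fun τ : ℝ => z a + τ * e a) (e a) τ := fun a => by
    simpa using ((hasDerivAt_id τ).mul_const (e a)).const_add (z a)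
  have hζ : DifferentiableAt ℝ
      (fun τ : ℝ => (Sum.elim (fun a => z a + τ * e a) v : Fin n ⊕ Fin n → ℝ)) τ := by
    refine differentiableAt_pi.2 fun m => ?_
    rcases m with a | b
    · exact (hl a).differentiableAt
    · exact differentiableAt_const _
  have h := hasDerivAt_comp_curve (ζ := fun τ : ℝ => (Sum.elim (fun a => z a + τ * e a) v :
    Fin n ⊕ Fin n → ℝ)) hΦ hζ
  rw [Fintype.sum_sum_type] at h
  simp only [Sum.elim_inl, Sum.elim_inr, (hl _).deriv, deriv_const, mul_zero,
    Finset.sum_const_zero, add_zero] at h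
  exact h

variable [IsManifold 𝓘(ℝ, Eu n) ∞ M] [IsManifold 𝓘(ℝ, Eu n) ∞ M']

/-- By the chain rule the derivative of `Dc(x, w(t))` would vanish with the velocity of `w`, but it
is the constant `B - A`. -/
lemma velocity_ne_zero (hN : IsOpen N) (hA0 : SmoothOn n i i' c N) {x : M} {w : ℝ → M'}
    (hγ : IsGeodesicOn n i i' c N (fun t => (x, w t)) (Set.Ioo 0 1)) {A B : Fin n → ℝ}
    (hAB : A ≠ B) (hint : ∀ t ∈ Set.Ioo (0 : ℝ) 1, ∀ k, unbarGrad n i i' c x (w t) k =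
      (1 - t) * A k + t * B k) {t : ℝ} (ht : t ∈ Set.Ioo (0 : ℝ) 1) :
    (fun k => deriv (fun s => barCoord n (w t) (w s) k) t) ≠ 0 := by
  intro hQ
  obtain ⟨k, hk⟩ := Function.ne_iff.1 hAB
  have hwc : ContinuousAt w t :=
    continuousAt_snd.comp ((hγ.1 t ht).continuousAt (isOpen_Ioo.mem_nhds ht))
  have hL : ContDiffAt ℝ 4 (localCost n i i' c (x, w t)) (coords n (x, w t) (x, w t)) :=
    localCost_contDiffAt hN hA0 (hγ.2.1 t ht) (mem_chart_source _ _) (mem_chart_source _ _)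
  have e1 : (fun s => unbarGrad n i i' c x (w s) k) =ᶠ[𝓝 t] fun s =>
      pd (Sum.inl k) (localCost n i i' c (x, w t)) (coords n (x, w t) (x, w s)) := by
    filter_upwards [hwc.eventually ((chartAt (Eu n) (w t)).open_source.eventually_mem
      (mem_chart_source _ _)), isOpen_Ioo.eventually_mem ht] with s hs hs'
    exact unbarGrad_eq_pd hN hA0 (hγ.2.1 s hs') hs k
  have e2 : (fun s => unbarGrad n i i' c x (w s) k) =ᶠ[𝓝 t] fun s =>
      (1 - s) * A k + s * B k := (isOpen_Ioo.eventually_mem ht).mono fun s hs => hint s hs k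
  have e3 : deriv (fun s : ℝ => (1 - s) * A k + s * B k) t = B k - A k := by
    have := (((hasDerivAt_id t).const_sub 1).mul_const (A k)).fun_add
      ((hasDerivAt_id t).mul_const (B k))
    refine this.deriv.trans ?_
    ring
  rw [← e2.deriv_eq, e1.deriv_eq, deriv_comp_curve (ζ := fun s => coords n (x, w t) (x, w s))
    ((pd_contDiffAt (m := 3) hL (by norm_num) _).differentiableAt (by simp))
    ((hγ.2.2 t ht).1.differentiableAt (by simp)), Fintype.sum_sum_type] at e3
  have hz1 : ∀ a, deriv (fun s => coords n (x, w t) (x, w s) (Sum.inl a)) t = 0 := fun a =>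
    (deriv_eventually_const (r := coords n (x, w t) (x, w t) (Sum.inl a)) (.of_forall fun s => rfl)).1
  have hz2 : ∀ b, deriv (fun s => coords n (x, w t) (x, w s) (Sum.inr b)) t = 0 := fun b =>
    congrFun hQ b
  simp only [hz1, hz2, mul_zero, Finset.sum_const_zero, add_zero] at e3
  exact hk (by linarith)

/-- The time derivative of `c(x, w(t)) - c(y, w(t))` cannot decrease to zero. -/
lemma exists_deriv_nonpos (hi : Topology.IsEmbedding i) (hi' : Topology.IsEmbedding i')
    (hN : IsOpen N) (hA0 : SmoothOn n i i' c N) (hA3w : WeaklyRegular n i i' c N) [T2Space K]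
    (hconv : HorizontallyConvex n i i' c N) {x y : M} {w : ℝ → M'}
    (hγ : IsGeodesicOn n i i' c N (fun t => (x, w t)) (Set.Ioo 0 1)) {A B : Fin n → ℝ}
    (hAB : A ≠ B) (hint : ∀ t ∈ Set.Ioo (0 : ℝ) 1, ∀ k, unbarGrad n i i' c x (w t) k =
      (1 - t) * A k + t * B k) (hy : ∀ t ∈ Set.Ioo (0 : ℝ) 1, (y, w t) ∈ N)
    {t₂ : ℝ} (ht₂ : t₂ ∈ Set.Ioo (0 : ℝ) 1)
    (hz : deriv (fun t => (c (i x) (i' (w t))).toReal - (c (i y) (i' (w t))).toReal) t₂ = 0)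
    {a : ℝ} (ha : a < t₂) : ∃ s ∈ Set.Ioo a t₂,
      deriv (fun t => (c (i x) (i' (w t))).toReal - (c (i y) (i' (w t))).toReal) s ≤ 0 := by
  have hnd := hA3w.1
  set w₂ := w t₂ with hw₂
  have hwc : ∀ t ∈ Set.Ioo (0 : ℝ) 1, ContinuousAt w t := fun t ht =>
    continuousAt_snd.comp ((hγ.1 t ht).continuousAt (isOpen_Ioo.mem_nhds ht))
  set L := localCost n i i' c (y, w₂) with hLdef
  set z : Fin n → ℝ := fun a => chartAt (Eu n) y y a with hzdef
  set q : ℝ → Fin n → ℝ := fun t k => deriv (fun s => barCoord n w₂ (w s) k) t with hq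
  set r : ℝ → Fin n → ℝ := fun t k => deriv (deriv fun s => barCoord n w₂ (w s) k) t with hr
  have hQ0 : q t₂ ≠ 0 := velocity_ne_zero hN hA0 hγ hAB hint ht₂
  -- The direction in which `y` is displaced. With this choice the time derivative of `c(y, w(t))`
  -- at `t₂` changes at the rate `e ⬝ᵥ e > 0` under the displacement.
  set e : Fin n → ℝ := (mixed L (coords n (y, w₂) (y, w₂))).mulVec (q t₂) with he
  have hunit := isUnit_mixed hnd (hy t₂ ht₂)
  have he0 : e ≠ 0 := by
    intro h
    refine hQ0 (Matrix.mulVec_injective_of_isUnit ((Matrix.isUnit_iff_isUnit_det _).2 hunit) ?_)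
    rw [Matrix.mulVec_zero]
    exact h
  set Z : ℝ → ℝ → Fin n ⊕ Fin n → ℝ := fun t τ =>
    Sum.elim (fun a => z a + τ * e a) (barCoord n w₂ (w t)) with hZ
  have hZ0 : Z t₂ 0 = coords n (y, w₂) (y, w₂) := by
    funext m
    rcases m with a | b
    · simp [hZ, hzdef, coords]
    · rfl
  -- The comparison of accelerations speaks only where `V` is zero, so at `y` alone a decay like
  -- `(t₂ - t)²` would not be excluded. The displaced points `yτ τ` supply zeros of `V` at times
  -- close to `t₂`.
  set yτ : ℝ → M := fun τ => (chartAt (Eu n) y).symm (WithLp.toLp 2 fun a => z a + τ * e a) with hyτ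
  have hyτ0 : yτ 0 = y := by
    simp only [hyτ, zero_mul, add_zero]
    exact (chartAt (Eu n) y).left_inv (mem_chart_source _ _)
  have hbc₂ : ContDiffAt ℝ 2 (fun s => barCoord n w₂ (w s)) t₂ := hγ.contDiffAt_barCoord ht₂
  have hbc₂' : ∀ k, ContDiffAt ℝ 2 (fun s => barCoord n w₂ (w s) k) t₂ := contDiffAt_pi.1 hbc₂
  have hL4 : ContDiffAt ℝ 4 L (Z t₂ 0) := by
    rw [hZ0]
    exact localCost_contDiffAt hN hA0 (hy t₂ ht₂) (mem_chart_source _ _) (mem_chart_source _ _)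
  have hZc : ContinuousAt (fun p : ℝ × ℝ => Z p.1 p.2) (t₂, 0) := by
    refine continuousAt_pi.2 fun m => ?_
    rcases m with a | b
    · have : Continuous fun p : ℝ × ℝ => z a + p.2 * e a := by fun_prop
      exact this.continuousAt
    · exact ContinuousAt.comp (f := Prod.fst) (x := (t₂, (0 : ℝ))) (hbc₂' b).continuousAt
        continuousAt_fst
  have hqc : ∀ k, ContinuousAt (fun p : ℝ × ℝ => q p.1 k) (t₂, 0) := fun k =>
    ContinuousAt.comp (f := Prod.fst) (x := (t₂, (0 : ℝ)))
      (contDiffAt_deriv (m := 1) (hbc₂' k) (by norm_num)).continuousAt continuousAt_fst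
  have hrc : ∀ k, ContinuousAt (fun p : ℝ × ℝ => r p.1 k) (t₂, 0) := fun k =>
    ContinuousAt.comp (f := Prod.fst) (x := (t₂, (0 : ℝ)))
      (contDiffAt_deriv (m := 0) (contDiffAt_deriv (m := 1) (hbc₂' k) (by norm_num))
        (by norm_num)).continuousAt continuousAt_fst
  have hcZ : ∀ {Φ : (Fin n ⊕ Fin n → ℝ) → ℝ}, ContinuousAt Φ (Z t₂ 0) →
      ContinuousAt (fun p : ℝ × ℝ => Φ (Z p.1 p.2)) (t₂, 0) := fun h =>
    ContinuousAt.comp (f := fun p : ℝ × ℝ => Z p.1 p.2) h hZc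
  -- derivatives in the parameter `τ`
  set B' : ℝ → ℝ → ℝ := fun t τ => ∑ k, (∑ a, pd (Sum.inl a) (pd (Sum.inr k) L) (Z t τ) * e a)
    * q t k with hB'
  set S' : ℝ → ℝ → ℝ := fun t τ => ∑ a, ((∑ k, ∑ l, pd (Sum.inr k) (fun y => mixed L y a l) (Z t τ)
    * (q t k * q t l)) + ∑ k, mixed L (Z t τ) a k * r t k) * e a with hS'
  have hB'c : ContinuousAt (fun p : ℝ × ℝ => B' p.1 p.2) (t₂, 0) := by
    refine tendsto_finsetSum _ fun k _ => Tendsto.mul (tendsto_finsetSum _ fun a _ => ?_) (hqc k)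
    exact Tendsto.mul_const _ (hcZ (pd_contDiffAt (m := 2) (pd_contDiffAt (m := 3) hL4 (by norm_num) _)
      (by norm_num) _).continuousAt)
  have hS'c : ContinuousAt (fun p : ℝ × ℝ => S' p.1 p.2) (t₂, 0) := by
    refine tendsto_finsetSum _ fun a _ => Tendsto.mul_const _ (Tendsto.add
      (tendsto_finsetSum _ fun k _ => tendsto_finsetSum _ fun l _ => Tendsto.mul ?_
        ((hqc k).mul (hqc l))) (tendsto_finsetSum _ fun k _ => Tendsto.mul ?_ (hrc k)))
    · exact hcZ (pd_contDiffAt (m := 1) (mixed_contDiffAt (m := 2) hL4 (by norm_num) a l)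
        (by norm_num) _).continuousAt
    · exact hcZ (mixed_contDiffAt (m := 2) hL4 (by norm_num) a k).continuousAt
  have hB'pos : 0 < B' t₂ 0 := by
    have h1 : B' t₂ 0 = e ⬝ᵥ e := by
      simp only [hB', dotProduct, Finset.sum_mul]
      rw [Finset.sum_comm]
      refine Finset.sum_congr rfl fun a _ => ?_
      conv_rhs => rw [he]
      simp only [Matrix.mulVec, dotProduct, Finset.sum_mul]
      refine Finset.sum_congr rfl fun k _ => ?_
      rw [pd_comm (hL4.of_le (by norm_num)), hZ0, mixed_apply]
      simp only [he, Matrix.mulVec, dotProduct]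
      ring
    rw [h1]
    exact lt_of_le_of_ne (Finset.sum_nonneg fun a _ => mul_self_nonneg _)
      fun h => he0 (dotProduct_self_eq_zero.1 h.symm)
  -- Half the rate at `(t₂, 0)`, and one more than the size of `S'` there: by continuity `m < B'`
  -- and `-C < S'` hold nearby.
  set m := B' t₂ 0 / 2 with hm
  set C := |S' t₂ 0| + 1 with hC
  have hyτc : ContinuousAt yτ 0 := by
    refine ContinuousAt.comp (f := fun τ : ℝ => (WithLp.toLp 2 fun a => z a + τ * e a : Eu n))
      (g := (chartAt (Eu n) y).symm) ?_ ?_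
    · simp only [zero_mul, add_zero]
      exact (chartAt (Eu n) y).continuousAt_symm (mem_chart_target _ _)
    · exact (PiLp.continuous_toLp 2 _).continuousAt.comp
        (by fun_prop : Continuous fun τ : ℝ => fun a => z a + τ * e a).continuousAt
  have htgt : ∀ᶠ τ in 𝓝 (0 : ℝ), (WithLp.toLp 2 fun a => z a + τ * e a : Eu n)
      ∈ (chartAt (Eu n) y).target := by
    have hcont : ContinuousAt (fun τ : ℝ => (WithLp.toLp 2 fun a => z a + τ * e a : Eu n)) 0 :=
      (PiLp.continuous_toLp 2 _).continuousAt.comp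
        (by fun_prop : Continuous fun τ : ℝ => fun a => z a + τ * e a).continuousAt
    refine hcont.eventually ((chartAt (Eu n) y).open_target.eventually_mem ?_)
    simp only [zero_mul, add_zero]
    exact mem_chart_target _ _
  have hpair : ContinuousAt (fun p : ℝ × ℝ => (yτ p.2, w p.1)) (t₂, 0) :=
    (ContinuousAt.comp (f := Prod.snd) (x := (t₂, (0 : ℝ))) hyτc continuousAt_snd).prodMk
      (ContinuousAt.comp (f := Prod.fst) (x := (t₂, (0 : ℝ))) (hwc t₂ ht₂) continuousAt_fst)
  have hev : ∀ᶠ p : ℝ × ℝ in 𝓝 (t₂, 0), ((yτ p.2, w p.1) ∈ N ∧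
      w p.1 ∈ (chartAt (Eu n) w₂).source) ∧ (p.1 ∈ Set.Ioo (0 : ℝ) 1 ∧
      ContDiffAt ℝ 2 (fun s => barCoord n w₂ (w s)) p.1) ∧
      (WithLp.toLp 2 fun a => z a + p.2 * e a : Eu n) ∈ (chartAt (Eu n) y).target ∧
      m < B' p.1 p.2 ∧ -C < S' p.1 p.2 ∧ ContDiffAt ℝ 4 L (Z p.1 p.2) := by
    refine ((hpair.eventually (hN.eventually_mem ?_)).and ?_).and
      (((continuousAt_fst.eventually (isOpen_Ioo.eventually_mem ht₂)).and
        (continuousAt_fst.eventually (hbc₂.eventually (by simp)))).and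
      ((continuousAt_snd.eventually htgt).and ((hB'c.eventually (lt_mem_nhds ?_)).and
        ((hS'c.eventually (lt_mem_nhds ?_)).and (hZc.eventually (hL4.eventually (by simp)))))))
    · simp only [hyτ0]
      exact hy t₂ ht₂
    · exact (ContinuousAt.comp (f := Prod.fst) (x := (t₂, (0 : ℝ))) (hwc t₂ ht₂)
        continuousAt_fst).eventually ((chartAt (Eu n) w₂).open_source.eventually_mem
          (mem_chart_source _ _))
    · simp only [hm]; linarith
    · simp only [hC]; linarith [neg_abs_le (S' t₂ 0)]
  obtain ⟨δ₀, hδ₀, hball⟩ := Metric.eventually_nhds_iff.1 hev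
  -- Less than `δ₀`, to stay where the estimates hold, and less than `t₂ - a`, so that the time
  -- found lies after `a`.
  set δ := min δ₀ (t₂ - a) / 2 with hδ
  have hmin : 0 < min δ₀ (t₂ - a) := lt_min hδ₀ (by linarith)
  have hδpos : 0 < δ := by simp only [hδ]; linarith
  have hδ1 : δ < δ₀ := by simp only [hδ]; linarith [min_le_left δ₀ (t₂ - a)]
  have hδ2 : δ < t₂ - a := by simp only [hδ]; linarith [min_le_right δ₀ (t₂ - a)]
  have hall : ∀ t ∈ Set.Ioc (t₂ - δ) t₂, ∀ τ ∈ Set.Ioo (-δ) δ, _ := fun t ht τ hτ =>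
    @hball (t, τ) (by
      rw [Prod.dist_eq, max_lt_iff]
      constructor
      · rw [Real.dist_eq, abs_lt]
        constructor <;> linarith [ht.1, ht.2]
      · rw [Real.dist_eq, abs_lt]
        constructor <;> linarith [hτ.1, hτ.2])
  have h0mem : (0 : ℝ) ∈ Set.Ioo (-δ) δ := ⟨by linarith, hδpos⟩
  have hIco : ∀ τ ∈ Set.Ico (0 : ℝ) δ, τ ∈ Set.Ioo (-δ) δ := fun τ hτ => ⟨by linarith [hτ.1], hτ.2⟩
  have hcoord : ∀ t ∈ Set.Ioc (t₂ - δ) t₂, ∀ τ ∈ Set.Ioo (-δ) δ,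
      coords n (y, w₂) (yτ τ, w t) = Z t τ := by
    intro t ht τ hτ
    have h1 := (hall t ht τ hτ).2.2.1
    funext k
    rcases k with a | b
    · simp only [coords, hyτ, hZ, Sum.elim_inl, (chartAt (Eu n) y).right_inv h1]
    · rfl
  have hsrc : ∀ t ∈ Set.Ioc (t₂ - δ) t₂, ∀ τ ∈ Set.Ioo (-δ) δ, yτ τ ∈ (chartAt (Eu n) y).source :=
    fun t ht τ hτ => (chartAt (Eu n) y).map_target (hall t ht τ hτ).2.2.1
  have hcost : ∀ t ∈ Set.Ioc (t₂ - δ) t₂, ∀ τ ∈ Set.Ioo (-δ) δ, _ := fun t ht τ hτ =>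
    hasDerivAt_cost hN hA0 (p := (y, w₂)) (hwc t (hall t ht τ hτ).2.1.1) (hall t ht τ hτ).1.1
      (hsrc t ht τ hτ) (hall t ht τ hτ).1.2 (hall t ht τ hτ).2.1.2
  have hxC : ∀ t ∈ Set.Ioo (0 : ℝ) 1, ContDiffAt ℝ 2 (fun s => (c (i x) (i' (w s))).toReal) t :=
    fun t ht => (hasDerivAt_cost hN hA0 (p := (x, w t)) (hwc t ht) (hγ.2.1 t ht)
      (mem_chart_source _ _) (mem_chart_source _ _) (hγ.contDiffAt_barCoord ht)).1
  have hyC : ∀ t ∈ Set.Ioo (0 : ℝ) 1, ContDiffAt ℝ 2 (fun s => (c (i y) (i' (w s))).toReal) t :=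
    fun t ht => (hasDerivAt_cost hN hA0 (p := (y, w t)) (hwc t ht) (hy t ht)
      (mem_chart_source _ _) (mem_chart_source _ _) (hγ.contDiffAt_barCoord ht)).1
  let V : ℝ → ℝ → ℝ := fun t τ => deriv (fun s => (c (i x) (i' (w s))).toReal) t
    - deriv (fun s => (c (i (yτ τ)) (i' (w s))).toReal) t
  let W : ℝ → ℝ → ℝ := fun t τ => deriv (deriv fun s => (c (i x) (i' (w s))).toReal) t
    - deriv (deriv fun s => (c (i (yτ τ)) (i' (w s))).toReal) t
  have hVf : ∀ t ∈ Set.Ioo (0 : ℝ) 1, V t 0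
      = deriv (fun t => (c (i x) (i' (w t))).toReal - (c (i y) (i' (w t))).toReal) t := by
    intro t ht
    rw [deriv_fun_sub ((hxC t ht).differentiableAt (by simp)) ((hyC t ht).differentiableAt (by simp))]
    simp only [V, hyτ0]
  have hVeq : ∀ t ∈ Set.Ioc (t₂ - δ) t₂, ∀ τ ∈ Set.Ioo (-δ) δ,
      V t τ = deriv (fun s => (c (i x) (i' (w s))).toReal) t
        - ∑ k, pd (Sum.inr k) L (Z t τ) * q t k := fun t ht τ hτ => by
    simp only [V]
    rw [(hcost t ht τ hτ).2.1, hcoord t ht τ hτ]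
  have hWeq : ∀ t ∈ Set.Ioc (t₂ - δ) t₂, ∀ τ ∈ Set.Ioo (-δ) δ,
      W t τ = deriv (deriv fun s => (c (i x) (i' (w s))).toReal) t
        - accel L (q t) (r t) (Z t τ) := fun t ht τ hτ => by
    simp only [W]
    rw [(hcost t ht τ hτ).2.2, hcoord t ht τ hτ]
  have hBder : ∀ t ∈ Set.Ioc (t₂ - δ) t₂, ∀ τ ∈ Set.Ioo (-δ) δ,
      HasDerivAt (fun τ => ∑ k, pd (Sum.inr k) L (Z t τ) * q t k) (B' t τ) τ := by
    intro t ht τ hτ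
    refine HasDerivAt.fun_sum fun k _ => HasDerivAt.mul_const ?_ _
    exact hasDerivAt_comp_line ((pd_contDiffAt (m := 3) (hall t ht τ hτ).2.2.2.2.2 (by norm_num)
      _).differentiableAt (by simp))
  have hSder : ∀ t ∈ Set.Ioc (t₂ - δ) t₂, ∀ τ ∈ Set.Ioo (-δ) δ,
      HasDerivAt (fun τ => accel L (q t) (r t) (Z t τ)) (S' t τ) τ := by
    intro t ht τ hτ
    have hL' := (hall t ht τ hτ).2.2.2.2.2
    have := hasDerivAt_comp_line (z := z) (e := e) (v := barCoord n w₂ (w t)) (τ := τ)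
      (Φ := accel L (q t) (r t)) ((accel_contDiffAt hL' _ _).differentiableAt (by simp))
    refine this.congr_deriv (Finset.sum_congr rfl fun a _ => ?_)
    congr 1
    exact pd_inl_accel hL' _ _ a
  have key : ∃ t ∈ Set.Ioo (t₂ - δ) t₂, V t 0 ≤ 0 := by
    refine exists_nonpos_before_zero (V := V) (W := W) (t₂ := t₂) (m := m) (C := C)
      hδpos (by simp only [hm]; linarith) (by positivity) ?_ ?_ ?_ ?_ ?_ ?_
    · intro t ht
      have ht1 : t ∈ Set.Ioo (0 : ℝ) 1 := (hall t ht 0 h0mem).2.1.1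
      simp only [V, W, hyτ0]
      exact ((contDiffAt_deriv (m := 1) (hxC t ht1) (by norm_num)).differentiableAt
        (by simp)).hasDerivAt.sub ((contDiffAt_deriv (m := 1) (hyC t ht1)
        (by norm_num)).differentiableAt (by simp)).hasDerivAt
    · intro t ht
      refine ContinuousOn.congr (f := fun τ => deriv (fun s => (c (i x) (i' (w s))).toReal) t
          - ∑ k, pd (Sum.inr k) L (Z t τ) * q t k) ?_ fun τ hτ => hVeq t ht τ (hIco τ hτ)
      exact fun τ hτ => (continuousAt_const.sub
        (hBder t ht τ (hIco τ hτ)).continuousAt).continuousWithinAt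
    · intro t ht τ hτ
      rw [hVeq t ht τ (hIco τ hτ), hVeq t ht 0 h0mem]
      have := mul_le_sub_of_le_deriv (hBder t ht) (fun τ hτ => (hall t ht τ hτ).2.2.2.1.le) hτ.1 hτ.2
      linarith
    · intro t ht τ hτ
      rw [hWeq t ht τ (hIco τ hτ), hWeq t ht 0 h0mem]
      have := mul_le_sub_of_le_deriv (hSder t ht) (fun τ hτ => (hall t ht τ hτ).2.2.2.2.1.le)
        hτ.1 hτ.2
      linarith
    · intro t ht τ hτ hV
      have h := hall t ht τ (hIco τ hτ)
      have := deriv2_cost_le hi hi' hN hA0 hA3w hconv isOpen_Ioo hγ h.2.1.1 h.1.1 (sub_eq_zero.1 hV)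
      simp only [W]
      linarith
    · rw [hVf t₂ ht₂, hz]
  obtain ⟨s, hs, hs'⟩ := key
  have hs1 : s ∈ Set.Ioo (0 : ℝ) 1 := (hall s ⟨hs.1, hs.2.le⟩ 0 h0mem).2.1.1
  refine ⟨s, ⟨by linarith [hs.1], hs.2⟩, ?_⟩
  rw [← hVf s hs1]
  exact hs'

/-- Sliding mountains: `t ↦ c(x, w(t)) - c(y, w(t))` is quasi-convex. -/
lemma sliding_le_max (hi : Topology.IsEmbedding i) (hi' : Topology.IsEmbedding i')
    (hN : IsOpen N) (hA0 : SmoothOn n i i' c N) (hA3w : WeaklyRegular n i i' c N) [T2Space K]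
    (hconv : HorizontallyConvex n i i' c N) {x y : M} {w : ℝ → M'}
    (hγ : IsGeodesicOn n i i' c N (fun t => (x, w t)) (Set.Ioo 0 1)) {A B : Fin n → ℝ}
    (hAB : A ≠ B) (hint : ∀ t ∈ Set.Ioo (0 : ℝ) 1, ∀ k, unbarGrad n i i' c x (w t) k =
      (1 - t) * A k + t * B k) (hy : ∀ t ∈ Set.Ioo (0 : ℝ) 1, (y, w t) ∈ N)
    {a t b : ℝ} (ha : 0 < a) (hat : a < t) (htb : t < b) (hb : b < 1) :
    (c (i x) (i' (w t))).toReal - (c (i y) (i' (w t))).toReal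
      ≤ max ((c (i x) (i' (w a))).toReal - (c (i y) (i' (w a))).toReal)
        ((c (i x) (i' (w b))).toReal - (c (i y) (i' (w b))).toReal) := by
  have hwc : ∀ t ∈ Set.Ioo (0 : ℝ) 1, ContinuousAt w t := fun t ht =>
    continuousAt_snd.comp ((hγ.1 t ht).continuousAt (isOpen_Ioo.mem_nhds ht))
  have hC : ∀ y : M, (∀ t ∈ Set.Ioo (0 : ℝ) 1, (y, w t) ∈ N) → ∀ t ∈ Set.Ioo (0 : ℝ) 1,
      ContDiffAt ℝ 2 (fun s => (c (i y) (i' (w s))).toReal) t :=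
    fun y hy t ht => (hasDerivAt_cost hN hA0 (p := (y, w t)) (hwc t ht) (hy t ht)
      (mem_chart_source _ _) (mem_chart_source _ _) (hγ.contDiffAt_barCoord ht)).1
  exact le_max_of_no_descent
    (f := fun t => (c (i x) (i' (w t))).toReal - (c (i y) (i' (w t))).toReal)
    (fun t ht => (hC x hγ.2.1 t ht).sub (hC y hy t ht))
    (fun t ht hz a ha => exists_deriv_nonpos hi hi' hN hA0 hA3w hconv hγ hAB hint hy ht hz ha)
    ha hat htb hb

end NoDescent

/-! ### The sliding mountain on all of `cl M`, and for covectors in the closure of the domain. -/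

section Sliding

variable {n : ℕ} {M M' K K' : Type*}
  [TopologicalSpace M] [ChartedSpace (Eu n) M] [TopologicalSpace M'] [ChartedSpace (Eu n) M']
  [TopologicalSpace K] [TopologicalSpace K']
  {i : M → K} {i' : M' → K'} {c : K → K' → EReal} {N : Set (M × M')}

/-- The mountain focused at `w` that vanishes at `a₀`. -/
def normalized (c : K → K' → EReal) (a₀ : K) (w : K') (a : K) : EReal := -c a w + c a₀ w

/-- Where `c(a, w) = ⊤` the sum is `⊥` plus a finite number, so finiteness at `a₀` suffices to avoid
the discontinuity of addition at `⊥ + ⊤`. -/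
lemma normalized_continuousAt (hc_bot : ∀ a w, c a w ≠ ⊥)
    (hc_cont : Continuous fun p : K × K' => c p.1 p.2) {a₀ : K} {p : K' × K}
    (h : c a₀ p.1 ≠ ⊤) : ContinuousAt (fun p : K' × K => normalized c a₀ p.1 p.2) p := by
  have h1 : ContinuousAt (fun p : K' × K => -c p.2 p.1) p :=
    (continuous_neg.comp (hc_cont.comp continuous_swap)).continuousAt
  have h2 : ContinuousAt (fun p : K' × K => c a₀ p.1) p :=
    (hc_cont.comp (continuous_const.prodMk continuous_fst)).continuousAt
  refine ContinuousAt.comp (f := fun p : K' × K => (-c p.2 p.1, c a₀ p.1))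
    (g := fun q : EReal × EReal => q.1 + q.2) (EReal.continuousAt_add (Or.inr (hc_bot _ _)) (Or.inr h))
    (h1.prodMk h2)

lemma normalized_eq_coe (hc_bot : ∀ a w, c a w ≠ ⊥) {a₀ a : K} {w : K'} (h₀ : c a₀ w ≠ ⊤)
    (h : c a w ≠ ⊤) :
    normalized c a₀ w a = (((c a₀ w).toReal - (c a w).toReal : ℝ) : EReal) := by
  rw [normalized, ← EReal.coe_toReal h₀ (hc_bot _ _), ← EReal.coe_toReal h (hc_bot _ _)]
  norm_cast
  simp only [EReal.toReal_coe]
  ring_nf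

variable [IsManifold 𝓘(ℝ, Eu n) ∞ M] [IsManifold 𝓘(ℝ, Eu n) ∞ M']

/-- Double mountain above sliding mountain, for foci in `N(x)`. -/
lemma sliding_normalized_le_max (hi : Topology.IsEmbedding i) (hid : DenseRange i)
    (hi' : Topology.IsEmbedding i') (hc_bot : ∀ a w, c a w ≠ ⊥)
    (hc_cont : Continuous fun p : K × K' => c p.1 p.2)
    (hN : IsOpen N) (hA0 : SmoothOn n i i' c N) (hA3w : WeaklyRegular n i i' c N) [T2Space K]
    (hconv : HorizontallyConvex n i i' c N) {x : M} {w : ℝ → M'} {w₀ w₁ : M'}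
    (hγ : IsGeodesicOn n i i' c N (fun t => (x, w t)) (Set.Ioo 0 1)) {A B : Fin n → ℝ}
    (hAB : A ≠ B) (hint : ∀ t ∈ Set.Ioo (0 : ℝ) 1, ∀ k, unbarGrad n i i' c x (w t) k =
      (1 - t) * A k + t * B k) (hw₀ : Tendsto w (𝓝[>] 0) (𝓝 w₀)) (hw₁ : Tendsto w (𝓝[<] 1) (𝓝 w₁))
    (h₀ : (x, w₀) ∈ N) (h₁ : (x, w₁) ∈ N)
    (hdense : Dense (⋂ t ∈ Set.Ioo (0 : ℝ) 1, visibleTo N (w t)))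
    {t : ℝ} (ht : t ∈ Set.Ioo (0 : ℝ) 1) (a : K) :
    normalized c (i x) (i' (w t)) a
      ≤ max (normalized c (i x) (i' w₀) a) (normalized c (i x) (i' w₁) a) := by
  have hfin : ∀ p ∈ N, c (i p.1) (i' p.2) ≠ ⊤ := fun p hp => (hA0.1 p hp).ne
  have hcont : ∀ w' : M', (x, w') ∈ N → Continuous fun a => normalized c (i x) (i' w') a :=
    fun w' hw' => continuous_iff_continuousAt.2 fun a =>
      ContinuousAt.comp (f := fun a : K => (i' w', a))
        (normalized_continuousAt hc_bot hc_cont (p := (i' w', a)) (hfin _ hw')) (by fun_prop)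
  have hclosed : IsClosed {a : K | normalized c (i x) (i' (w t)) a
      ≤ max (normalized c (i x) (i' w₀) a) (normalized c (i x) (i' w₁) a)} :=
    isClosed_le (hcont _ (hγ.2.1 t ht)) ((hcont _ h₀).max (hcont _ h₁))
  have hD := hid.dense_image hi.continuous hdense
  -- Both sides are continuous in `a`, so points visible from every focus of the open geodesic,
  -- which are dense, are enough.
  suffices hsub : i '' (⋂ t ∈ Set.Ioo (0 : ℝ) 1, visibleTo N (w t)) ⊆ {a : K |
      normalized c (i x) (i' (w t)) a
        ≤ max (normalized c (i x) (i' w₀) a) (normalized c (i x) (i' w₁) a)} from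
    hclosed.closure_subset_iff.2 hsub (hD a)
  rintro _ ⟨y, hy, rfl⟩
  have hyN : ∀ t ∈ Set.Ioo (0 : ℝ) 1, (y, w t) ∈ N := fun t ht => Set.mem_iInter₂.1 hy t ht
  have hval : ∀ t ∈ Set.Ioo (0 : ℝ) 1, normalized c (i x) (i' (w t)) (i y)
      = (((c (i x) (i' (w t))).toReal - (c (i y) (i' (w t))).toReal : ℝ) : EReal) := fun t ht =>
    normalized_eq_coe hc_bot (hfin _ (hγ.2.1 t ht)) (hfin _ (hyN t ht))
  have hlim : ∀ {l : Filter ℝ} {w' : M'}, (x, w') ∈ N → Tendsto w l (𝓝 w') →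
      Tendsto (fun s => normalized c (i x) (i' (w s)) (i y)) l
        (𝓝 (normalized c (i x) (i' w') (i y))) := fun {l w'} h hl =>
    Tendsto.comp (g := fun p : K' × K => normalized c (i x) p.1 p.2)
      (f := fun s => (i' (w s), i y))
      (normalized_continuousAt hc_bot hc_cont (p := (i' w', i y)) (hfin _ h)).tendsto
      (((hi'.continuous.tendsto _).comp hl).prodMk_nhds tendsto_const_nhds)
  -- Quasi-convexity is known only between interior times; the end foci are reached by letting the
  -- two outer times tend to `0` and `1` independently.
  have hlim2 : Tendsto (fun s : ℝ × ℝ => max (normalized c (i x) (i' (w s.1)) (i y))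
      (normalized c (i x) (i' (w s.2)) (i y))) (𝓝[>] 0 ×ˢ 𝓝[<] 1)
      (𝓝 (max (normalized c (i x) (i' w₀) (i y)) (normalized c (i x) (i' w₁) (i y)))) :=
    ((hlim h₀ hw₀).comp tendsto_fst).max ((hlim h₁ hw₁).comp tendsto_snd)
  refine ge_of_tendsto hlim2 ?_
  filter_upwards [prod_mem_prod (Ioo_mem_nhdsGT ht.1) (Ioo_mem_nhdsLT ht.2)] with s hs
  have hs1 : s.1 ∈ Set.Ioo (0 : ℝ) 1 := ⟨hs.1.1, hs.1.2.trans ht.2⟩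
  have hs2 : s.2 ∈ Set.Ioo (0 : ℝ) 1 := ⟨ht.1.trans hs.2.1, hs.2.2⟩
  rw [hval t ht, hval _ hs1, hval _ hs2, ← EReal.coe_strictMono.monotone.map_max,
    EReal.coe_le_coe_iff]
  exact sliding_le_max hi hi' hN hA0 hA3w hconv hγ hAB hint hyN hs1.1 hs.1.2 hs.2.1 hs2.2

lemma negDc_ext (hN : IsOpen N) (hA0 : SmoothOn n i i' c N) {x : M} {w : M'} (h : (x, w) ∈ N)
    (q : Eu n →L[ℝ] ℝ) (hq : ∀ k, q (EuclideanSpace.single k 1) = -unbarGrad n i i' c x w k) :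
    (negDc n i c x (i' w) : Eu n →L[ℝ] ℝ) = q := by
  refine ContinuousLinearMap.coe_injective
    ((EuclideanSpace.basisFun (Fin n) ℝ).toBasis.ext fun k => ?_)
  simp only [OrthonormalBasis.coe_toBasis, EuclideanSpace.basisFun_apply]
  exact (negDc_apply_single hN hA0 h k).trans (hq k).symm

/-- The interpolation property of the exponential `E` on the domain `-Dc(x, N(x))`. -/
lemma sliding_on_domCExpAt (hi : Topology.IsEmbedding i) (hid : DenseRange i)
    (hi' : Topology.IsEmbedding i') (hc_bot : ∀ a w, c a w ≠ ⊥)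
    (hc_cont : Continuous fun p : K × K' => c p.1 p.2)
    (hN : IsOpen N) (hA0 : SmoothOn n i i' c N) (hA1 : Twisted n i i' c N)
    (hA3w : WeaklyRegular n i i' c N) [T2Space K] [T2Space K']
    (hconv : HorizontallyConvex n i i' c N) {x : M}
    (hx : AppearsConvexFrom n i i' c N x (Set.univ : Set K'))
    (hdense : ∀ (w : ℝ → M') (w₀ w₁ : K'),
      IsGeodesicOn n i i' c N (fun t => (x, w t)) (Set.Ioo 0 1) →
      Tendsto (fun t => i' (w t)) (𝓝[>] 0) (𝓝 w₀) →
      Tendsto (fun t => i' (w t)) (𝓝[<] 1) (𝓝 w₁) →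
      Dense (⋂ t ∈ Set.Ioo (0 : ℝ) 1, visibleTo N (w t)))
    {E : (Eu n →L[ℝ] ℝ) → K'} (hE : ∀ w, (x, w) ∈ N → E (negDc n i c x (i' w)) = i' w)
    {q₀ q₁ : Eu n →L[ℝ] ℝ} (hq₀ : q₀ ∈ domCExpAt n i i' c N x)
    (hq₁ : q₁ ∈ domCExpAt n i i' c N x) {t : ℝ} (ht : t ∈ Set.Ioo (0 : ℝ) 1) :
    (1 - t) • q₀ + t • q₁ ∈ (domCExpAt n i i' c N x : Set (Eu n →L[ℝ] ℝ)) ∧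
    ∀ a, normalized c (i x) (E ((1 - t) • q₀ + t • q₁)) a
      ≤ max (normalized c (i x) (E q₀) a) (normalized c (i x) (E q₁) a) := by
  obtain ⟨w₀, h₀, rfl⟩ := hq₀
  obtain ⟨w₁, h₁, rfl⟩ := hq₁
  -- Geodesic convexity links only distinct points.
  rcases eq_or_ne w₀ w₁ with rfl | hne
  · have hcomb : ∀ q : Eu n →L[ℝ] ℝ, (1 - t) • q + t • q = q := fun q => by
      rw [← add_smul, sub_add_cancel, one_smul]
    have h := hcomb (negDc n i c x (i' w₀))
    exact ⟨h.symm ▸ ⟨w₀, h₀, rfl⟩, fun a => by rw [h, max_self]⟩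
  have hl := hx.2 (i x, i' w₀) ⟨rfl, trivial⟩ (i x, i' w₁) ⟨rfl, trivial⟩
    fun h => hne (hi'.injective (congrArg Prod.snd h))
  obtain ⟨w, hγ, hw0, hw1, hint⟩ := exists_vertical_geodesic hi hi' hN hA0 hA3w.1 hA1 h₀ h₁ hne hl
  have hAB : unbarGrad n i i' c x w₀ ≠ unbarGrad n i i' c x w₁ := by
    intro h
    refine hne (hA1 x h₀ h₁ ?_)
    exact negDc_ext hN hA0 h₀ (negDc n i c x (i' w₁)) fun k => by
      rw [h]; exact negDc_apply_single hN hA0 h₁ k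
  -- Affine interpolation of `Dc` means that the geodesic is the image of the segment between the
  -- two covectors; in particular the domain is convex.
  have hwt : (negDc n i c x (i' (w t)) : Eu n →L[ℝ] ℝ)
      = (1 - t) • (negDc n i c x (i' w₀) : Eu n →L[ℝ] ℝ)
        + t • (negDc n i c x (i' w₁) : Eu n →L[ℝ] ℝ) := by
    refine negDc_ext hN hA0 (hγ.2.1 t ht) _ fun k => ?_
    have e0 := negDc_apply_single hN hA0 h₀ k
    have e1 := negDc_apply_single hN hA0 h₁ k
    rw [hint t ht k]
    refine (congrArg₂ (fun a b => (1 - t) * a + t * b) e0 e1).trans ?_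
    ring
  refine ⟨hwt ▸ ⟨w t, hγ.2.1 t ht, rfl⟩, fun a => ?_⟩
  have hcont' := hi'.continuous
  have h2 := sliding_normalized_le_max hi hid hi' hc_bot hc_cont hN hA0 hA3w hconv hγ hAB hint hw0
    hw1 h₀ h₁ (hdense w (i' w₀) (i' w₁) hγ ((hcont'.tendsto _).comp hw0)
      ((hcont'.tendsto _).comp hw1)) ht a
  have e2 : E ((1 - t) • (negDc n i c x (i' w₀) : Eu n →L[ℝ] ℝ)
        + t • (negDc n i c x (i' w₁) : Eu n →L[ℝ] ℝ)) = i' (w t) :=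
    (congrArg E hwt.symm).trans (hE _ (hγ.2.1 t ht))
  exact le_of_eq_of_le (congrArg (fun v => normalized c (i x) v a) e2)
    (h2.trans_eq (by rw [hE w₀ h₀, hE w₁ h₁]))

/-- The interpolation property extends to the closure of the domain. -/
lemma sliding_on_closure (hc_bot : ∀ a w, c a w ≠ ⊥)
    (hc_cont : Continuous fun p : K × K' => c p.1 p.2) {a₀ : K} {D : Set (Eu n →L[ℝ] ℝ)}
    {E : (Eu n →L[ℝ] ℝ) → K'} (hEc : ContinuousOn E (closure D))
    (hfin : ∀ q ∈ closure D, c a₀ (E q) ≠ ⊤) {t : ℝ}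
    (hD : ∀ q₀ ∈ D, ∀ q₁ ∈ D, (1 - t) • q₀ + t • q₁ ∈ D ∧
      ∀ a, normalized c a₀ (E ((1 - t) • q₀ + t • q₁)) a
        ≤ max (normalized c a₀ (E q₀) a) (normalized c a₀ (E q₁) a))
    {q₀ q₁ : Eu n →L[ℝ] ℝ} (hq₀ : q₀ ∈ closure D) (hq₁ : q₁ ∈ closure D) :
    (1 - t) • q₀ + t • q₁ ∈ closure D ∧
      ∀ a, normalized c a₀ (E ((1 - t) • q₀ + t • q₁)) a
        ≤ max (normalized c a₀ (E q₀) a) (normalized c a₀ (E q₁) a) := by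
  obtain ⟨p₀, hp₀, hl₀⟩ := mem_closure_iff_seq_limit.1 hq₀
  obtain ⟨p₁, hp₁, hl₁⟩ := mem_closure_iff_seq_limit.1 hq₁
  have hl : Tendsto (fun k => (1 - t) • p₀ k + t • p₁ k) atTop (𝓝 ((1 - t) • q₀ + t • q₁)) :=
    (hl₀.const_smul _).add (hl₁.const_smul _)
  have hmem : (1 - t) • q₀ + t • q₁ ∈ closure D :=
    mem_closure_of_tendsto hl (Eventually.of_forall fun k => (hD _ (hp₀ k) _ (hp₁ k)).1)
  refine ⟨hmem, fun a => ?_⟩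
  -- The exponential is continuous on the closure, and `hfin` makes the normalized mountain
  -- continuous at the limiting focus.
  have hlim : ∀ {p : ℕ → Eu n →L[ℝ] ℝ} {q : Eu n →L[ℝ] ℝ}, q ∈ closure D → (∀ k, p k ∈ D) →
      Tendsto p atTop (𝓝 q) →
      Tendsto (fun k => normalized c a₀ (E (p k)) a) atTop (𝓝 (normalized c a₀ (E q) a)) := by
    intro p q hq hp hpq
    have h1 : Tendsto (fun k => E (p k)) atTop (𝓝 (E q)) :=
      (hEc q hq).tendsto.comp (tendsto_nhdsWithin_iff.2 ⟨hpq, .of_forall fun k =>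
        subset_closure (hp k)⟩)
    exact Tendsto.comp (g := fun p : K' × K => normalized c a₀ p.1 p.2)
      (f := fun k => (E (p k), a))
      (normalized_continuousAt hc_bot hc_cont (p := (E q, a)) (hfin q hq)).tendsto
      (h1.prodMk_nhds tendsto_const_nhds)
  exact le_of_tendsto_of_tendsto (hlim hmem (fun k => (hD _ (hp₀ k) _ (hp₁ k)).1) hl)
    ((hlim hq₀ hp₀ hl₀).max (hlim hq₁ hp₁ hl₁))
    (Eventually.of_forall fun k => (hD _ (hp₀ k) _ (hp₁ k)).2 a)

end Sliding

/-! ### Convexity of the set of covectors in contact. -/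

section Contact

variable {n : ℕ} {K K' : Type*} [TopologicalSpace K] [TopologicalSpace K'] {c : K → K' → EReal}
  {u : K → EReal}

/-- The values at `b` may be `⊤`, so terms cannot be moved across the inequality without separating
cases. -/
lemma contact_iff {ua ub ca cb : EReal} (h1 : ua ≠ ⊤) (h2 : ua ≠ ⊥) (h3 : ca ≠ ⊤) (h4 : ca ≠ ⊥)
    (h5 : ub ≠ ⊥) (h6 : cb ≠ ⊥) : ua + ca ≤ ub + cb ↔ -cb + ca + ua ≤ ub := by
  lift ua to ℝ using ⟨h1, h2⟩
  lift ca to ℝ using ⟨h3, h4⟩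
  induction cb with
  | bot => exact absurd rfl h6
  | top => simp [EReal.add_top_of_ne_bot h5]
  | coe cb =>
    induction ub with
    | bot => exact absurd rfl h5
    | top => simp
    | coe ub =>
      norm_cast
      constructor <;> intro h <;> linarith

/-- Puts contact into the form of a global bound on a normalized mountain, to which the sliding
inequality applies. -/
lemma mem_contactSet_iff (hc_bot : ∀ a w, c a w ≠ ⊥) (hu : ∀ a, u a ≠ ⊥) {a : K} (ha : u a ≠ ⊤)
    {w : K'} : w ∈ contactSet c u a ↔ c a w ≠ ⊤ ∧ ∀ b, normalized c a w b + u a ≤ u b := by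
  rw [contactSet, Set.mem_ofPred_eq, lt_top_iff_ne_top]
  refine and_congr_right fun h => forall_congr' fun b => ?_
  exact contact_iff ha (hu a) h (hc_bot _ _) (hu b) (hc_bot _ _)

/-- The covectors in the closure of the domain whose exponential is in contact form a closed
convex set. -/
lemma isClosed_convex_contact (hc_bot : ∀ a w, c a w ≠ ⊥)
    (hc_cont : Continuous fun p : K × K' => c p.1 p.2) (hu : ∀ a, u a ≠ ⊥) {a₀ : K}
    (ha₀ : u a₀ ≠ ⊤) {D : Set (Eu n →L[ℝ] ℝ)}
    {E : (Eu n →L[ℝ] ℝ) → K'} (hEc : ContinuousOn E (closure D))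
    (hfin : ∀ q ∈ closure D, c a₀ (E q) ≠ ⊤)
    (hD : ∀ t ∈ Set.Ioo (0 : ℝ) 1, ∀ q₀ ∈ D, ∀ q₁ ∈ D, (1 - t) • q₀ + t • q₁ ∈ D ∧
      ∀ a, normalized c a₀ (E ((1 - t) • q₀ + t • q₁)) a
        ≤ max (normalized c a₀ (E q₀) a) (normalized c a₀ (E q₁) a)) :
    IsClosed {q | q ∈ closure D ∧ E q ∈ contactSet c u a₀} ∧
      Convex ℝ {q | q ∈ closure D ∧ E q ∈ contactSet c u a₀} := by
  constructor
  · refine IsSeqClosed.isClosed fun p q hp hpq => ?_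
    have hq : q ∈ closure D := isClosed_closure.mem_of_tendsto hpq (.of_forall fun k => (hp k).1)
    refine ⟨hq, (mem_contactSet_iff hc_bot hu ha₀).2 ⟨hfin q hq, fun b => ?_⟩⟩
    have h1 : Tendsto (fun k => E (p k)) atTop (𝓝 (E q)) :=
      (hEc q hq).tendsto.comp (tendsto_nhdsWithin_iff.2 ⟨hpq, .of_forall fun k => (hp k).1⟩)
    have h2 : Tendsto (fun k => normalized c a₀ (E (p k)) b) atTop
        (𝓝 (normalized c a₀ (E q) b)) :=
      Tendsto.comp (g := fun p : K' × K => normalized c a₀ p.1 p.2)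
        (f := fun k => (E (p k), b))
        (normalized_continuousAt hc_bot hc_cont (p := (E q, b)) (hfin q hq)).tendsto
        (h1.prodMk_nhds tendsto_const_nhds)
    have h3 : Tendsto (fun k => normalized c a₀ (E (p k)) b + u a₀) atTop
        (𝓝 (normalized c a₀ (E q) b + u a₀)) :=
      Tendsto.comp (g := fun q : EReal × EReal => q.1 + q.2)
        (f := fun k => (normalized c a₀ (E (p k)) b, u a₀))
        (EReal.continuousAt_add (Or.inr (hu a₀)) (Or.inr ha₀)).tendsto
        (h2.prodMk_nhds tendsto_const_nhds)
    exact le_of_tendsto' h3 fun k => ((mem_contactSet_iff hc_bot hu ha₀).1 (hp k).2).2 b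
  -- The sliding mountain is pointwise below one of two mountains that are below `u`.
  · refine convex_iff_forall_pos.2 fun q₀ hq₀ q₁ hq₁ s t hs ht hst => ?_
    obtain rfl : s = 1 - t := by linarith
    have h := sliding_on_closure hc_bot hc_cont hEc hfin
      (hD t ⟨ht, by linarith⟩) hq₀.1 hq₁.1
    refine ⟨h.1, (mem_contactSet_iff hc_bot hu ha₀).2 ⟨hfin _ h.1, fun b => ?_⟩⟩
    have e0 := ((mem_contactSet_iff hc_bot hu ha₀).1 hq₀.2).2 b
    have e1 := ((mem_contactSet_iff hc_bot hu ha₀).1 hq₁.2).2 b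
    refine (add_le_add_left (h.2 b) (u a₀)).trans ?_
    rcases max_choice (normalized c a₀ (E q₀) b) (normalized c a₀ (E q₁) b) with hm | hm <;>
      rw [hm] <;> assumption

end Contact

end OT

end

noncomputable section

namespace OT

open Filter MeasureTheory

/-! ### Lipschitz and semiconvexity bounds from distributional ones, by mollification. -/

section Mollify

variable {n : ℕ} {F : Eu n → ℝ} {Ω : Set (Eu n)} {C : ℝ}

lemma hasDerivAt_integral_line (hF : Integrable F) {ρ : Eu n → ℝ} (hρ : ContDiff ℝ ∞ ρ)
    (hc : HasCompactSupport ρ) (a v : Eu n) (t : ℝ) :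
    HasDerivAt (fun t : ℝ => ∫ y, F y * ρ (a + t • v - y))
      (∫ y, F y * fderiv ℝ ρ (a + t • v - y) v) t := by
  obtain ⟨B, hB⟩ := (hρ.continuous_fderiv (by simp)).bounded_above_of_compact_support (hc.fderiv ℝ)
  obtain ⟨B₀, hB₀⟩ := hρ.continuous.bounded_above_of_compact_support hc
  have hmeas : ∀ s : ℝ, AEStronglyMeasurable (fun y => ρ (a + s • v - y)) volume := fun s =>
    (hρ.continuous.comp (by fun_prop : Continuous fun y : Eu n =>
      a + s • v - y)).aestronglyMeasurable
  refine (hasDerivAt_integral_of_dominated_loc_of_deriv_le (s := Set.univ)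
    (F := fun s y => F y * ρ (a + s • v - y)) (F' := fun s y => F y * fderiv ℝ ρ (a + s • v - y) v)
    (bound := fun y => ‖F y‖ * (B * ‖v‖)) univ_mem
    (.of_forall fun s => hF.aestronglyMeasurable.mul (hmeas s)) ?_ ?_ ?_ (hF.norm.mul_const _)
    ?_).2
  · exact hF.mul_bdd (hmeas t) (c := B₀) (.of_forall fun y => hB₀ _)
  · exact hF.aestronglyMeasurable.mul (((hρ.continuous_fderiv (by simp)).comp
      (by fun_prop : Continuous fun y : Eu n => a + t • v - y)).clm_apply
        continuous_const).aestronglyMeasurable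
  · refine .of_forall fun y s _ => ?_
    rw [norm_mul]
    gcongr
    exact ((fderiv ℝ ρ (a + s • v - y)).le_opNorm v).trans (by gcongr; exact hB _)
  · refine .of_forall fun y s _ => ?_
    have h1 : HasDerivAt (fun s : ℝ => a + s • v - y) v s := by
      simpa using (((hasDerivAt_id s).smul_const v).const_add a).sub_const y
    exact (((hρ.differentiable (by simp)).differentiableAt.hasFDerivAt
      (x := a + s • v - y)).comp_hasDerivAt s h1).const_mul _

lemma fderiv_comp_const_sub (ρ : Eu n → ℝ) (hρ : Differentiable ℝ ρ) (z y v : Eu n) :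
    fderiv ℝ (fun y => ρ (z - y)) y v = -fderiv ℝ ρ (z - y) v := by
  have h : HasFDerivAt (fun y => z - y) (-ContinuousLinearMap.id ℝ (Eu n)) y :=
    (hasFDerivAt_id y).const_sub z
  have h2 : HasFDerivAt (fun y => ρ (z - y)) _ y := (hρ (z - y)).hasFDerivAt.comp y h
  rw [h2.fderiv]
  simp

lemma hasCompactSupport_comp_const_sub {ρ : Eu n → ℝ} (hc : HasCompactSupport ρ) (z : Eu n) :
    HasCompactSupport fun y => ρ (z - y) :=
  hc.comp_homeomorph (Homeomorph.subLeft z)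

/-- The standard mollifier of radius `ε`. -/
lemma exists_mollifier (n : ℕ) {ε : ℝ} (hε : 0 < ε) : ∃ ρ : Eu n → ℝ, ContDiff ℝ ∞ ρ ∧
    HasCompactSupport ρ ∧ tsupport ρ ⊆ Metric.closedBall 0 ε ∧ (∀ z, 0 ≤ ρ z) ∧ ∫ z, ρ z = 1 := by
  let b : ContDiffBump (0 : Eu n) := ⟨ε / 2, ε, by positivity, by linarith⟩
  exact ⟨b.normed volume, b.contDiff_normed, b.hasCompactSupport_normed,
    (b.tsupport_normed_eq (μ := volume)).le, b.nonneg_normed, b.integral_normed⟩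

lemma abs_mollify_sub_le (hF : Integrable F) {ρ : Eu n → ℝ} (hρ : Continuous ρ)
    (hc : HasCompactSupport ρ) (hρ0 : ∀ z, 0 ≤ ρ z) (hρ1 : ∫ z, ρ z = 1) {ε η : ℝ}
    (hsupp : tsupport ρ ⊆ Metric.closedBall 0 ε) {z : Eu n}
    (hz : ∀ y, dist y z ≤ ε → |F y - F z| ≤ η) :
    |(∫ y, F y * ρ (z - y)) - F z| ≤ η := by
  obtain ⟨B₀, hB₀⟩ := hρ.bounded_above_of_compact_support hc
  have h1 : ∫ y, ρ (z - y) = 1 := by rw [integral_sub_left_eq_self ρ volume z, hρ1]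
  have hi : Integrable fun y => ρ (z - y) :=
    (hρ.comp (by fun_prop)).integrable_of_hasCompactSupport (hasCompactSupport_comp_const_sub hc z)
  have hFi : Integrable fun y => F y * ρ (z - y) :=
    hF.mul_bdd hi.aestronglyMeasurable (c := B₀) (.of_forall fun y => hB₀ _)
  have e : (∫ y, F y * ρ (z - y)) - F z = ∫ y, (F y - F z) * ρ (z - y) := by
    simp_rw [sub_mul]
    rw [integral_sub hFi (hi.const_mul _), integral_const_mul, h1, mul_one]
  rw [e, ← Real.norm_eq_abs]
  calc ‖∫ y, (F y - F z) * ρ (z - y)‖ ≤ ∫ y, η * ρ (z - y) := by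
        refine norm_integral_le_of_norm_le (hi.const_mul η) (.of_forall fun y => ?_)
        by_cases hy : dist y z ≤ ε
        · rw [norm_mul, Real.norm_of_nonneg (hρ0 _)]
          exact mul_le_mul_of_nonneg_right (hz y hy) (hρ0 _)
        · have : ρ (z - y) = 0 := by
            refine image_eq_zero_of_notMem_tsupport fun h => hy ?_
            have := hsupp h
            rwa [mem_closedBall_zero_iff, ← dist_eq_norm, dist_comm] at this
          simp [this]
    _ = η := by rw [integral_const_mul, h1, mul_one]

lemma tsupport_comp_const_sub_subset {ρ : Eu n → ℝ} {ε : ℝ}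
    (hsupp : tsupport ρ ⊆ Metric.closedBall 0 ε) (z : Eu n) :
    tsupport (fun y => ρ (z - y)) ⊆ Metric.closedBall z ε := by
  refine closure_minimal (fun y hy => ?_) Metric.isClosed_closedBall
  have := hsupp (subset_tsupport ρ hy)
  rwa [mem_closedBall_zero_iff, ← dist_eq_norm, dist_comm] at this

/-- Local mollification of a continuous function, together with the distributional derivatives
that its derivatives along a line represent. -/
lemma exists_local_mollification {z₀ : Eu n} {r : ℝ} (hr : 0 < r)
    (hball : Metric.closedBall z₀ (2 * r) ⊆ Ω) (hF : ContinuousOn F Ω) {a v : Eu n}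
    (ha : a ∈ Metric.closedBall z₀ r) (hav : a + v ∈ Metric.closedBall z₀ r) {η : ℝ} (hη : 0 < η) :
    ∃ ψ : ℝ → Eu n → ℝ, (∀ t, ContDiff ℝ ∞ (ψ t)) ∧ (∀ t, HasCompactSupport (ψ t)) ∧
      (∀ t z, 0 ≤ ψ t z) ∧ (∀ t, ∫ z, ψ t z = 1) ∧
      ∃ h h' : ℝ → ℝ,
        (∀ t, HasDerivAt h (h' t) t) ∧
        (∀ t ∈ Set.Icc (0 : ℝ) 1, tsupport (ψ t) ⊆ Ω ∧ |h t - F (a + t • v)| ≤ η ∧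
          h' t = -∫ z, F z * fderiv ℝ (ψ t) z v ∧
          HasDerivAt h' (∫ z, F z * fderiv ℝ (fun y => fderiv ℝ (ψ t) y v) z v) t) := by
  -- Uniform continuity on the compact double ball fixes the accuracy; a mollifier of radius `min δ
  -- r` centred on the segment stays inside that ball.
  obtain ⟨δ, hδ, hδF⟩ := Metric.uniformContinuousOn_iff_le.1
    ((isCompact_closedBall z₀ (2 * r)).uniformContinuousOn_of_continuous (hF.mono hball)) η hη
  have hε : 0 < min δ r := lt_min hδ hr
  obtain ⟨ρ, hρ, hc, hsupp, hρ0, hρ1⟩ := exists_mollifier n hε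
  have hseg : ∀ t ∈ Set.Icc (0 : ℝ) 1, a + t • v ∈ Metric.closedBall z₀ r := by
    intro t ht
    have := (convex_closedBall z₀ r) ha hav (sub_nonneg.2 ht.2) ht.1 (by ring)
    convert this using 1
    module
  have hsub : ∀ t ∈ Set.Icc (0 : ℝ) 1,
      Metric.closedBall (a + t • v) (min δ r) ⊆ Metric.closedBall z₀ (2 * r) := fun t ht =>
    Metric.closedBall_subset_closedBall' (by
      have := Metric.mem_closedBall.1 (hseg t ht)
      linarith [min_le_right δ r])
  -- Truncation makes `F` integrable on the whole space without changing it on the supports of the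
  -- mollifiers.
  let G : Eu n → ℝ := (Metric.closedBall z₀ (2 * r)).indicator F
  have hG : Integrable G := by
    rw [integrable_indicator_iff Metric.isClosed_closedBall.measurableSet]
    exact (hF.mono hball).integrableOn_compact (isCompact_closedBall _ _)
  have hGF : ∀ t ∈ Set.Icc (0 : ℝ) 1, ∀ g : Eu n → ℝ, tsupport g ⊆ Metric.closedBall 0 (min δ r) →
      ∫ y, G y * g (a + t • v - y) = ∫ y, F y * g (a + t • v - y) := by
    intro t ht g hg
    refine integral_congr_ae (.of_forall fun y => ?_)
    by_cases hy : y ∈ Metric.closedBall z₀ (2 * r)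
    · simp only [G, Set.indicator_of_mem hy]
    · have : g (a + t • v - y) = 0 :=
        image_eq_zero_of_notMem_tsupport (f := fun y => g (a + t • v - y)) fun h =>
          hy (hsub t ht (tsupport_comp_const_sub_subset hg _ h))
      simp only [this, mul_zero]
  let ρv : Eu n → ℝ := fun z => fderiv ℝ ρ z v
  have hρv : ContDiff ℝ ∞ ρv := (hρ.fderiv_right (m := ∞) (by simp)).clm_apply contDiff_const
  have hcv : HasCompactSupport ρv := (hc.fderiv ℝ).comp_left (g := fun A : Eu n →L[ℝ] ℝ => A v)
    (by simp)
  have hsv : tsupport ρv ⊆ tsupport ρ := tsupport_fderiv_apply_subset ℝ v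
  have hd : Differentiable ℝ ρ := hρ.differentiable (by simp)
  have hdv : Differentiable ℝ ρv := hρv.differentiable (by simp)
  have hsvv : tsupport (fun z => fderiv ℝ ρv z v) ⊆ tsupport ρv :=
    tsupport_fderiv_apply_subset ℝ v
  have e1 : ∀ z, (fun y => fderiv ℝ (fun y => ρ (z - y)) y v) = fun y => -ρv (z - y) := fun z =>
    funext fun y => fderiv_comp_const_sub ρ hd z y v
  have e2 : ∀ z y, fderiv ℝ (fun y => -ρv (z - y)) y v = fderiv ℝ ρv (z - y) v := fun z y => by
    rw [fderiv_fun_neg, neg_apply, fderiv_comp_const_sub ρv hdv, neg_neg]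
  -- The test functions are translates of a reflected mollifier. A derivative in `t` falls on the
  -- kernel and becomes minus a derivative in the integration variable, whence the sign in the first
  -- derivative of the mollification and none in the second.
  refine ⟨fun t y => ρ (a + t • v - y), fun t => hρ.comp (by fun_prop),
    fun t => hasCompactSupport_comp_const_sub hc _, fun t y => hρ0 _,
    fun t => (integral_sub_left_eq_self ρ volume _).trans hρ1,
    fun t => ∫ y, G y * ρ (a + t • v - y), fun t => ∫ y, G y * ρv (a + t • v - y),
    fun t => hasDerivAt_integral_line hG hρ hc a v t, fun t ht => ⟨?_, ?_, ?_, ?_⟩⟩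
  · exact (tsupport_comp_const_sub_subset hsupp _).trans ((hsub t ht).trans hball)
  · have hmem : a + t • v ∈ Metric.closedBall z₀ (2 * r) :=
      Metric.closedBall_subset_closedBall (by linarith) (hseg t ht)
    have hGz : G (a + t • v) = F (a + t • v) := Set.indicator_of_mem hmem _
    rw [← hGz]
    refine abs_mollify_sub_le hG hρ.continuous hc hρ0 hρ1 hsupp fun y hy => ?_
    have hy' := hsub t ht (Metric.mem_closedBall.2 hy)
    rw [hGz, show G y = F y from Set.indicator_of_mem hy' _, ← Real.dist_eq]
    exact hδF _ hy' _ hmem (hy.trans (min_le_left _ _))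
  · simp only
    rw [hGF t ht ρv (hsv.trans hsupp), ← integral_neg]
    refine integral_congr_ae (.of_forall fun y => ?_)
    have := congrFun (e1 (a + t • v)) y
    simp only at this ⊢
    rw [this]
    ring
  · have h := hasDerivAt_integral_line hG hρv hcv a v t
    rw [hGF t ht _ (hsvv.trans (hsv.trans hsupp))] at h
    simp only [e1, e2]
    exact h

/-- A distributional bound on the gradient is a Lipschitz bound on balls. -/
lemma abs_sub_le_of_distribGradLE {z₀ : Eu n} {r : ℝ} (hr : 0 < r)
    (hball : Metric.closedBall z₀ (2 * r) ⊆ Ω) (hF : ContinuousOn F Ω) (h : DistribGradLE Ω F C)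
    {a b : Eu n} (ha : a ∈ Metric.closedBall z₀ r) (hb : b ∈ Metric.closedBall z₀ r) :
    |F b - F a| ≤ C * ‖b - a‖ := by
  refine le_of_forall_pos_le_add fun η hη => ?_
  obtain ⟨ψ, hψ, hψc, hψ0, hψ1, g, g', hg, hI⟩ := exists_local_mollification hr hball hF (v := b - a)
    ha (by simpa using hb) (half_pos hη)
  have hbd : ∀ t ∈ Set.Icc (0 : ℝ) 1, ‖g' t‖ ≤ C * ‖b - a‖ := by
    intro t ht
    obtain ⟨h1, -, h2, -⟩ := hI t ht
    have := h (ψ t) (hψ t) (hψc t) h1 (b - a)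
    rw [integral_congr_ae (.of_forall fun z => abs_of_nonneg (hψ0 t z)), hψ1, mul_one] at this
    rwa [h2, norm_neg]
  have hmv := (convex_Icc (0 : ℝ) 1).norm_image_sub_le_of_norm_hasDerivWithin_le
    (fun t _ => (hg t).hasDerivWithinAt) hbd (Set.left_mem_Icc.2 zero_le_one)
    (Set.right_mem_Icc.2 zero_le_one)
  have h0 := (hI 0 (Set.left_mem_Icc.2 zero_le_one)).2.1
  have h1 := (hI 1 (Set.right_mem_Icc.2 zero_le_one)).2.1
  simp only [zero_smul, add_zero, one_smul, add_sub_cancel, sub_zero, norm_one, mul_one,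
    Real.norm_eq_abs] at h0 h1 hmv
  rw [abs_le] at *
  constructor <;> linarith [h0.1, h0.2, h1.1, h1.2, hmv.1, hmv.2]

/-- A distributional lower bound on the Hessian is semiconvexity along the segments of a ball. -/
lemma convexOn_of_distribHessGE {z₀ : Eu n} {r : ℝ} (hr : 0 < r)
    (hball : Metric.closedBall z₀ (2 * r) ⊆ Ω) (hF : ContinuousOn F Ω) (h : DistribHessGE Ω F C)
    {a v : Eu n} (ha : a ∈ Metric.closedBall z₀ r) (hav : a + v ∈ Metric.closedBall z₀ r) :
    ConvexOn ℝ (Set.Icc (0 : ℝ) 1) fun t => F (a + t • v) + C / 2 * ‖v‖ ^ 2 * t ^ 2 := by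
  have hmoll : ∀ η > 0, ∃ g : ℝ → ℝ, ConvexOn ℝ (Set.Icc (0 : ℝ) 1) g ∧ ∀ t ∈ Set.Icc (0 : ℝ) 1,
      |g t - (F (a + t • v) + C / 2 * ‖v‖ ^ 2 * t ^ 2)| ≤ η := by
    intro η hη
    obtain ⟨ψ, hψ, hψc, hψ0, hψ1, g, g', hg, hI⟩ := exists_local_mollification hr hball hF ha hav hη
    refine ⟨fun t => g t + C / 2 * ‖v‖ ^ 2 * t ^ 2, ?_, fun t ht => ?_⟩
    · have hd : ∀ t, HasDerivAt (fun t => g t + C / 2 * ‖v‖ ^ 2 * t ^ 2)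
          (g' t + C * ‖v‖ ^ 2 * t) t := fun t => by
        refine ((hg t).add ((hasDerivAt_pow 2 t).const_mul _)).congr_deriv ?_
        simp only [Nat.cast_ofNat, Nat.add_one_sub_one, pow_one]
        ring
      refine convexOn_of_hasDerivWithinAt2_nonneg (convex_Icc 0 1)
        (fun t _ => (hd t).continuousAt.continuousWithinAt) (fun t _ => (hd t).hasDerivWithinAt)
        (f'' := fun t => (∫ z, F z * fderiv ℝ (fun y => fderiv ℝ (ψ t) y v) z v) + C * ‖v‖ ^ 2)
        (fun t ht => ?_) fun t ht => ?_
      · have ht' := interior_subset ht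
        refine (((hI t ht').2.2.2.add ((hasDerivAt_id t).const_mul _)).congr_deriv
          ?_).hasDerivWithinAt
        ring
      · obtain ⟨h1, -, -, -⟩ := hI t (interior_subset ht)
        have := h (ψ t) (hψ t) (hψc t) h1 (hψ0 t) v
        rw [hψ1] at this
        linarith
    · have := (hI t ht).2.1
      convert this using 2
      ring
  -- Convexity passes to the uniform limit: half of `η` is lost on each side of the inequality.
  refine ⟨convex_Icc 0 1, fun s hs t ht α β hα hβ hαβ => ?_⟩
  refine le_of_forall_pos_le_add fun η hη => ?_
  obtain ⟨g, hg, hgF⟩ := hmoll (η / 2) (half_pos hη)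
  have h1 := abs_le.1 (hgF s hs)
  have h2 := abs_le.1 (hgF t ht)
  have h3 := abs_le.1 (hgF _ (convex_Icc (0 : ℝ) 1 hs ht hα hβ hαβ))
  have h4 := hg.2 hs ht hα hβ hαβ
  have h5 := mul_le_mul_of_nonneg_left h1.2 hα
  have h6 := mul_le_mul_of_nonneg_left h2.2 hβ
  simp only [smul_eq_mul] at *
  have h7 : α * (η / 2) + β * (η / 2) = η / 2 := by rw [← add_mul, hαβ, one_mul]
  linarith [h3.1]

end Mollify

end OT

end

noncomputable section

namespace OT

open Filter

/-! ### Subgradients on Euclidean space. -/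

section Subgradients

variable {n : ℕ}

/-- The subgradients at `z` of a real function on Euclidean space. -/
def subgradients (F : Eu n → ℝ) (z : Eu n) : Set (Eu n →L[ℝ] ℝ) :=
  {q | ∀ ε : ℝ, 0 < ε → ∀ᶠ y in 𝓝 z, F z + q (y - z) ≤ F y + ε * ‖y - z‖}

variable {F : Eu n → ℝ} {z : Eu n}

lemma convex_subgradients (F : Eu n → ℝ) (z : Eu n) : Convex ℝ (subgradients F z) := by
  intro p hp q hq a b ha hb hab ε hε
  filter_upwards [hp ε hε, hq ε hε] with y h1 h2
  have h3 := mul_le_mul_of_nonneg_left h1 ha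
  have h4 := mul_le_mul_of_nonneg_left h2 hb
  have e : ∀ X : ℝ, a * X + b * X = X := fun X => by rw [← add_mul, hab, one_mul]
  have e1 := e (F z)
  have e2 := e (F y + ε * ‖y - z‖)
  simp only [add_apply, smul_apply, smul_eq_mul]
  linarith

lemma isClosed_subgradients (F : Eu n → ℝ) (z : Eu n) : IsClosed (subgradients F z) := by
  refine isClosed_of_closure_subset fun q hq ε hε => ?_
  obtain ⟨p, hp, hpq⟩ := Metric.mem_closure_iff.1 hq (ε / 2) (half_pos hε)
  filter_upwards [hp (ε / 2) (half_pos hε)] with y hy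
  have h1 : (q - p) (y - z) ≤ ε / 2 * ‖y - z‖ :=
    (le_abs_self _).trans (((q - p).le_opNorm _).trans (by
      gcongr; rw [← dist_eq_norm]; exact hpq.le))
  rw [sub_apply] at h1
  linarith

lemma subgradients_along_line {q : Eu n →L[ℝ] ℝ} (hq : q ∈ subgradients F z) (v : Eu n) {ε : ℝ}
    (hε : 0 < ε) : ∀ᶠ t : ℝ in 𝓝[>] 0, F z + t * q v ≤ F (z + t • v) + t * ε := by
  have h1 : Tendsto (fun t : ℝ => z + t • v) (𝓝[>] 0) (𝓝 z) := by
    have : Tendsto (fun t : ℝ => z + t • v) (𝓝 0) (𝓝 (z + (0 : ℝ) • v)) :=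
      (by fun_prop : Continuous fun t : ℝ => z + t • v).tendsto 0
    rw [zero_smul, add_zero] at this
    exact this.mono_left nhdsWithin_le_nhds
  have hv : 0 < ‖v‖ + 1 := by positivity
  filter_upwards [h1.eventually (hq (ε / (‖v‖ + 1)) (by positivity)), self_mem_nhdsWithin]
    with t ht ht0
  have ht0 : (0 : ℝ) < t := ht0
  rw [add_sub_cancel_left, map_smul, smul_eq_mul, norm_smul, Real.norm_of_nonneg ht0.le] at ht
  refine ht.trans (add_le_add le_rfl ?_)
  have h2 : ε / (‖v‖ + 1) * ‖v‖ ≤ ε := by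
    rw [div_mul_eq_mul_div, div_le_iff₀ hv]
    nlinarith [norm_nonneg v]
  nlinarith

/-- An upper bound along the ray in the direction `v` controls `q v`. Differentiability, Lipschitz
bounds and semiconvexity all act on subgradients through such a bound. -/
lemma subgradients_apply_le {q : Eu n →L[ℝ] ℝ} (hq : q ∈ subgradients F z) {v : Eu n} {b : ℝ → ℝ}
    {B : ℝ} (hb : Tendsto b (𝓝[>] 0) (𝓝 B))
    (h : ∀ᶠ t : ℝ in 𝓝[>] 0, F (z + t • v) ≤ F z + t * b t) : q v ≤ B := by
  refine le_of_forall_pos_le_add fun ε hε => ?_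
  refine ge_of_tendsto (hb.add_const ε) ?_
  filter_upwards [subgradients_along_line hq v hε, h, self_mem_nhdsWithin] with t h1 h2 ht
  have ht : (0 : ℝ) < t := ht
  refine le_of_mul_le_mul_left ?_ ht
  linarith

lemma subgradients_of_hasFDerivAt {L : Eu n →L[ℝ] ℝ} (h : HasFDerivAt F L z) :
    subgradients F z = {L} := by
  refine Set.Subset.antisymm (fun q hq => ?_) (Set.singleton_subset_iff.2 fun ε hε => ?_)
  · have hle : ∀ v, q v ≤ L v := by
      intro v
      have hd : HasDerivAt (fun t : ℝ => F (z + t • v)) (L v) 0 := h.hasLineDerivAt v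
      have hs := hasDerivAt_iff_tendsto_slope_zero.1 hd
      refine subgradients_apply_le hq
        (hs.mono_left (nhdsWithin_mono 0 fun t ht => ne_of_gt ht)) ?_
      filter_upwards [self_mem_nhdsWithin] with t ht
      have ht : t ≠ 0 := ne_of_gt ht
      simp [mul_inv_cancel_left₀ ht]
    refine ContinuousLinearMap.ext fun v => le_antisymm (hle v) ?_
    simpa using hle (-v)
  · filter_upwards [h.isLittleO.def hε] with y hy
    rw [Real.norm_eq_abs] at hy
    linarith [neg_abs_le (F y - F z - L (y - z))]

lemma norm_le_of_mem_subgradients {q : Eu n →L[ℝ] ℝ} (hq : q ∈ subgradients F z) {κ : ℝ}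
    (hκ : 0 ≤ κ) (h : ∀ᶠ y in 𝓝 z, |F y - F z| ≤ κ * ‖y - z‖) : ‖q‖ ≤ κ := by
  have hle : ∀ v, q v ≤ κ * ‖v‖ := by
    intro v
    refine subgradients_apply_le hq tendsto_const_nhds ?_
    have h1 : Tendsto (fun t : ℝ => z + t • v) (𝓝[>] 0) (𝓝 z) := by
      have : Tendsto (fun t : ℝ => z + t • v) (𝓝 0) (𝓝 (z + (0 : ℝ) • v)) :=
        (by fun_prop : Continuous fun t : ℝ => z + t • v).tendsto 0
      rw [zero_smul, add_zero] at this
      exact this.mono_left nhdsWithin_le_nhds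
    filter_upwards [h1.eventually h, self_mem_nhdsWithin] with t ht ht0
    rw [add_sub_cancel_left, norm_smul, Real.norm_of_nonneg (le_of_lt ht0)] at ht
    linarith [le_abs_self (F (z + t • v) - F z)]
  refine q.opNorm_le_bound hκ fun v => abs_le.2 ⟨?_, hle v⟩
  have := hle (-v)
  rw [map_neg, norm_neg] at this
  linarith

/-- Subgradients pull back under differentiable maps. -/
lemma comp_mem_subgradients {τ : Eu n → Eu n} {A : Eu n →L[ℝ] Eu n} (hτ : HasFDerivAt τ A z)
    {q : Eu n →L[ℝ] ℝ} (hq : q ∈ subgradients F (τ z)) :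
    q.comp A ∈ subgradients (fun y => F (τ y)) z := by
  intro ε hε
  have hK : 0 < ‖A‖ + 1 := by positivity
  have hQ : 0 < 2 * (‖q‖ + 1) := by positivity
  filter_upwards [hτ.continuousAt.eventually (hq (ε / (2 * (‖A‖ + 1))) (by positivity)),
    hτ.isLittleO.def one_pos, hτ.isLittleO.def (c := ε / (2 * (‖q‖ + 1))) (by positivity)]
    with y h1 h2 h3
  have h4 : ‖τ y - τ z‖ ≤ (‖A‖ + 1) * ‖y - z‖ := by
    have e : τ y - τ z = (τ y - τ z - A (y - z)) + A (y - z) := by abel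
    rw [e]
    refine (norm_add_le _ _).trans ((add_le_add h2 (A.le_opNorm _)).trans_eq ?_)
    ring
  have h5 : q (A (y - z)) ≤ q (τ y - τ z) + ε / 2 * ‖y - z‖ := by
    have h6 : |q (τ y - τ z - A (y - z))| ≤ ε / 2 * ‖y - z‖ := by
      refine (q.le_opNorm _).trans ?_
      calc ‖q‖ * ‖τ y - τ z - A (y - z)‖
          ≤ (‖q‖ + 1) * (ε / (2 * (‖q‖ + 1)) * ‖y - z‖) := by gcongr; linarith
        _ = ε / 2 * ‖y - z‖ := by field_simp
    rw [map_sub] at h6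
    linarith [neg_abs_le (q (τ y - τ z) - q (A (y - z)))]
  have h7 : ε / (2 * (‖A‖ + 1)) * ‖τ y - τ z‖ ≤ ε / 2 * ‖y - z‖ :=
    calc ε / (2 * (‖A‖ + 1)) * ‖τ y - τ z‖
        ≤ ε / (2 * (‖A‖ + 1)) * ((‖A‖ + 1) * ‖y - z‖) := by gcongr
      _ = ε / 2 * ‖y - z‖ := by field_simp
  change F (τ z) + q (A (y - z)) ≤ F (τ y) + ε * ‖y - z‖
  linarith

/-- The subgradient inequality for a function that is semiconvex along a segment. -/
lemma add_apply_le_of_semiconvex {v : Eu n} {κ : ℝ}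
    (hc : ConvexOn ℝ (Set.Icc (0 : ℝ) 1) fun t => F (z + t • v) + κ * t ^ 2)
    {q : Eu n →L[ℝ] ℝ} (hq : q ∈ subgradients F z) : F z + q v ≤ F (z + v) + κ := by
  suffices h : q v ≤ F (z + v) - F z + κ by linarith
  -- The bound given by the chord over `[0, 1]`, after subtracting `F z` and the quadratic term and
  -- dividing by `t`.
  have hb : Tendsto (fun t : ℝ => F (z + v) - F z + κ - κ * t) (𝓝[>] 0)
      (𝓝 (F (z + v) - F z + κ)) := by
    have : Tendsto (fun t : ℝ => F (z + v) - F z + κ - κ * t) (𝓝 0)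
        (𝓝 (F (z + v) - F z + κ - κ * 0)) :=
      (by fun_prop : Continuous fun t : ℝ => F (z + v) - F z + κ - κ * t).tendsto 0
    rw [mul_zero, sub_zero] at this
    exact this.mono_left nhdsWithin_le_nhds
  refine subgradients_apply_le hq hb ?_
  filter_upwards [Ioo_mem_nhdsGT (one_pos (α := ℝ))] with t ht
  have h := hc.2 (Set.left_mem_Icc.2 zero_le_one) (Set.right_mem_Icc.2 zero_le_one)
    (sub_nonneg.2 ht.2.le) ht.1.le (by ring : 1 - t + t = 1)
  simp only [smul_eq_mul, mul_zero, mul_one, zero_add, zero_smul, add_zero, one_smul] at h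
  nlinarith

end Subgradients

/-! ### Subdifferentials on the manifold, and their change of chart. -/

section Subdifferential

variable {n : ℕ} {M K K' : Type*} [TopologicalSpace M] [ChartedSpace (Eu n) M]
  {f : M → EReal} {x : M}

lemma mem_subdifferential_iff (hf : ∀ᶠ y in 𝓝 x, f y ≠ ⊥ ∧ f y ≠ ⊤) (q : Eu n →L[ℝ] ℝ) :
    q ∈ (subdifferential n f x : Set (Eu n →L[ℝ] ℝ)) ↔
      q ∈ subgradients (fun z => (f ((chartAt (Eu n) x).symm z)).toReal) (chartAt (Eu n) x x) := by
  have hx := mem_chart_source (Eu n) x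
  refine forall₂_congr fun ε _ => ?_
  rw [← (chartAt (Eu n) x).map_nhds_eq hx, eventually_map]
  refine eventually_congr ?_
  filter_upwards [hf, (chartAt (Eu n) x).open_source.mem_nhds hx] with y hy hys
  rw [(chartAt (Eu n) x).left_inv hys, (chartAt (Eu n) x).left_inv hx]
  rw [← EReal.coe_le_coe_iff, EReal.coe_add, EReal.coe_add, EReal.coe_toReal hy.2 hy.1,
    EReal.coe_toReal hf.self_of_nhds.2 hf.self_of_nhds.1]
  exact Iff.rfl

lemma subdifferential_eq_subgradients (hf : ∀ᶠ y in 𝓝 x, f y ≠ ⊥ ∧ f y ≠ ⊤) :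
    (subdifferential n f x : Set (Eu n →L[ℝ] ℝ)) =
      subgradients (fun z => (f ((chartAt (Eu n) x).symm z)).toReal) (chartAt (Eu n) x x) :=
  Set.ext (mem_subdifferential_iff hf)

/-- A function supporting another to first order has a smaller subdifferential. -/
lemma SupportsToFirstOrder.subdifferential_subset {i : M → K} {u f : K → EReal}
    (h : SupportsToFirstOrder n i u f x) :
    subdifferential n (fun y => f (i y)) x ⊆ subdifferential n (fun y => u (i y)) x := by
  intro q hq ε hε
  filter_upwards [hq (ε / 2) (half_pos hε), h.2.2 (ε / 2) (half_pos hε)] with y h1 h2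
  simp only [h.1]
  refine h1.trans ((add_le_add_left h2 _).trans_eq ?_)
  rw [add_assoc, ← EReal.coe_add]
  congr 2
  ring

end Subdifferential

section ChartChange

variable {n : ℕ} {M : Type*} [TopologicalSpace M] [ChartedSpace (Eu n) M]

lemma transition_contDiffAt [IsManifold 𝓘(ℝ, Eu n) ∞ M] {φ ψ : OpenPartialHomeomorph M (Eu n)}
    (hφ : φ ∈ IsManifold.maximalAtlas 𝓘(ℝ, Eu n) ∞ M)
    (hψ : ψ ∈ IsManifold.maximalAtlas 𝓘(ℝ, Eu n) ∞ M) {y : M} (hyφ : y ∈ φ.source)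
    (hyψ : y ∈ ψ.source) : ContDiffAt ℝ ∞ (fun z => ψ (φ.symm z)) (φ y) := by
  rw [← contMDiffAt_iff_contDiffAt]
  refine ContMDiffAt.comp (φ y) (I' := 𝓘(ℝ, Eu n)) (g := ψ) (f := φ.symm) ?_
    (contMDiffAt_symm_of_mem_maximalAtlas hφ (φ.map_source hyφ))
  rw [φ.left_inv hyφ]
  exact contMDiffAt_of_mem_maximalAtlas hψ hyψ

lemma subgradients_congr {F G : Eu n → ℝ} {z : Eu n} (h : F =ᶠ[𝓝 z] G) :
    subgradients F z = subgradients G z := by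
  refine Set.ext fun q => forall₂_congr fun ε _ => eventually_congr ?_
  filter_upwards [h] with y hy
  rw [hy, h.eq_of_nhds]

lemma eventually_transition_inverse {φ ψ : OpenPartialHomeomorph M (Eu n)} {y : M}
    (hyφ : y ∈ φ.source) (hyψ : y ∈ ψ.source) :
    ∀ᶠ z in 𝓝 (φ y), z ∈ φ.target ∧ ψ.symm (ψ (φ.symm z)) = φ.symm z := by
  rw [← φ.map_nhds_eq hyφ, eventually_map]
  filter_upwards [φ.open_source.mem_nhds hyφ, ψ.open_source.mem_nhds hyψ] with y' h1 h2
  rw [φ.left_inv h1, ψ.left_inv h2]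
  exact ⟨φ.map_source h1, rfl⟩

lemma transition_comp {φ ψ : OpenPartialHomeomorph M (Eu n)} {y : M}
    (hyφ : y ∈ φ.source) (hyψ : y ∈ ψ.source) {A B : Eu n →L[ℝ] Eu n}
    (hA : HasFDerivAt (fun z => ψ (φ.symm z)) A (φ y))
    (hB : HasFDerivAt (fun z => φ (ψ.symm z)) B (ψ y)) :
    B.comp A = ContinuousLinearMap.id ℝ (Eu n) := by
  have hB' : HasFDerivAt (fun z => φ (ψ.symm z)) B (ψ (φ.symm (φ y))) := by
    rwa [φ.left_inv hyφ]
  refine (hB'.comp (φ y) hA).unique ((hasFDerivAt_id (φ y)).congr_of_eventuallyEq ?_)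
  filter_upwards [eventually_transition_inverse hyφ hyψ] with z hz
  simp only [Function.comp, hz.2, φ.right_inv hz.1, id]

/-- Subdifferentials are subgradients in any chart of the maximal atlas. -/
lemma exists_subdifferential_iff [IsManifold 𝓘(ℝ, Eu n) ∞ M] {φ : OpenPartialHomeomorph M (Eu n)}
    (hφ : φ ∈ IsManifold.maximalAtlas 𝓘(ℝ, Eu n) ∞ M) {y : M} (hy : y ∈ φ.source) :
    ∃ A : Eu n ≃L[ℝ] Eu n, ∀ f : M → EReal, (∀ᶠ z in 𝓝 y, f z ≠ ⊥ ∧ f z ≠ ⊤) →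
      ∀ q : Eu n →L[ℝ] ℝ, q ∈ (subdifferential n f y : Set (Eu n →L[ℝ] ℝ)) ↔
        q.comp (A : Eu n →L[ℝ] Eu n) ∈ subgradients (fun z => (f (φ.symm z)).toReal) (φ y) := by
  set ψ := chartAt (Eu n) y with hψdef
  have hψ : ψ ∈ IsManifold.maximalAtlas 𝓘(ℝ, Eu n) ∞ M := IsManifold.chart_mem_maximalAtlas y
  have hyψ : y ∈ ψ.source := mem_chart_source _ y
  have hA := ((transition_contDiffAt hφ hψ hy hyψ).differentiableAt (by simp)).hasFDerivAt
  have hB := ((transition_contDiffAt hψ hφ hyψ hy).differentiableAt (by simp)).hasFDerivAt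
  set A := fderiv ℝ (fun z => ψ (φ.symm z)) (φ y)
  set B := fderiv ℝ (fun z => φ (ψ.symm z)) (ψ y)
  have hBA := transition_comp hy hyψ hA hB
  have hAB := transition_comp hyψ hy hB hA
  -- The equivalence is the derivative of the transition map, so one and the same `A` serves for `u`
  -- and for every mountain.
  refine ⟨ContinuousLinearEquiv.equivOfInverse A B (fun v => DFunLike.congr_fun hBA v)
    fun v => DFunLike.congr_fun hAB v, fun f hf q => ?_⟩
  rw [mem_subdifferential_iff hf]
  have e1 : subgradients (fun z => (f (ψ.symm (ψ (φ.symm z)))).toReal) (φ y)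
      = subgradients (fun z => (f (φ.symm z)).toReal) (φ y) :=
    subgradients_congr ((eventually_transition_inverse hy hyψ).mono fun z hz => by
      simp only [hz.2])
  have e2 : subgradients (fun z => (f (φ.symm (φ (ψ.symm z)))).toReal) (ψ y)
      = subgradients (fun z => (f (ψ.symm z)).toReal) (ψ y) :=
    subgradients_congr ((eventually_transition_inverse hyψ hy).mono fun z hz => by
      simp only [hz.2])
  constructor
  · intro hq
    rw [← e1]
    refine comp_mem_subgradients (F := fun z => (f (ψ.symm z)).toReal) hA ?_
    rw [φ.left_inv hy]
    exact hq
  · intro hq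
    have := comp_mem_subgradients (F := fun z => (f (φ.symm z)).toReal) hB
      (q := q.comp A) (by rw [ψ.left_inv hyψ]; exact hq)
    rw [e2, ContinuousLinearMap.comp_assoc, hAB, ContinuousLinearMap.comp_id] at this
    exact this

end ChartChange

/-! ### The extended exponential on the fibre over `x`. -/

section Fibre

variable {n : ℕ} {M M' K K' : Type*}
  [TopologicalSpace M] [ChartedSpace (Eu n) M] [TopologicalSpace M'] [ChartedSpace (Eu n) M']
  [TopologicalSpace K] [TopologicalSpace K'] [IsManifold 𝓘(ℝ, Eu n) ∞ M]
  [IsManifold 𝓘(ℝ, Eu n) ∞ M']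
  {i : M → K} {i' : M' → K'} {c : K → K' → EReal} {N : Set (M × M')}

lemma mountain_toReal {a : K} {w : K'} (h : c a w ≠ ⊤) (h' : c a w ≠ ⊥) (lam : ℝ) :
    (mountain c w lam a).toReal = -(c a w).toReal + lam := by
  lift c a w to ℝ using ⟨h, h'⟩ with r hr
  rw [mountain, ← hr]
  norm_cast

lemma mountain_finite_iff {a : K} {w : K'} (lam : ℝ) :
    (mountain c w lam a ≠ ⊥ ∧ mountain c w lam a ≠ ⊤) ↔ (c a w ≠ ⊥ ∧ c a w ≠ ⊤) := by
  rw [mountain]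
  induction c a w with
  | bot => simp
  | top => simp
  | coe r =>
    exact iff_of_true (And.intro (EReal.coe_ne_bot (-r + lam)) (EReal.coe_ne_top (-r + lam)))
      (And.intro (EReal.coe_ne_bot _) (EReal.coe_ne_top _))

lemma subdifferential_mountain_of_mem (hN : IsOpen N) (hA0 : SmoothOn n i i' c N)
    (hc_bot : ∀ a w, c a w ≠ ⊥) {x : M} {w : M'} (h : (x, w) ∈ N) (lam : ℝ) :
    subdifferential n (fun z => mountain c (i' w) lam (i z)) x = {negDc n i c x (i' w)} := by
  have hnear : ∀ᶠ y in 𝓝 x, (y, w) ∈ N :=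
    (Continuous.prodMk_left w).continuousAt.eventually (hN.mem_nhds h)
  have hfin : ∀ᶠ y in 𝓝 x, mountain c (i' w) lam (i y) ≠ ⊥ ∧ mountain c (i' w) lam (i y) ≠ ⊤ :=
    hnear.mono fun y hy => (mountain_finite_iff lam).2 ⟨hc_bot _ _, (hA0.1 _ hy).ne⟩
  refine (subdifferential_eq_subgradients hfin).trans ?_
  have hx := mem_chart_source (Eu n) x
  have heq : (fun z => (mountain c (i' w) lam (i ((chartAt (Eu n) x).symm z))).toReal)
      =ᶠ[𝓝 (chartAt (Eu n) x x)]
      fun z => -(c (i ((chartAt (Eu n) x).symm z)) (i' w)).toReal + lam := by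
    rw [EventuallyEq, ← (chartAt (Eu n) x).map_nhds_eq hx, eventually_map]
    filter_upwards [hnear, (chartAt (Eu n) x).open_source.mem_nhds hx] with y hy hys
    rw [(chartAt (Eu n) x).left_inv hys]
    exact mountain_toReal (hA0.1 _ hy).ne (hc_bot _ _) lam
  rw [subgradients_congr heq]
  refine (subgradients_of_hasFDerivAt
    (((slice_differentiableAt hN hA0 h hx).hasFDerivAt.neg).add_const lam)).trans ?_
  rw [← negDc_eq_fderiv hN hA0 h]
  rfl

lemma cost_mdifferentiableAt (hN : IsOpen N) (hA0 : SmoothOn n i i' c N) {x : M} {w : M'}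
    (h : (x, w) ∈ N) :
    MDifferentiableAt 𝓘(ℝ, Eu n) 𝓘(ℝ, ℝ) (fun y : M => (c (i y) (i' w)).toReal) x := by
  have hc := (hA0.2 _ h).contMDiffAt (hN.mem_nhds h)
  exact (ContMDiffAt.comp x (f := fun y : M => (y, w)) hc
    (contMDiffAt_id.prodMk contMDiffAt_const)).mdifferentiableAt (by simp)

variable {X : CotangentBundle n M → K'}

/-- The inclusion of the fibre is continuous, so the closure of the domain within the fibre lies
over `x` in the closure of the domain in the bundle. `D` names the domain as a set in the normed
space of covectors. -/
lemma continuousOn_fibre (hX : ContinuousOn X (closure (domCExp n i i' c N))) {x : M}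
    {D : Set (Eu n →L[ℝ] ℝ)} (hD : D = domCExpAt n i i' c N x) :
    ContinuousOn (fun q : Eu n →L[ℝ] ℝ => X ⟨x, q⟩) (closure D) := by
  subst hD
  have hcont : Continuous fun q : Eu n →L[ℝ] ℝ => (⟨x, q⟩ : CotangentBundle n M) :=
    FiberBundle.continuous_totalSpaceMk (F := Eu n →L[ℝ] ℝ) (E := fun x : M => Cotangent n x) x
  exact hX.comp hcont.continuousOn fun q hq => map_mem_closure hcont hq fun p hp => hp

/-- Where `c(·, i' w)` is differentiable the subdifferential of the mountain is one covector, which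
is then extreme. So `X` extends the cost exponential. -/
lemma exp_negDc (hN : IsOpen N) (hA0 : SmoothOn n i i' c N) (hc_bot : ∀ a w, c a w ≠ ⊥)
    (hX : ∀ (w : K') (lam : ℝ) (y : M), c (i y) w < ⊤ →
      ∀ q ∈ Set.extremePoints ℝ (subdifferential n (fun z => mountain c w lam (i z)) y),
        (⟨y, q⟩ : CotangentBundle n M) ∈ closure (domCExp n i i' c N) ∧ X ⟨y, q⟩ = w)
    {x : M} {w : M'} (h : (x, w) ∈ N) : X ⟨x, negDc n i c x (i' w)⟩ = i' w := by
  refine (hX (i' w) 0 x (hA0.1 _ h) _ ?_).2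
  rw [subdifferential_mountain_of_mem hN hA0 hc_bot h, extremePoints_singleton]
  exact Set.mem_singleton _

/-- The cost is finite at the exponentials of covectors in the closure of the domain. -/
lemma cost_ne_top_of_mem_closure (hN : IsOpen N) (hA0 : SmoothOn n i i' c N)
    (hc_cont : Continuous fun p : K × K' => c p.1 p.2) (hblow : GradientBlowup n i c) {x : M}
    {D : Set (Eu n →L[ℝ] ℝ)} (hD : D = domCExpAt n i i' c N x)
    {E : (Eu n →L[ℝ] ℝ) → K'} (hEc : ContinuousOn E (closure D))
    (hE : ∀ w, (x, w) ∈ N → E (negDc n i c x (i' w)) = i' w) {q : Eu n →L[ℝ] ℝ}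
    (hq : q ∈ closure D) : c (i x) (E q) ≠ ⊤ := by
  intro htop
  obtain ⟨p, hp, hpq⟩ := mem_closure_iff_seq_limit.1 hq
  choose w hw hwp using fun k => hD.subset (hp k)
  have hEp : ∀ k, E (p k) = i' (w k) := fun k =>
    (congrArg E (hwp k).symm).trans (hE (w k) (hw k))
  have h1 : Tendsto (fun k => i' (w k)) atTop (𝓝 (E q)) := by
    simp only [← hEp]
    exact (hEc q hq).tendsto.comp (tendsto_nhdsWithin_iff.2 ⟨hpq, .of_forall fun k =>
      subset_closure (hp k)⟩)
  have h2 : Tendsto (fun k => c (i x) (i' (w k))) atTop (𝓝 ⊤) := by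
    rw [← htop]
    exact ((hc_cont.comp (Continuous.prodMk_right (i x))).tendsto (E q)).comp h1
  -- If the cost were infinite at the limit, the norms of the derivatives at the fixed point `x`
  -- would diverge; but they converge to the norm of `q`.
  have h3 := hblow (fun _ => x) (fun k => i' (w k)) x (E q) (fun k => hA0.1 _ (hw k))
    (fun k => cost_mdifferentiableAt hN hA0 (hw k)) tendsto_const_nhds h1 h2
  refine not_tendsto_atTop_of_tendsto_nhds hpq.norm (h3.congr fun k => ?_)
  have h4 := (negDc_eq_fderiv hN hA0 (hw k)).symm.trans (hwp k)
  rw [← norm_neg, h4]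

end Fibre

/-! ### Uniform estimates for mountains and their limits. -/

section Bounds

variable {n : ℕ} {M K K' : Type*} [TopologicalSpace M] [TopologicalSpace K] [TopologicalSpace K']
  {i : M → K} {c : K → K' → EReal} {φ : OpenPartialHomeomorph M (Eu n)} {C : ℝ} {w : K'} {lam : ℝ}

lemma BoundsInChart.cost_ne_top (hB : BoundsInChart i φ C (mountain c w lam)) {y : M}
    (hy : y ∈ φ.source) : c (i y) w ≠ ⊤ :=
  ((mountain_finite_iff lam).1 (hB.1 y hy)).2

lemma BoundsInChart.toReal_eq (hB : BoundsInChart i φ C (mountain c w lam))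
    (hc_bot : ∀ a w, c a w ≠ ⊥) {z : Eu n} (hz : z ∈ φ.target) :
    (mountain c w lam (i (φ.symm z))).toReal = -(c (i (φ.symm z)) w).toReal + lam :=
  mountain_toReal (hB.cost_ne_top (φ.map_target hz)) (hc_bot _ _) lam

lemma BoundsInChart.continuousOn (hB : BoundsInChart i φ C (mountain c w lam))
    (hi : Continuous i) (hc_bot : ∀ a w, c a w ≠ ⊥)
    (hc_cont : Continuous fun p : K × K' => c p.1 p.2) :
    ContinuousOn (fun z => (mountain c w lam (i (φ.symm z))).toReal) φ.target := by
  have h : ContinuousOn (fun z => -(c (i (φ.symm z)) w).toReal + lam) φ.target := by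
    refine fun z hz => ContinuousAt.continuousWithinAt ?_
    have h1 : ContinuousAt (fun z => c (i (φ.symm z)) w) z :=
      ((hc_cont.comp (Continuous.prodMk_left w)).comp hi).continuousAt.comp
        (φ.symm.continuousAt hz)
    have h2 := EReal.tendsto_toReal (hB.cost_ne_top (φ.map_target hz)) (hc_bot _ w)
    exact ((h2.comp h1.tendsto).neg).add_const lam
  exact h.congr fun z hz => hB.toReal_eq hc_bot hz

lemma BoundsInChart.abs_sub_le (hB : BoundsInChart i φ C (mountain c w lam))
    (hi : Continuous i) (hc_bot : ∀ a w, c a w ≠ ⊥)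
    (hc_cont : Continuous fun p : K × K' => c p.1 p.2) {z₀ : Eu n} {r : ℝ} (hr : 0 < r)
    (hball : Metric.closedBall z₀ (2 * r) ⊆ φ.target) {a b : Eu n}
    (ha : a ∈ Metric.closedBall z₀ r) (hb : b ∈ Metric.closedBall z₀ r) :
    |(c (i (φ.symm b)) w).toReal - (c (i (φ.symm a)) w).toReal| ≤ |C| * ‖b - a‖ := by
  have h := abs_sub_le_of_distribGradLE hr hball (hB.continuousOn hi hc_bot hc_cont) hB.2.1 ha hb
  have hsub : Metric.closedBall z₀ r ⊆ φ.target :=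
    (Metric.closedBall_subset_closedBall (by linarith)).trans hball
  rw [hB.toReal_eq hc_bot (hsub ha), hB.toReal_eq hc_bot (hsub hb)] at h
  rw [← abs_neg]
  refine (le_of_eq ?_).trans (h.trans (by gcongr; exact le_abs_self C))
  congr 1
  ring

lemma BoundsInChart.norm_subgradient_le (hB : BoundsInChart i φ C (mountain c w lam))
    (hi : Continuous i) (hc_bot : ∀ a w, c a w ≠ ⊥)
    (hc_cont : Continuous fun p : K × K' => c p.1 p.2) {z : Eu n} (hz : z ∈ φ.target)
    {q : Eu n →L[ℝ] ℝ}
    (hq : q ∈ subgradients (fun z => (mountain c w lam (i (φ.symm z))).toReal) z) : ‖q‖ ≤ |C| := by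
  obtain ⟨R, hR, hRs⟩ := Metric.nhds_basis_closedBall.mem_iff.1 (φ.open_target.mem_nhds hz)
  refine norm_le_of_mem_subgradients hq (abs_nonneg C) ?_
  filter_upwards [Metric.closedBall_mem_nhds z (half_pos hR)] with y hy
  have h := abs_sub_le_of_distribGradLE (half_pos hR) (by rwa [mul_div_cancel₀ R two_ne_zero])
    (hB.continuousOn hi hc_bot hc_cont) hB.2.1 (Metric.mem_closedBall_self (half_pos hR).le) hy
  exact h.trans (by gcongr; exact le_abs_self C)

lemma BoundsInChart.add_subgradient_le (hB : BoundsInChart i φ C (mountain c w lam))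
    (hi : Continuous i) (hc_bot : ∀ a w, c a w ≠ ⊥)
    (hc_cont : Continuous fun p : K × K' => c p.1 p.2) {z₀ : Eu n} {r : ℝ} (hr : 0 < r)
    (hball : Metric.closedBall z₀ (2 * r) ⊆ φ.target) {a b : Eu n}
    (ha : a ∈ Metric.closedBall z₀ r) (hb : b ∈ Metric.closedBall z₀ r) {q : Eu n →L[ℝ] ℝ}
    (hq : q ∈ subgradients (fun z => (mountain c w lam (i (φ.symm z))).toReal) a) :
    (c (i (φ.symm b)) w).toReal - (c (i (φ.symm a)) w).toReal + q (b - a)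
      ≤ C / 2 * ‖b - a‖ ^ 2 := by
  have h := add_apply_le_of_semiconvex (convexOn_of_distribHessGE hr hball
    (hB.continuousOn hi hc_bot hc_cont) hB.2.2 ha (v := b - a) (by simpa using hb)) hq
  have hsub : Metric.closedBall z₀ r ⊆ φ.target :=
    (Metric.closedBall_subset_closedBall (by linarith)).trans hball
  rw [add_sub_cancel, hB.toReal_eq hc_bot (hsub ha), hB.toReal_eq hc_bot (hsub hb)] at h
  linarith

/-- A quadratic error with a uniform constant survives a limit of mountains; the `o`-error in the
definition of a subgradient need not. -/
lemma mem_subgradients_of_quadratic {F : Eu n → ℝ} {z : Eu n} {q : Eu n →L[ℝ] ℝ} {κ : ℝ}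
    (h : ∀ᶠ y in 𝓝 z, F z + q (y - z) ≤ F y + κ * ‖y - z‖ ^ 2) : q ∈ subgradients F z := by
  intro ε hε
  have h1 : Tendsto (fun y : Eu n => κ * ‖y - z‖) (𝓝 z) (𝓝 (κ * ‖z - z‖)) :=
    (by fun_prop : Continuous fun y : Eu n => κ * ‖y - z‖).tendsto z
  rw [sub_self, norm_zero, mul_zero] at h1
  filter_upwards [h, h1.eventually (gt_mem_nhds hε)] with y h2 h3
  refine h2.trans (add_le_add le_rfl ?_)
  rw [pow_two, ← mul_assoc]
  exact mul_le_mul_of_nonneg_right h3.le (norm_nonneg _)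

variable [ChartedSpace (Eu n) M] [IsManifold 𝓘(ℝ, Eu n) ∞ M]

/-- Limits of foci of mountains with uniform bounds near `x` have finite cost at `x`. -/
lemma cost_ne_top_of_tendsto (hi : Continuous i) (hc_bot : ∀ a w, c a w ≠ ⊥)
    (hc_cont : Continuous fun p : K × K' => c p.1 p.2) (hblow : GradientBlowup n i c)
    (hφ : φ ∈ IsManifold.maximalAtlas 𝓘(ℝ, Eu n) ∞ M) {x : M} (hx : x ∈ φ.source)
    {w : ℕ → K'} {lam : ℕ → ℝ} (hB : ∀ k, BoundsInChart i φ C (mountain c (w k) (lam k))) {w' : K'}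
    (hw : Tendsto w atTop (𝓝 w')) : c (i x) w' ≠ ⊤ := by
  intro htop
  obtain ⟨R, hR, hRs⟩ := Metric.nhds_basis_closedBall.mem_iff.1
    (φ.open_target.mem_nhds (φ.map_source hx))
  set r := R / 2 with hrdef
  have hr : 0 < r := half_pos hR
  have hball : Metric.closedBall (φ x) (2 * r) ⊆ φ.target := by
    rwa [hrdef, mul_div_cancel₀ R two_ne_zero]
  set ψ := chartAt (Eu n) x with hψdef
  have hψ : ψ ∈ IsManifold.maximalAtlas 𝓘(ℝ, Eu n) ∞ M := IsManifold.chart_mem_maximalAtlas x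
  have hxψ : x ∈ ψ.source := mem_chart_source _ x
  have hτ := transition_contDiffAt hψ hφ hxψ hx
  -- `GradientBlowup` measures gradients in the preferred chart at `x`, the bounds are given in `φ`;
  -- a Lipschitz constant of the transition map compares them.
  obtain ⟨L, S, hS, hLip⟩ := (hτ.of_le (m := 1) (by simp)).exists_lipschitzOnWith
  have hτb : ∀ᶠ z in 𝓝 (ψ x), φ (ψ.symm z) ∈ Metric.closedBall (φ x) r := by
    refine hτ.continuousAt.eventually ?_
    simp only
    rw [ψ.left_inv hxψ]
    exact Metric.closedBall_mem_nhds _ hr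
  have hsrc : ∀ᶠ z in 𝓝 (ψ x), ψ.symm z ∈ φ.source := by
    refine (ψ.symm.continuousAt (ψ.map_source hxψ)).eventually ?_
    rw [ψ.left_inv hxψ]
    exact φ.open_source.mem_nhds hx
  have htgt : ∀ᶠ z in 𝓝 (ψ x), z ∈ ψ.target := ψ.open_target.mem_nhds (ψ.map_source hxψ)
  obtain ⟨ρ, hρ, hρs⟩ := Metric.eventually_nhds_iff_ball.1 (hτb.and (hsrc.and (htgt.and hS)))
  let H : ℕ → Eu n → ℝ := fun k z => (c (i (ψ.symm z)) (w k)).toReal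
  have hH : ∀ k, LipschitzOnWith (Real.toNNReal |C| * L) (H k) (Metric.ball (ψ x) ρ) := by
    intro k
    refine LipschitzOnWith.of_dist_le_mul fun a ha b hb => ?_
    obtain ⟨ha1, ha2, -, ha4⟩ := hρs a ha
    obtain ⟨hb1, hb2, -, hb4⟩ := hρs b hb
    have h1 := (hB k).abs_sub_le hi hc_bot hc_cont hr hball hb1 ha1
    rw [φ.left_inv ha2, φ.left_inv hb2, ← Real.dist_eq, ← dist_eq_norm] at h1
    refine h1.trans ?_
    rw [NNReal.coe_mul, Real.coe_toNNReal _ (abs_nonneg C), mul_assoc]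
    exact mul_le_mul_of_nonneg_left (hLip.dist_le_mul a ha4 b hb4) (abs_nonneg C)
  -- Blow-up concerns points of differentiability, while the costs are only known to be Lipschitz
  -- near `x`. Rademacher's theorem provides such points within `ρ / (k + 1)` of `x`, and their
  -- bounded gradients contradict blow-up.
  have hex : ∀ k : ℕ, ∃ z ∈ Metric.ball (ψ x) (ρ / (k + 1)), DifferentiableAt ℝ (H k) z := by
    intro k
    have hsub : Metric.ball (ψ x) (ρ / (k + 1)) ⊆ Metric.ball (ψ x) ρ :=
      Metric.ball_subset_ball (div_le_self hρ.le (by linarith [k.cast_nonneg (α := ℝ)]))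
    have hd := MeasureTheory.Measure.dense_of_ae
      ((hH k).ae_differentiableWithinAt_of_mem (μ := MeasureTheory.volume))
    obtain ⟨z, hz1, hz2⟩ := hd.exists_mem_open Metric.isOpen_ball
      (Metric.nonempty_ball (x := ψ x).2 (by positivity : 0 < ρ / (k + 1)))
    exact ⟨z, hz2, (hz1 (hsub hz2)).differentiableAt (Metric.isOpen_ball.mem_nhds (hsub hz2))⟩
  choose z hz hzd using hex
  have hzρ : ∀ k, z k ∈ Metric.ball (ψ x) ρ := fun k =>
    Metric.ball_subset_ball (div_le_self hρ.le (by linarith [k.cast_nonneg (α := ℝ)])) (hz k)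
  have hzx : Tendsto z atTop (𝓝 (ψ x)) := by
    rw [tendsto_iff_dist_tendsto_zero]
    refine squeeze_zero (fun k => dist_nonneg) (fun k => (Metric.mem_ball.1 (hz k)).le) ?_
    have := (tendsto_one_div_add_atTop_nhds_zero_nat (𝕜 := ℝ)).const_mul ρ
    simpa [div_eq_mul_inv] using this
  have hyx : Tendsto (fun k => ψ.symm (z k)) atTop (𝓝 x) := by
    have := (ψ.symm.continuousAt (ψ.map_source hxψ)).tendsto.comp hzx
    rwa [ψ.left_inv hxψ] at this
  have hblow' := hblow (fun k => ψ.symm (z k)) w x w'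
    (fun k => lt_top_iff_ne_top.2 ((hB k).cost_ne_top (hρs _ (hzρ k)).2.1)) (fun k => ?_) hyx hw ?_
  · refine not_tendsto_atTop_of_tendsto_nhds (tendsto_const_nhds (x := |C| * L))
      (tendsto_atTop_mono (fun k => ?_) hblow')
    rw [ψ.right_inv (hρs _ (hzρ k)).2.2.1]
    have := norm_fderiv_le_of_lipschitzOn ℝ (Metric.isOpen_ball.mem_nhds (hzρ k)) (hH k)
    rwa [NNReal.coe_mul, Real.coe_toNNReal _ (abs_nonneg C)] at this
  · have hsy : ψ.symm (z k) ∈ ψ.source := ψ.map_target (hρs _ (hzρ k)).2.2.1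
    have h1 : MDifferentiableAt 𝓘(ℝ, Eu n) 𝓘(ℝ, Eu n) ψ (ψ.symm (z k)) :=
      (contMDiffAt_of_mem_maximalAtlas hψ hsy).mdifferentiableAt (by simp)
    have h2 : MDifferentiableAt 𝓘(ℝ, Eu n) 𝓘(ℝ, ℝ) (H k) (ψ (ψ.symm (z k))) := by
      rw [ψ.right_inv (hρs _ (hzρ k)).2.2.1]
      exact (hzd k).mdifferentiableAt
    refine (h2.comp (ψ.symm (z k)) h1).congr_of_eventuallyEq ?_
    filter_upwards [ψ.open_source.mem_nhds hsy] with y hy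
    simp only [H, Function.comp, ψ.left_inv hy]
  · rw [← htop]
    exact (hc_cont.tendsto (i x, w')).comp (((hi.tendsto x).comp hyx).prodMk_nhds hw)

end Bounds

/-! ### Subgradients of `u` dominated by those of mountains in contact. -/

section Tangential

variable {n : ℕ} {M K K' : Type*} [TopologicalSpace M] [TopologicalSpace K] [TopologicalSpace K']
  {i : M → K} {c : K → K' → EReal} {φ : OpenPartialHomeomorph M (Eu n)} {C : ℝ} {u : K → EReal}

lemma toReal_le_of_mem_contactSet (hc_bot : ∀ a w, c a w ≠ ⊥) (hu : ∀ a, u a ≠ ⊥) {a b : K}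
    {w : K'} (hw : w ∈ contactSet c u a) (ha : u a ≠ ⊤) (hb : u b ≠ ⊤) (hcb : c b w ≠ ⊤) :
    (u a).toReal + (c a w).toReal ≤ (u b).toReal + (c b w).toReal := by
  have h := hw.2 b
  rwa [← EReal.coe_toReal ha (hu a), ← EReal.coe_toReal hw.1.ne (hc_bot _ _),
    ← EReal.coe_toReal hb (hu b), ← EReal.coe_toReal hcb (hc_bot _ _), ← EReal.coe_add,
    ← EReal.coe_add, EReal.coe_le_coe_iff] at h

/-- The mountain through a contact point supports `u` to first order there. -/
lemma supportsToFirstOrder_of_mem_contactSet [ChartedSpace (Eu n) M] (hc_bot : ∀ a w, c a w ≠ ⊥)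
    (hu : ∀ a, u a ≠ ⊥) {y : M} {w : K'} (hw : w ∈ contactSet c u (i y)) (hy : u (i y) ≠ ⊤) :
    SupportsToFirstOrder n i u (mountain c w ((u (i y)).toReal + (c (i y) w).toReal)) y := by
  have hval : ∀ b, mountain c w ((u (i y)).toReal + (c (i y) w).toReal) b
      = normalized c (i y) w b + u (i y) := fun b => by
    rw [mountain, normalized, EReal.coe_add, EReal.coe_toReal hy (hu _),
      EReal.coe_toReal hw.1.ne (hc_bot _ _), add_comm (u (i y)), add_assoc]
  have hle := ((mem_contactSet_iff hc_bot hu hy).1 hw).2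
  refine ⟨?_, lt_top_iff_ne_top.2 hy, fun ε hε => .of_forall fun z => ?_⟩
  · rw [hval, normalized_eq_coe hc_bot hw.1.ne hw.1.ne, sub_self, EReal.coe_zero, zero_add]
  · rw [hval]
    refine (hle (i z)).trans (le_add_of_nonneg_right ?_)
    exact_mod_cast mul_nonneg hε.le (norm_nonneg _)

variable [CompactSpace K'] [FirstCountableTopology K'] [ChartedSpace (Eu n) M]
  [IsManifold 𝓘(ℝ, Eu n) ∞ M]

/-- In each direction, each subgradient of `u` is dominated by a subgradient of a mountain
in contact. -/
lemma exists_contact_subgradient (hi : Continuous i) (hc_bot : ∀ a w, c a w ≠ ⊥)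
    (hc_cont : Continuous fun p : K × K' => c p.1 p.2) (hblow : GradientBlowup n i c)
    (hφ : φ ∈ IsManifold.maximalAtlas 𝓘(ℝ, Eu n) ∞ M) {x : M} (hx : x ∈ φ.source)
    (hu : ∀ a, u a ≠ ⊥) (hfin : ∀ y ∈ φ.source, u (i y) ≠ ⊤)
    (hne : ∀ y ∈ φ.source, (contactSet c u (i y)).Nonempty)
    (hB : ∀ y ∈ φ.source, ∀ w ∈ contactSet c u (i y),
      BoundsInChart i φ C (mountain c w ((u (i y)).toReal + (c (i y) w).toReal)))
    (hsub : ∀ y ∈ φ.source, ∀ w ∈ contactSet c u (i y),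
      (subgradients (fun z => (mountain c w ((u (i y)).toReal + (c (i y) w).toReal)
        (i (φ.symm z))).toReal) (φ y)).Nonempty)
    {q : Eu n →L[ℝ] ℝ} (hq : q ∈ subgradients (fun z => (u (i (φ.symm z))).toReal) (φ x))
    (e : Eu n) :
    ∃ w ∈ contactSet c u (i x), ∃ p ∈ subgradients (fun z =>
      (mountain c w ((u (i x)).toReal + (c (i x) w).toReal) (i (φ.symm z))).toReal) (φ x),
      q e ≤ p e := by
  obtain ⟨R, hR, hRs⟩ := Metric.nhds_basis_closedBall.mem_iff.1
    (φ.open_target.mem_nhds (φ.map_source hx))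
  set r := R / 2 with hrdef
  have hr : 0 < r := half_pos hR
  have hball : Metric.closedBall (φ x) (2 * r) ⊆ φ.target := by
    rwa [hrdef, mul_div_cancel₀ R two_ne_zero]
  have hsubt : Metric.closedBall (φ x) r ⊆ φ.target :=
    (Metric.closedBall_subset_closedBall (by linarith)).trans hball
  have hx0 : φ x ∈ Metric.closedBall (φ x) r := Metric.mem_closedBall_self hr.le
  -- a sequence of contact points approaching `x` from the direction `e`
  let t : ℕ → ℝ := fun k => r / (‖e‖ + 1) * (1 / (k + 1))
  have ht0 : ∀ k, 0 < t k := fun k => by positivity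
  have htlim : Tendsto t atTop (𝓝 0) := by
    have := (tendsto_one_div_add_atTop_nhds_zero_nat (𝕜 := ℝ)).const_mul (r / (‖e‖ + 1))
    rwa [mul_zero] at this
  have htlim' : Tendsto t atTop (𝓝[>] 0) :=
    tendsto_nhdsWithin_iff.2 ⟨htlim, .of_forall ht0⟩
  let z : ℕ → Eu n := fun k => φ x + t k • e
  have hzball : ∀ k, z k ∈ Metric.closedBall (φ x) r := by
    intro k
    rw [mem_closedBall_iff_norm, add_sub_cancel_left, norm_smul, Real.norm_of_nonneg (ht0 k).le]
    have h1 : 1 / ((k : ℝ) + 1) ≤ 1 := by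
      rw [div_le_one (by positivity)]; linarith [k.cast_nonneg (α := ℝ)]
    calc r / (‖e‖ + 1) * (1 / ((k : ℝ) + 1)) * ‖e‖ ≤ r / (‖e‖ + 1) * 1 * (‖e‖ + 1) := by
          gcongr; linarith
      _ = r := by field_simp
  have hys : ∀ k, φ.symm (z k) ∈ φ.source := fun k => φ.map_target (hsubt (hzball k))
  choose w hw using fun k => hne _ (hys k)
  choose p hp using fun k => hsub _ (hys k) (w k) (hw k)
  have hBk := fun k => hB _ (hys k) (w k) (hw k)
  have hp' : ∀ k, p k ∈ subgradients (fun z' => (mountain c (w k)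
      ((u (i (φ.symm (z k)))).toReal + (c (i (φ.symm (z k))) (w k)).toReal)
        (i (φ.symm z'))).toReal) (z k) := fun k => by
    have := hp k
    rwa [φ.right_inv (hsubt (hzball k))] at this
  have hpC : ∀ k, p k ∈ Metric.closedBall (0 : Eu n →L[ℝ] ℝ) |C| := fun k =>
    mem_closedBall_zero_iff.2
      ((hBk k).norm_subgradient_le hi hc_bot hc_cont (hsubt (hzball k)) (hp' k))
  -- The gradient bound confines the subgradients to a compact ball, and the foci lie in the compact
  -- `cl M'`.
  obtain ⟨⟨p', w'⟩, -, s, hs, hlim⟩ := ((isCompact_closedBall (0 : Eu n →L[ℝ] ℝ) |C|).prod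
    (isCompact_univ (X := K'))).tendsto_subseq (x := fun k => (p k, w k))
    fun k => ⟨hpC k, trivial⟩
  have hplim : Tendsto (fun k => p (s k)) atTop (𝓝 p') := (continuous_fst.tendsto _).comp hlim
  have hwlim : Tendsto (fun k => w (s k)) atTop (𝓝 w') := (continuous_snd.tendsto _).comp hlim
  have hts : Tendsto (fun k => t (s k)) atTop (𝓝 0) := htlim.comp hs.tendsto_atTop
  have hzs : Tendsto (fun k => z (s k)) atTop (𝓝 (φ x)) := by
    simpa using (hts.smul_const e).const_add (φ x)
  have hcx : c (i x) w' ≠ ⊤ :=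
    cost_ne_top_of_tendsto hi hc_bot hc_cont hblow hφ hx (fun k => hBk (s k)) hwlim
  -- comparison of the values of `u` at `x` and along the sequence
  have hupper : ∀ k, (u (i (φ.symm (z k)))).toReal
      ≤ (u (i x)).toReal + t k * p k e + C / 2 * (t k * ‖e‖) ^ 2 := by
    intro k
    have h1 := (hBk k).add_subgradient_le hi hc_bot hc_cont hr hball (hzball k) hx0 (hp' k)
    have h2 := toReal_le_of_mem_contactSet hc_bot hu (hw k) (hfin _ (hys k)) (hfin x hx)
      ((hBk k).cost_ne_top hx)
    have e1 : φ x - z k = -(t k • e) := by simp only [z]; abel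
    rw [e1, map_neg, map_smul, norm_neg, norm_smul, Real.norm_of_nonneg (ht0 k).le, smul_eq_mul,
      φ.left_inv hx] at h1
    linarith
  have hlower : ∀ ε > 0, ∀ᶠ k in atTop, (u (i x)).toReal + t (s k) * q e
      ≤ (u (i (φ.symm (z (s k))))).toReal + t (s k) * ε := fun ε hε => by
    have := (htlim'.comp hs.tendsto_atTop).eventually (subgradients_along_line hq e hε)
    simpa only [φ.left_inv hx, Function.comp_apply] using this
  have hpe : Tendsto (fun k => p (s k) e) atTop (𝓝 (p' e)) :=
    ((ContinuousLinearMap.apply ℝ ℝ e).continuous.tendsto p').comp hplim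
  -- The mountain in contact at the `k`-th point bounds `u(x)` below, while `q` bounds `u` below at
  -- that point. Together, after division by the step length, they give `q e ≤ p_k e` up to
  -- vanishing terms.
  have hle : q e ≤ p' e := by
    refine le_of_forall_pos_le_add fun ε hε => ?_
    have hl : Tendsto (fun k => p (s k) e + C / 2 * ‖e‖ ^ 2 * t (s k) + ε) atTop
        (𝓝 (p' e + C / 2 * ‖e‖ ^ 2 * 0 + ε)) := (hpe.add (hts.const_mul _)).add_const ε
    rw [mul_zero, add_zero] at hl
    refine ge_of_tendsto hl ((hlower ε hε).mono fun k hk => ?_)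
    refine le_of_mul_le_mul_left ?_ (ht0 (s k))
    have := hupper (s k)
    linarith
  -- Contact at `x` in the limit needs convergence of the values of `u`; it comes from squeezing
  -- between the two comparisons.
  have hUlim : Tendsto (fun k => (u (i (φ.symm (z (s k))))).toReal) atTop
      (𝓝 (u (i x)).toReal) := by
    have l1 : Tendsto (fun k => (u (i x)).toReal + t (s k) * q e - t (s k) * 1) atTop
        (𝓝 ((u (i x)).toReal + 0 * q e - 0 * 1)) :=
      ((hts.mul_const _).const_add _).sub (hts.mul_const _)
    have l2 : Tendsto (fun k => (u (i x)).toReal + t (s k) * p (s k) e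
        + C / 2 * (t (s k) * ‖e‖) ^ 2) atTop
        (𝓝 ((u (i x)).toReal + 0 * p' e + C / 2 * (0 * ‖e‖) ^ 2)) :=
      ((hts.mul hpe).const_add _).add (((hts.mul_const _).pow 2).const_mul _)
    simp only [zero_mul, add_zero, sub_zero, ne_eq, OfNat.ofNat_ne_zero, not_false_eq_true,
      zero_pow, mul_zero] at l1 l2
    refine tendsto_of_tendsto_of_tendsto_of_le_of_le' l1 l2
      ((hlower 1 one_pos).mono fun k hk => by linarith) (.of_forall fun k => hupper (s k))
  have hylim : Tendsto (fun k => φ.symm (z (s k))) atTop (𝓝 x) := by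
    have := (φ.symm.continuousAt (φ.map_source hx)).tendsto.comp hzs
    rwa [φ.left_inv hx] at this
  have hclim : Tendsto (fun k => c (i (φ.symm (z (s k)))) (w (s k))) atTop (𝓝 (c (i x) w')) :=
    (hc_cont.tendsto (i x, w')).comp (((hi.tendsto x).comp hylim).prodMk_nhds hwlim)
  have hclim' : ∀ b, Tendsto (fun k => c b (w (s k))) atTop (𝓝 (c b w')) := fun b =>
    (hc_cont.tendsto (b, w')).comp (tendsto_const_nhds.prodMk_nhds hwlim)
  have hcontact : w' ∈ contactSet c u (i x) := by
    refine (mem_contactSet_iff hc_bot hu (hfin x hx)).2 ⟨hcx, fun b => ?_⟩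
    have hUlim' : Tendsto (fun k => u (i (φ.symm (z (s k))))) atTop (𝓝 (u (i x))) := by
      rw [← EReal.coe_toReal (hfin x hx) (hu _)]
      exact ((continuous_coe_real_ereal.tendsto _).comp hUlim).congr fun k =>
        EReal.coe_toReal (hfin _ (hys _)) (hu _)
    have h1 : Tendsto (fun k => normalized c (i (φ.symm (z (s k)))) (w (s k)) b) atTop
        (𝓝 (normalized c (i x) w' b)) :=
      (EReal.continuousAt_add (p := (-c b w', c (i x) w')) (Or.inr (hc_bot _ _))
        (Or.inr hcx)).tendsto.comp (((continuous_neg.tendsto _).comp (hclim' b)).prodMk_nhds hclim)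
    have h2 : Tendsto (fun k => normalized c (i (φ.symm (z (s k)))) (w (s k)) b
        + u (i (φ.symm (z (s k))))) atTop (𝓝 (normalized c (i x) w' b + u (i x))) :=
      (EReal.continuousAt_add (p := (normalized c (i x) w' b, u (i x))) (Or.inr (hu _))
        (Or.inr (hfin x hx))).tendsto.comp (h1.prodMk_nhds hUlim')
    exact le_of_tendsto' h2 fun k =>
      ((mem_contactSet_iff hc_bot hu (hfin _ (hys _))).1 (hw (s k))).2 b
  -- The semiconvex inequality for `p_k` has the same constant `C / 2` for all `k`, so it passes to
  -- the limit and makes `p'` a subgradient of the limiting mountain.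
  refine ⟨w', hcontact, p', mem_subgradients_of_quadratic (κ := C / 2) ?_, hle⟩
  have hB' := hB x hx w' hcontact
  filter_upwards [Metric.closedBall_mem_nhds (φ x) hr] with y hy
  rw [hB'.toReal_eq hc_bot (hsubt hx0), hB'.toReal_eq hc_bot (hsubt hy), φ.left_inv hx]
  have l1 := (EReal.tendsto_toReal (hB'.cost_ne_top (φ.map_target (hsubt hy)))
    (hc_bot _ _)).comp (hclim' (i (φ.symm y)))
  have l2 := (EReal.tendsto_toReal hcx (hc_bot _ _)).comp hclim
  have l3 : Tendsto (fun k => y - z (s k)) atTop (𝓝 (y - φ x)) := hzs.const_sub y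
  have l4 : Tendsto (fun k => p (s k) (y - z (s k))) atTop (𝓝 (p' (y - φ x))) :=
    (isBoundedBilinearMap_apply.continuous.tendsto (p', y - φ x)).comp (hplim.prodMk_nhds l3)
  have := le_of_tendsto_of_tendsto' ((l1.sub l2).add l4) ((l3.norm.pow 2).const_mul (C / 2))
    fun k => (hBk (s k)).add_subgradient_le hi hc_bot hc_cont hr hball (hzball (s k)) hy
      (hp' (s k))
  linarith

end Tangential

/-! ### Separation of covectors by vectors. -/

section Separation

variable {n : ℕ}

lemma eq_sum_proj (p : Eu n →L[ℝ] ℝ) :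
    p = ∑ j, p (EuclideanSpace.single j 1) • (EuclideanSpace.proj j : Eu n →L[ℝ] ℝ) := by
  refine ContinuousLinearMap.coe_injective
    ((EuclideanSpace.basisFun (Fin n) ℝ).toBasis.ext fun k => ?_)
  simp

/-- A covector dominated in each direction by an element of a closed convex set belongs to it. -/
lemma mem_of_forall_exists_apply_le {G : Set (Eu n →L[ℝ] ℝ)} (hGc : IsClosed G)
    (hGv : Convex ℝ G) {q : Eu n →L[ℝ] ℝ} (h : ∀ e, ∃ p ∈ G, q e ≤ p e) : q ∈ G := by
  by_contra hq
  obtain ⟨f, b, hfq, hfG⟩ := geometric_hahn_banach_point_closed hGv hGc hq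
  -- In finite dimensions a functional on covectors is evaluation at a vector.
  have hf : ∀ p : Eu n →L[ℝ] ℝ, f p =
      p (∑ j, f (EuclideanSpace.proj j : Eu n →L[ℝ] ℝ) • EuclideanSpace.single j (1 : ℝ)) := by
    intro p
    conv_lhs => rw [eq_sum_proj p]
    simp only [map_sum, map_smul, smul_eq_mul]
    exact Finset.sum_congr rfl fun j _ => mul_comm _ _
  -- Hahn–Banach places `q` on the lower side of `G`; the minus sign turns the domination in `h`
  -- against this.
  obtain ⟨p, hp, hle⟩ :=
    h (-∑ j, f (EuclideanSpace.proj j : Eu n →L[ℝ] ℝ) • EuclideanSpace.single j (1 : ℝ))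
  rw [map_neg, map_neg, ← hf, ← hf] at hle
  linarith [hfG p hp]

end Separation

/-! ### Compactness of the subdifferentials of mountains. -/

section Compactness

variable {n : ℕ} {M K K' : Type*} [TopologicalSpace M] [ChartedSpace (Eu n) M]
  [IsManifold 𝓘(ℝ, Eu n) ∞ M] [TopologicalSpace K] [TopologicalSpace K']
  {i : M → K} {c : K → K' → EReal} {φ : OpenPartialHomeomorph M (Eu n)} {C : ℝ}

lemma BoundsInChart.eventually_finite {f : K → EReal} (hB : BoundsInChart i φ C f) {y : M}
    (hy : y ∈ φ.source) : ∀ᶠ z in 𝓝 y, f (i z) ≠ ⊥ ∧ f (i z) ≠ ⊤ := by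
  filter_upwards [φ.open_source.mem_nhds hy] with z hz using hB.1 z hz

/-- Boundedness is the gradient bound in `φ`, carried to the preferred chart by the derivative of
the transition map. Compactness makes extreme points exist and Krein–Milman applicable. -/
lemma BoundsInChart.isCompact_convex_subdifferential {w : K'} {lam : ℝ}
    (hB : BoundsInChart i φ C (mountain c w lam)) (hi : Continuous i)
    (hc_bot : ∀ a w, c a w ≠ ⊥) (hc_cont : Continuous fun p : K × K' => c p.1 p.2)
    (hφ : φ ∈ IsManifold.maximalAtlas 𝓘(ℝ, Eu n) ∞ M) {x : M} (hx : x ∈ φ.source)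
    {S : Set (Eu n →L[ℝ] ℝ)} (hS : S = subdifferential n (fun z => mountain c w lam (i z)) x) :
    IsCompact S ∧ Convex ℝ S := by
  have hfin := hB.eventually_finite hx
  have hS' := hS.trans (subdifferential_eq_subgradients hfin)
  obtain ⟨A, hA⟩ := exists_subdifferential_iff hφ hx
  refine ⟨Metric.isCompact_of_isClosed_isBounded (hS' ▸ isClosed_subgradients _ _)
    (Metric.isBounded_closedBall.subset
      (t := Metric.closedBall 0 (|C| * ‖(A.symm : Eu n →L[ℝ] Eu n)‖)) fun q hq => ?_),
    hS' ▸ convex_subgradients _ _⟩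
  have h1 := (hA _ hfin q).1 (hS ▸ hq)
  have h2 := hB.norm_subgradient_le hi hc_bot hc_cont (φ.map_source hx) h1
  rw [mem_closedBall_zero_iff]
  have e : q = (q.comp (A : Eu n →L[ℝ] Eu n)).comp (A.symm : Eu n →L[ℝ] Eu n) := by
    ext v; simp
  rw [e]
  exact (ContinuousLinearMap.opNorm_comp_le _ _).trans (by gcongr)

end Compactness

end OT

end

/-! ### From support to first order to contact. -/

theorem theoremA8 {n : ℕ} {M M' K K' : Type*}
    [TopologicalSpace M] [ChartedSpace (Eu n) M] [IsManifold 𝓘(ℝ, Eu n) ∞ M]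
    [TopologicalSpace M'] [ChartedSpace (Eu n) M'] [IsManifold 𝓘(ℝ, Eu n) ∞ M']
    [TopologicalSpace K] [CompactSpace K] [TopologicalSpace.MetrizableSpace K]
    [TopologicalSpace K'] [CompactSpace K'] [TopologicalSpace.MetrizableSpace K']
    (i : M → K) (hi : Topology.IsEmbedding i) (hid : DenseRange i)
    (i' : M' → K') (hi' : Topology.IsEmbedding i') (hid' : DenseRange i')
    (c : K → K' → EReal) (hc_bot : ∀ a w, c a w ≠ ⊥)
    (hc_cont : Continuous fun p : K × K' => c p.1 p.2)
    (N : Set (M × M')) (hN : IsOpen N)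
    (hA0 : OT.SmoothOn n i i' c N)
    (hA1 : OT.Twisted n i i' c N)
    (hA3w : OT.WeaklyRegular n i i' c N)
    (hconv : OT.HorizontallyConvex n i i' c N)
    (hblow : OT.GradientBlowup n i c)
    (x : M)
    (hx : OT.AppearsConvexFrom n i i' c N x (Set.univ : Set K'))
    (hdense : ∀ (w : ℝ → M') (w₀ w₁ : K'),
      OT.IsGeodesicOn n i i' c N (fun t => (x, w t)) (Set.Ioo 0 1) →
      Filter.Tendsto (fun t => i' (w t)) (𝓝[>] 0) (𝓝 w₀) →
      Filter.Tendsto (fun t => i' (w t)) (𝓝[<] 1) (𝓝 w₁) →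
      Dense (⋂ t ∈ Set.Ioo (0 : ℝ) 1, OT.visibleTo N (w t)))
    (u : K → EReal) (hu : OT.IsCConvex i c (Set.univ : Set K') u)
    (φ : OpenPartialHomeomorph M (Eu n))
    (hφ : φ ∈ IsManifold.maximalAtlas 𝓘(ℝ, Eu n) ∞ M) (hxφ : x ∈ φ.source)
    (hU : ∀ y ∈ φ.source, u (i y) < ⊤ ∧ (OT.contactSet c u (i y)).Nonempty)
    (C : ℝ)
    (hbounds : ∀ y ∈ φ.source, ∀ (w : K') (lam : ℝ),
      OT.SupportsToFirstOrder n i u (OT.mountain c w lam) y →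
      OT.BoundsInChart i φ C (OT.mountain c w lam))
    (hA1' : OT.ExtendedTwist n i i' c N)
    (hfibre : ∀ (w : K') (lam : ℝ), c (i x) w < ⊤ →
      Set.extremePoints ℝ (OT.subdifferential n (fun z => OT.mountain c w lam (i z)) x)
        ⊆ closure (OT.domCExpAt n i i' c N x))
    (w : K') (lam : ℝ)
    (hfirst : OT.SupportsToFirstOrder n i u (OT.mountain c w lam) x) :
    ∀ a : K, OT.mountain c w lam a ≤ u a := by

  obtain ⟨hu_bot, -, -⟩ := hu
  obtain ⟨hne, X, hXc, hX⟩ := hA1'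
  have hic := hi.continuous
  have hufin : ∀ y ∈ φ.source, u (i y) ≠ ⊤ := fun y hy => (hU y hy).1.ne
  -- the cost exponential on the fibre over `x`
  obtain ⟨D, hD⟩ : ∃ D : Set (Eu n →L[ℝ] ℝ), D = OT.domCExpAt n i i' c N x := ⟨_, rfl⟩
  obtain ⟨E, hEdef⟩ : ∃ E : (Eu n →L[ℝ] ℝ) → K', E = fun q => X ⟨x, q⟩ := ⟨_, rfl⟩
  have hEc : ContinuousOn E (closure D) := hEdef ▸ OT.continuousOn_fibre hXc hD
  have hE : ∀ w, (x, w) ∈ N → E (OT.negDc n i c x (i' w)) = i' w := fun w hw => by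
    rw [hEdef]
    exact OT.exp_negDc hN hA0 hc_bot hX hw
  have hEfin : ∀ q ∈ closure D, c (i x) (E q) ≠ ⊤ := fun q hq =>
    OT.cost_ne_top_of_mem_closure hN hA0 hc_cont hblow hD hEc hE hq
  obtain ⟨hGc, hGv⟩ := OT.isClosed_convex_contact hc_bot hc_cont hu_bot (hufin x hxφ) hEc hEfin
    fun t ht q₀ hq₀ q₁ hq₁ => by
      rw [hD] at hq₀ hq₁ ⊢
      exact OT.sliding_on_domCExpAt hi hid hi' hc_bot hc_cont hN hA0 hA1 hA3w hconv hx hdense hE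
        hq₀ hq₁ ht
  set G : Set (Eu n →L[ℝ] ℝ) := {q | q ∈ closure D ∧ E q ∈ OT.contactSet c u (i x)} with hG
  -- Extreme subgradients remember the focus: the closure in the fibre comes from `hfibre`, the
  -- value of the exponential from the extended twist.
  have hext : ∀ (w : K') (lam : ℝ), c (i x) w < ⊤ → ∀ S : Set (Eu n →L[ℝ] ℝ),
      S = OT.subdifferential n (fun z => OT.mountain c w lam (i z)) x →
      ∀ q ∈ Set.extremePoints ℝ S, q ∈ closure D ∧ E q = w := by
    intro w lam hw S hS q hq
    rw [hS] at hq
    refine ⟨?_, ?_⟩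
    · rw [hD]; exact hfibre w lam hw hq
    · rw [hEdef]; exact (hX w lam x hw q hq).2
  -- mountains in contact with `u`
  have hB : ∀ y ∈ φ.source, ∀ w ∈ OT.contactSet c u (i y), OT.BoundsInChart i φ C
      (OT.mountain c w ((u (i y)).toReal + (c (i y) w).toReal)) := fun y hy w hw =>
    hbounds y hy w _ (OT.supportsToFirstOrder_of_mem_contactSet hc_bot hu_bot hw (hufin y hy))
  have hKM : ∀ w ∈ OT.contactSet c u (i x), ∀ S : Set (Eu n →L[ℝ] ℝ),
      S = OT.subdifferential n (fun z =>
        OT.mountain c w ((u (i x)).toReal + (c (i x) w).toReal) (i z)) x → S ⊆ G := by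
    intro w hw S hS
    obtain ⟨hSc, hSv⟩ := (hB x hxφ w hw).isCompact_convex_subdifferential hic hc_bot hc_cont hφ
      hxφ hS
    -- Krein–Milman: the extreme points lie in `G`, which is closed and convex.
    rw [← closure_convexHull_extremePoints hSc hSv]
    refine closure_minimal (convexHull_min (fun q hq => ?_) hGv) hGc
    obtain ⟨h1, h2⟩ := hext w _ hw.1 S hS q hq
    exact ⟨h1, h2.symm ▸ hw⟩
  -- the subdifferential of `u` at `x` consists of covectors in contact
  have hsubu : ∀ q : Eu n →L[ℝ] ℝ,
      q ∈ (OT.subdifferential n (fun y => u (i y)) x : Set (Eu n →L[ℝ] ℝ)) → q ∈ G := by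
    intro q hq
    refine OT.mem_of_forall_exists_apply_le hGc hGv fun e => ?_
    obtain ⟨A, hA⟩ := OT.exists_subdifferential_iff hφ hxφ
    have hqA := (hA (fun y => u (i y)) (by
      filter_upwards [φ.open_source.mem_nhds hxφ] with y hy using ⟨hu_bot _, hufin y hy⟩) q).1 hq
    -- `A.symm e` is the direction `e` expressed in the chart `φ`.
    obtain ⟨w', hw', p, hp, hle⟩ := OT.exists_contact_subgradient hic hc_bot hc_cont hblow hφ hxφ
      hu_bot hufin (fun y hy => (hU y hy).2) hB (fun y hy w hw => by
        obtain ⟨A, hA⟩ := OT.exists_subdifferential_iff hφ hy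
        obtain ⟨p, hp⟩ := hne w ((u (i y)).toReal + (c (i y) w).toReal) y hw.1
        exact ⟨_, (hA _ ((hB y hy w hw).eventually_finite hy) p).1 hp⟩) hqA (A.symm e)
    refine ⟨p.comp (A.symm : Eu n →L[ℝ] Eu n), hKM w' hw' _ rfl ?_, ?_⟩
    · refine (hA _ ((hB x hxφ w' hw').eventually_finite hxφ) _).2 ?_
      convert hp using 1
      ext v; simp
    · simpa using hle
  -- the given mountain
  have hw : c (i x) w < ⊤ := by
    refine lt_top_iff_ne_top.2 fun h => hu_bot (i x) ?_
    rw [hfirst.1, OT.mountain, h]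
    simp
  obtain ⟨S, hS⟩ : ∃ S : Set (Eu n →L[ℝ] ℝ),
      S = OT.subdifferential n (fun z => OT.mountain c w lam (i z)) x := ⟨_, rfl⟩
  obtain ⟨hSc, -⟩ := (hbounds x hxφ w lam hfirst).isCompact_convex_subdifferential hic hc_bot
    hc_cont hφ hxφ hS
  -- One extreme point suffices: its exponential is `w`, and membership in `G` puts that exponential
  -- in contact.
  obtain ⟨q, hq⟩ := hSc.extremePoints_nonempty (hS ▸ hne w lam x hw)
  have hqu : q ∈ G := hsubu q (hfirst.subdifferential_subset (hS ▸ hq.1))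
  have hwcontact : w ∈ OT.contactSet c u (i x) := (hext w lam hw S hS q hq).2 ▸ hqu.2
  intro a
  refine le_of_eq_of_le ?_
    (((OT.mem_contactSet_iff hc_bot hu_bot (hufin x hxφ)).1 hwcontact).2 a)
  rw [hfirst.1, OT.mountain, OT.mountain, OT.normalized, ← EReal.coe_toReal hw.ne (hc_bot _ _),
    add_assoc, ← add_assoc (((c (i x) w).toReal : ℝ) : EReal)]
  norm_cast
  simp
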